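/- Let $\mathbb{T}=\mathbb{R}/2\pi\mathbb{Z}$, let $\|\cdot\|$ be the norm of $L^2(\mathbb{T}\times\mathbb{R})$, and let $X$ be the space of real $f$ with $\|f\|_X^2=\|f\|^2+\|yf\|^2<\infty$. Put $\delta_0=512^{-1/4}$, $\varepsilon_0=\delta_0/4$, $\alpha_0=4\delta_0^3$, $\gamma_0=\delta_0/4$ and $C_0=(3e(1+2\alpha_0\varepsilon_0))^{1/2}$. Then $\varepsilon_0\ge\frac1{20}$, and the following holds. Let $0<\nu\le 1$ and let $(\omega,\psi)$ be a solution with $\omega\in C([0,\infty);X)$, in the sense of distributions, of the linearization of the 2D Navier--Stokes equations at the Poiseuille flow, $$\partial_t\omega+y^2\partial_x\omega-2\partial_x\psi=\nu\Delta\omega,\qquad \Delta\psi=\omega\qquad\text{on }\mathbb{T}\times\mathbb{R},$$ where $\psi(t)$ is locally integrable and its nonzero $x$-frequencies belong to $H^1$ for every $t\ge0$ (no $H^1$ regularity of the initial datum $\omega(0)\in X$ is required). For an integer $k\ge1$ let $\omega_k,\psi_k$ be the projections of $\omega,\psi$ to the $x$-frequencies $\pm k$, i.e. $f_k(x,y)=\sum_{|l|=k}a_l(y)e^{ilx}$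 with $a_l(y)=\frac1{2\pi}\int_{\mathbb{T}}f(x,y)e^{-ilx}\,dx$, and let $$Q_k(t)=\tfrac12\|\omega_k(t)\|^2+\tfrac{\gamma_0}{4}\left[\|y\,\omega_k(t)\|^2+2\|\nabla\psi_k(t)\|^2\right],\qquad \lambda_{\nu,k}=\frac{\nu^{1/2}|k|^{1/2}}{1+|\log\nu|+\log|k|}.$$ Then for every $k\ge1$ $$Q_k(t)\le C_0^2\,Q_k(0)\,e^{-2\varepsilon_0\lambda_{\nu,k}t},\qquad t\ge0.$$ -/

import Mathlib

open MeasureTheory Filter Topology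

noncomputable section

namespace Poiseuille

/-- The cylinder `𝕋 × ℝ`, `𝕋 = ℝ / 2πℤ`, is represented by its fundamental strip
`(0, 2π] × ℝ`; this is Lebesgue measure on it. Points are `p = (x, y)`. -/
def cyl : Measure (ℝ × ℝ) :=
  volume.restrict (Set.Ioc (0 : ℝ) (2 * Real.pi) ×ˢ (Set.univ : Set ℝ))

/-- Classical partial derivative in `x`. -/
def dx (φ : ℝ × ℝ → ℝ) (p : ℝ × ℝ) : ℝ := deriv (fun x => φ (x, p.2)) p.1

/-- Classical partial derivative in `y`. -/
def dy (φ : ℝ × ℝ → ℝ) (p : ℝ × ℝ) : ℝ := deriv (fun y => φ (p.1, y)) p.2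

/-- Classical Laplacian. -/
def lap (φ : ℝ × ℝ → ℝ) (p : ℝ × ℝ) : ℝ := dx (dx φ) p + dy (dy φ) p

/-- Test functions on `𝕋 × ℝ`: smooth, `2π`-periodic in `x`, compactly supported in `y`. -/
structure IsTest (φ : ℝ × ℝ → ℝ) : Prop where
  smooth : ContDiff ℝ ((⊤ : ℕ∞) : WithTop ℕ∞) φ
  periodic : ∀ x y : ℝ, φ (x + 2 * Real.pi, y) = φ (x, y)
  compact : ∃ R : ℝ, ∀ x y : ℝ, R < |y| → φ (x, y) = 0

/-- `‖f‖²` in `L²(𝕋 × ℝ)`. -/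
def normSq (f : ℝ × ℝ → ℝ) : ℝ := ∫ p, f p ^ 2 ∂cyl

/-- Multiplication by `y`. -/
def mulY (f : ℝ × ℝ → ℝ) (p : ℝ × ℝ) : ℝ := p.2 * f p

/-- Membership in the weighted space `X`, i.e. `f, y f ∈ L²(𝕋 × ℝ)`. -/
def MemX (f : ℝ × ℝ → ℝ) : Prop := MemLp f 2 cyl ∧ MemLp (mulY f) 2 cyl

/-- `‖f‖_X² = ‖f‖² + ‖y f‖²`. -/
def normXSq (f : ℝ × ℝ → ℝ) : ℝ := normSq f + normSq (mulY f)

/-- `g ∈ L²(𝕋 × ℝ)` is the weak derivative `∂ₓ f`. -/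
def IsWeakDx (f g : ℝ × ℝ → ℝ) : Prop :=
  MemLp g 2 cyl ∧ ∀ φ, IsTest φ → ∫ p, f p * dx φ p ∂cyl = -∫ p, g p * φ p ∂cyl

/-- `g ∈ L²(𝕋 × ℝ)` is the weak derivative `∂_y f`. -/
def IsWeakDy (f g : ℝ × ℝ → ℝ) : Prop :=
  MemLp g 2 cyl ∧ ∀ φ, IsTest φ → ∫ p, f p * dy φ p ∂cyl = -∫ p, g p * φ p ∂cyl

/-- The Sobolev space `H¹(𝕋 × ℝ)`. -/
def MemH1 (f : ℝ × ℝ → ℝ) : Prop :=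
  MemLp f 2 cyl ∧ (∃ g, IsWeakDx f g) ∧ ∃ g, IsWeakDy f g

open Classical in
/-- The weak derivative `∂ₓ f` (it is unique almost everywhere). -/
def weakDx (f : ℝ × ℝ → ℝ) : ℝ × ℝ → ℝ := if h : ∃ g, IsWeakDx f g then h.choose else 0

open Classical in
/-- The weak derivative `∂_y f` (it is unique almost everywhere). -/
def weakDy (f : ℝ × ℝ → ℝ) : ℝ × ℝ → ℝ := if h : ∃ g, IsWeakDy f g then h.choose else 0

/-- `‖∇ f‖²`, used for `f ∈ H¹` only. -/
def gradNormSq (f : ℝ × ℝ → ℝ) : ℝ := normSq (weakDx f) + normSq (weakDy f)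

/-- The Fourier coefficient `a_l(y) = (2π)⁻¹ ∫_𝕋 f(x, y) e^{-ilx} dx`. -/
def fourierCoef (l : ℤ) (f : ℝ × ℝ → ℝ) (y : ℝ) : ℂ :=
  (1 / (2 * Real.pi) : ℂ) *
    ∫ x in (0 : ℝ)..(2 * Real.pi), (f (x, y) : ℂ) * Complex.exp (-(Complex.I * l * x))

/-- The band `f_k(x, y) = ∑_{|l| = k} a_l(y) e^{ilx}`. For real `f` the sum is real, so that
taking the real part only changes its type. -/
def band (k : ℕ) (f : ℝ × ℝ → ℝ) (p : ℝ × ℝ) : ℝ :=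
  (∑ l ∈ ({(k : ℤ), -(k : ℤ)} : Finset ℤ),
    fourierCoef l f p.2 * Complex.exp (Complex.I * l * p.1)).re

/-- `(ω, ψ)` is a global solution, with data `ω(0) ∈ X`, of the linearization at the Poiseuille
flow, `∂ₜω + y² ∂ₓω - 2 ∂ₓψ = ν Δω`, `Δψ = ω` on `𝕋 × ℝ`: `ω ∈ C([0, ∞); X)`, both equations
hold in the sense of distributions, and every nonzero `x`-frequency of `ψ` has finite energy
(which makes it `Δ⁻¹` of the corresponding frequency of `ω`; the zero frequency of `ψ`
does not enter the first equation). -/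
structure IsSolution (ν : ℝ) (ω ψ : ℝ → ℝ × ℝ → ℝ) : Prop where
  memX : ∀ t, 0 ≤ t → MemX (ω t)
  cont : ∀ t, 0 ≤ t →
    Tendsto (fun s => normXSq (fun p => ω s p - ω t p)) (𝓝[Set.Ici 0] t) (𝓝 0)
  stream_locInt : ∀ t, 0 ≤ t → ∀ R : ℝ,
    IntegrableOn (ψ t) (Set.Ioc (0 : ℝ) (2 * Real.pi) ×ˢ Set.Icc (-R) R)
  stream_H1 : ∀ t, 0 ≤ t → ∀ k : ℕ, 1 ≤ k → MemH1 (band k (ψ t))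
  stream_eq : ∀ t, 0 ≤ t → ∀ φ, IsTest φ →
    ∫ p, ψ t p * lap φ p ∂cyl = ∫ p, ω t p * φ p ∂cyl
  vort_eq : ∀ t, 0 ≤ t → ∀ φ, IsTest φ →
    ∫ p, ω t p * φ p ∂cyl - ∫ p, ω 0 p * φ p ∂cyl =
      ∫ s in (0 : ℝ)..t,
        ∫ p, (ω s p * (p.2 ^ 2 * dx φ p + ν * lap φ p) - 2 * (ψ s p * dx φ p)) ∂cyl

/-- The universal constants of the hypocoercivity scheme: `δ₀⁴ = 1/512`, `ε₀ = δ₀/4`,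
`α₀ = 4δ₀³`, `γ₀ = δ₀/4`. -/
def δ₀ : ℝ := (1 / 512 : ℝ) ^ (1 / 4 : ℝ)

/-- See `δ₀`. -/
def ε₀ : ℝ := δ₀ / 4

/-- See `δ₀`. -/
def α₀ : ℝ := 4 * δ₀ ^ 3

/-- See `δ₀`. -/
def γ₀ : ℝ := δ₀ / 4

/-- `C₀ = (3e(1 + 2α₀ε₀))^{1/2}`. -/
def C₀ : ℝ := Real.sqrt (3 * Real.exp 1 * (1 + 2 * α₀ * ε₀))

/-- `λ_{ν,k} = ν^{1/2} |k|^{1/2} / (1 + |log ν| + log |k|)`. -/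
def rate (ν : ℝ) (k : ℕ) : ℝ :=
  Real.sqrt ν * Real.sqrt k / (1 + |Real.log ν| + Real.log k)

/-- `Q_k = ½‖ω_k‖² + (γ₀/4) (‖y ω_k‖² + 2‖∇ψ_k‖²)`. -/
def Q (k : ℕ) (ω ψ : ℝ × ℝ → ℝ) : ℝ :=
  1 / 2 * normSq (band k ω) +
    γ₀ / 4 * (normSq (mulY (band k ω)) + 2 * gradNormSq (band k ψ))

end Poiseuille

end

/-! The problem decouples into the Fourier modes in `x`. For the frequency `k`, with `U` and `B` the
coefficients of `ω` and `ψ`, the equations are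
`∂ₜU = ν (U'' - k² U) - i k y² U + 2 i k B` and `B'' - k² B = U` on the line (`IsModeSolution`,
`IsSolution.exists_isModeSolution`), and by Plancherel `Q_k` is `4π` times an energy `modeEnergy` of
the mode (`Q_eq`); identifying `‖∇ψ_k‖²` rests on the uniqueness of weak derivatives on the
cylinder, which is Parseval's identity in almost every fiber.

The solution is only weak, and no moment or derivative beyond `U, y U ∈ L²` is given. Averaging over
time intervals of length `h` makes the time derivative `P` a continuous curve in `L²`, with
`y P ∈ L²`; a second average makes `U'` differentiable in time as well. At a fixed time the equation
is then an ODE for `U` with right-hand side in `L²`, and it is the equation itself that gives the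
regularity in space: pairing it with `U` gives `U' ∈ L²` (`IsEvo.exists_deriv`), pairing it
with `y² U - 2 B`, for which the transport terms cancel, gives `y U' ∈ L²`
(`exists_mulY_deriv`), and expanding `‖ν U'' - i k y² U‖²`, whose cross term is
an exact derivative up to lower order terms, gives `U'', y² U ∈ L²` (`exists_second_deriv`). Each of
these is an instance of `integrable_of_WD_add`: if `h' = q + r` with `q ≥ 0`, `r` integrable and `h`
small at infinity on average, then `q` is integrable and there is no boundary term.

For such regular solutions all computations are exact identities between `L²` inner products
(`IsEvo.identities`), and yield the decay at rate `√(ν k)` of the hypocoercive functional `hypo`,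
`½ (‖U‖² + α ‖U'‖² + 2 β ⟨i y U, U'⟩ + γ (‖y U‖² + 2 ‖∇B‖²))`. The term with `β` produces the
missing dissipation `-2 k ‖y U‖² - 4 k ‖B'‖²`; here the nonlocal contribution has the good sign
because of the Pohozaev identity `IsStream.inner_mulY`. The uncertainty principle
`‖U‖² ≤ 2 ‖y U‖ ‖U'‖` then controls `‖U‖` (`hypo_dissipation`).

The functional involves `U'`, which the datum does not control, and its weights are those of the
energy only up to the factor `√(k/ν)`. The first defect is repaired by starting at a time `t₀` of
order `1 / √(ν k)` at which the viscous dissipation bounds `‖U'‖` (`IsRegularCurve.exists_time`).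
The second is repaired by monotonicity of the energy: the factor is the exponential of
`½ (|log ν| + log k)`, and is absorbed on passing from the rate `√(ν k)` to `λ_{ν,k}`
(`decay_with_log`). Since the energy contains no derivative of `U`, the estimate survives the limit
`h → 0` (`IsModeSolution.decay`). -/

namespace Poiseuille

/-! ### Weak derivatives on the line -/

/-- Test functions on `ℝ`: smooth and compactly supported. -/
structure IsLineTest (η : ℝ → ℝ) : Prop where
  smooth : ContDiff ℝ ((⊤ : ℕ∞) : WithTop ℕ∞) η
  compact : HasCompactSupport η

namespace IsLineTest

variable {η χ : ℝ → ℝ}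

theorem continuous (h : IsLineTest η) : Continuous η := h.smooth.continuous

theorem differentiable (h : IsLineTest η) : Differentiable ℝ η := h.smooth.differentiable (by simp)

theorem deriv (h : IsLineTest η) : IsLineTest (deriv η) :=
  ⟨(contDiff_infty_iff_deriv.1 h.smooth).2, h.compact.deriv⟩

theorem add (h : IsLineTest η) (h' : IsLineTest χ) : IsLineTest (fun y => η y + χ y) :=
  ⟨h.smooth.add h'.smooth, h.compact.add h'.compact⟩

theorem const_mul (h : IsLineTest η) (c : ℝ) : IsLineTest (fun y => c * η y) :=
  ⟨contDiff_const.mul h.smooth, h.compact.mul_left⟩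

theorem integrable_mul {f : ℝ → ℝ} (h : IsLineTest η) (hf : LocallyIntegrable f) :
    Integrable (fun y => η y * f y) :=
  hf.integrable_smul_left_of_hasCompactSupport h.continuous h.compact

theorem integrable (h : IsLineTest η) : Integrable η :=
  h.continuous.integrable_of_hasCompactSupport h.compact

theorem exists_bound (h : IsLineTest η) : ∃ R : ℝ, 0 < R ∧ ∀ y, R ≤ |y| → η y = 0 := by
  obtain ⟨R, hR⟩ := h.compact.isCompact.isBounded.subset_closedBall 0
  refine ⟨max R 0 + 1, by positivity, fun y hy => ?_⟩
  by_contra h0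
  have := hR (subset_tsupport _ (Function.mem_support.2 h0))
  simp only [Metric.mem_closedBall, dist_zero_right, Real.norm_eq_abs] at this
  linarith [le_max_left R 0]

end IsLineTest

/-- `g` is the weak derivative of `f` on `ℝ`, both being locally integrable. -/
structure WD (f g : ℝ → ℝ) : Prop where
  left : LocallyIntegrable f
  right : LocallyIntegrable g
  eq : ∀ η, IsLineTest η → ∫ y, deriv η y * f y = -∫ y, η y * g y

/-- The primitive of `g` with value `c` at `0`. -/
noncomputable def prim (g : ℝ → ℝ) (c : ℝ) (y : ℝ) : ℝ := c + ∫ s in (0 : ℝ)..y, g s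

theorem locallyIntegrable_intervalIntegrable {g : ℝ → ℝ} (hg : LocallyIntegrable g) (a b : ℝ) :
    IntervalIntegrable g volume a b :=
  (hg.integrableOn_isCompact isCompact_uIcc).intervalIntegrable

theorem continuous_prim {g : ℝ → ℝ} (hg : LocallyIntegrable g) (c : ℝ) : Continuous (prim g c) :=
  continuous_const.add
    (intervalIntegral.continuous_primitive (locallyIntegrable_intervalIntegrable hg) 0)

theorem absolutelyContinuous_prim {g : ℝ → ℝ} (hg : LocallyIntegrable g) (c : ℝ) {a b : ℝ}
    (h0 : (0 : ℝ) ∈ Set.uIcc a b) : AbsolutelyContinuousOnInterval (prim g c) a b :=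
  (contDiffOn_const (c := c)).absolutelyContinuousOnInterval.add
    ((locallyIntegrable_intervalIntegrable hg a b).absolutelyContinuousOnInterval_intervalIntegral
      h0)

theorem ae_hasDerivAt_prim {g : ℝ → ℝ} (hg : LocallyIntegrable g) (c : ℝ) :
    ∀ᵐ y, HasDerivAt (prim g c) (g y) y := by
  filter_upwards [LocallyIntegrable.ae_hasDerivAt_integral hg] with y hy
  exact (hy 0).const_add c

/-- Integration by parts, the primitives being absolutely continuous. -/
theorem integral_prim_mul_prim {g q : ℝ → ℝ} (hg : LocallyIntegrable g) (hq : LocallyIntegrable q)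
    (c d : ℝ) {a b : ℝ} (h0 : (0 : ℝ) ∈ Set.uIcc a b) :
    ∫ y in a..b, (g y * prim q d y + prim g c y * q y) =
      prim g c b * prim q d b - prim g c a * prim q d a := by
  rw [← (absolutelyContinuous_prim hg c h0).integral_deriv_mul_eq_sub
    (absolutelyContinuous_prim hq d h0)]
  apply intervalIntegral.integral_congr_ae
  filter_upwards [ae_hasDerivAt_prim hg c, ae_hasDerivAt_prim hq d] with y h1 h2 _
  rw [h1.deriv, h2.deriv]

theorem IsLineTest.eq_prim {η : ℝ → ℝ} (h : IsLineTest η) : η = prim (_root_.deriv η) (η 0) := by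
  funext y
  rw [prim, intervalIntegral.integral_deriv_eq_sub (fun x _ => h.differentiable x)
    (h.deriv.continuous.intervalIntegrable _ _)]
  ring

theorem WD.prim {g : ℝ → ℝ} (hg : LocallyIntegrable g) (c : ℝ) : WD (prim g c) g := by
  refine ⟨(continuous_prim hg c).locallyIntegrable, hg, fun η hη => ?_⟩
  obtain ⟨R, hR, hz⟩ := hη.exists_bound
  have hsupp : ∀ f : ℝ → ℝ, (∀ y, R ≤ |y| → f y = 0) → ∫ y in (-R)..R, f y = ∫ y, f y := by
    intro f hf
    refine intervalIntegral.integral_eq_integral_of_support_subset fun y hy => ?_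
    have : |y| < R := by
      by_contra h
      exact hy (hf y (not_lt.1 h))
    rw [abs_lt] at this
    exact ⟨this.1, this.2.le⟩
  have key := integral_prim_mul_prim hg hη.deriv.continuous.locallyIntegrable c (η 0)
    (a := -R) (b := R) (by rw [Set.uIcc_of_le (by linarith)]; constructor <;> linarith)
  rw [← hη.eq_prim, hz R (le_abs_self R), hz (-R) (by rw [abs_neg]; exact le_abs_self R)] at key
  have i1 : Integrable (fun y => η y * g y) := hη.integrable_mul hg
  have i2 : Integrable (fun y => deriv η y * Poiseuille.prim g c y) :=
    hη.deriv.integrable_mul (continuous_prim hg c).locallyIntegrable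
  have hd : ∀ y, R < |y| → deriv η y = 0 := by
    intro y hy
    have : η =ᶠ[𝓝 y] fun _ => 0 := by
      filter_upwards [(isOpen_lt continuous_const continuous_abs).mem_nhds hy] with x hx
      exact hz x (le_of_lt hx)
    rw [this.deriv_eq]; simp
  have hd' : ∀ y, R ≤ |y| → deriv η y = 0 := by
    intro y hy
    have hcl : IsClosed {y | deriv η y = 0} :=
      isClosed_eq hη.deriv.continuous continuous_const
    have : y ∈ closure {y : ℝ | R < |y|} := by
      rcases le_abs.1 hy with h | h
      · refine closure_mono (s := Set.Ioi R) (fun x hx => lt_of_lt_of_le hx (le_abs_self x)) ?_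
        rw [closure_Ioi]; exact h
      · refine closure_mono (s := Set.Iio (-R)) (fun x hx => ?_) ?_
        · exact lt_of_lt_of_le (lt_neg.1 hx) (neg_le_abs x)
        · rw [closure_Iio]; exact le_neg.1 h
    exact closure_minimal (fun x hx => hd x hx) hcl this
  rw [hsupp] at key
  · have e : ∫ y, (g y * η y + Poiseuille.prim g c y * deriv η y) =
        (∫ y, η y * g y) + ∫ y, deriv η y * Poiseuille.prim g c y := by
      rw [← integral_add i1 i2]; congr 1; funext y; ring
    rw [e] at key; linarith
  · intro y hy; rw [hz y hy, hd' y hy]; ring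

theorem exists_lineTest_integral_one : ∃ η, IsLineTest η ∧ ∫ y, η y = 1 := by
  let b : ContDiffBump (0 : ℝ) := ⟨1, 2, by norm_num, by norm_num⟩
  exact ⟨b.normed volume, ⟨b.contDiff_normed, b.hasCompactSupport_normed⟩, b.integral_normed⟩

theorem IsLineTest.exists_primitive {θ : ℝ → ℝ} (hθ : IsLineTest θ) (h0 : ∫ y, θ y = 0) :
    ∃ χ, IsLineTest χ ∧ _root_.deriv χ = θ := by
  obtain ⟨R, hR, hz⟩ := hθ.exists_bound
  let χ : ℝ → ℝ := fun y => ∫ s in (-R)..y, θ s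
  have hd : ∀ y, HasDerivAt χ (θ y) y := fun y =>
    intervalIntegral.integral_hasDerivAt_right (hθ.continuous.intervalIntegrable _ _)
      (hθ.continuous.stronglyMeasurableAtFilter _ _) hθ.continuous.continuousAt
  have hde : _root_.deriv χ = θ := funext fun y => (hd y).deriv
  refine ⟨χ, ⟨?_, ?_⟩, hde⟩
  · rw [contDiff_infty_iff_deriv, hde]
    exact ⟨fun y => (hd y).differentiableAt, hθ.smooth⟩
  · refine HasCompactSupport.intro (isCompact_Icc (a := -R) (b := R)) fun y hy => ?_
    rcases le_or_gt y (-R) with h | h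
    · refine (intervalIntegral.integral_congr (g := fun _ => 0) fun s hs => ?_).trans (by simp)
      rw [Set.uIcc_of_ge h] at hs
      exact hz s (by rw [abs_of_nonpos] <;> linarith [hs.2])
    · have hy' : R < y := by
        by_contra h'
        exact hy ⟨h.le, not_lt.1 h'⟩
      refine Eq.trans (intervalIntegral.integral_eq_integral_of_support_subset fun s hs => ?_) h0
      have : |s| < R := by
        by_contra h
        exact hs (hz s (not_lt.1 h))
      rw [abs_lt] at this
      exact ⟨this.1, by linarith⟩

/-- du Bois-Reymond: a linear functional on test functions that kills all derivatives is a
multiple of the integral. -/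
theorem exists_const_of_deriv_eq_zero (T : (ℝ → ℝ) → ℝ)
    (hadd : ∀ η χ, IsLineTest η → IsLineTest χ → T (fun y => η y + χ y) = T η + T χ)
    (hmul : ∀ c η, IsLineTest η → T (fun y => c * η y) = c * T η)
    (hz : ∀ χ, IsLineTest χ → T (deriv χ) = 0) :
    ∃ c, ∀ η, IsLineTest η → T η = c * ∫ y, η y := by
  obtain ⟨η₀, h₀, hi⟩ := exists_lineTest_integral_one
  refine ⟨T η₀, fun η hη => ?_⟩
  have hc := h₀.const_mul (-∫ y, η y)
  obtain ⟨χ, hχ, hd⟩ := (hη.add hc).exists_primitive (by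
    rw [integral_add hη.integrable hc.integrable, integral_const_mul, hi]; ring)
  have := hz χ hχ
  rw [hd, hadd _ _ hη hc, hmul _ _ h₀] at this
  linarith

/-- A weakly differentiable function is, almost everywhere, a primitive of its derivative. -/
theorem WD.exists_prim {f g : ℝ → ℝ} (h : WD f g) : ∃ c, f =ᵐ[volume] Poiseuille.prim g c := by
  have hp := WD.prim h.right 0
  have hl : LocallyIntegrable (fun y => f y - Poiseuille.prim g 0 y) := h.left.sub hp.left
  obtain ⟨c, hc⟩ := exists_const_of_deriv_eq_zero
    (fun η => ∫ y, η y * (f y - Poiseuille.prim g 0 y))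
    (fun η χ hη hχ => by
      rw [← integral_add (hη.integrable_mul hl) (hχ.integrable_mul hl)]
      congr 1; funext y; ring)
    (fun c η hη => by
      rw [← integral_const_mul]; congr 1; funext y; ring)
    (fun χ hχ => by
      have e1 := h.eq χ hχ
      have e2 := hp.eq χ hχ
      simp only [mul_sub]
      rw [integral_sub (hχ.deriv.integrable_mul h.left) (hχ.deriv.integrable_mul hp.left),
        e1, e2, sub_self])
  refine ⟨c, ?_⟩
  have := ae_eq_of_integral_contDiff_smul_eq hl (locallyIntegrable_const c) (fun η h1 h2 => by
    have := hc η ⟨h1, h2⟩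
    simp only [smul_eq_mul]
    rw [this, integral_mul_const, mul_comm])
  filter_upwards [this] with y hy
  simp only [Poiseuille.prim] at hy ⊢
  linarith

theorem WD.congr {f g f' g' : ℝ → ℝ} (h : WD f g) (hf : f =ᵐ[volume] f') (hg : g =ᵐ[volume] g') :
    WD f' g' where
  left := (locallyIntegrable_congr hf).1 h.left
  right := (locallyIntegrable_congr hg).1 h.right
  eq η hη := by
    have e1 : ∫ y, deriv η y * f' y = ∫ y, deriv η y * f y :=
      integral_congr_ae (by filter_upwards [hf] with y hy; rw [hy])
    have e2 : ∫ y, η y * g' y = ∫ y, η y * g y :=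
      integral_congr_ae (by filter_upwards [hg] with y hy; rw [hy])
    rw [e1, e2, h.eq η hη]

/-- Leibniz rule; it holds without smoothness since both factors are absolutely continuous. -/
theorem WD.mul {f g p q : ℝ → ℝ} (h : WD f g) (h' : WD p q) :
    WD (fun y => f y * p y) (fun y => g y * p y + f y * q y) := by
  obtain ⟨c, hc⟩ := h.exists_prim
  obtain ⟨d, hd⟩ := h'.exists_prim
  have c1 := continuous_prim h.right c
  have c2 := continuous_prim h'.right d
  have hr : LocallyIntegrable
      fun y => g y * Poiseuille.prim q d y + Poiseuille.prim g c y * q y := by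
    rw [← locallyIntegrableOn_univ]
    exact ((h.right.locallyIntegrableOn _).mul_continuousOn c2.continuousOn
      isOpen_univ.isLocallyClosed).add
      ((h'.right.locallyIntegrableOn _).continuousOn_mul c1.continuousOn
        isOpen_univ.isLocallyClosed)
  refine (WD.prim hr (c * d)).congr ?_ ?_
  · filter_upwards [hc, hd] with y h1 h2
    rw [h1, h2]
    have := integral_prim_mul_prim h.right h'.right c d (a := 0) (b := y) (by simp)
    rw [Poiseuille.prim, this]
    simp [Poiseuille.prim]
  · filter_upwards [hc, hd] with y h1 h2
    rw [← h1, ← h2]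

/-- If `f'' = G` weakly then `f` has a weak derivative. -/
theorem exists_WD_of_second {f G : ℝ → ℝ} (hf : LocallyIntegrable f) (hG : LocallyIntegrable G)
    (h : ∀ η, IsLineTest η → ∫ y, deriv (deriv η) y * f y = ∫ y, η y * G y) :
    ∃ f1, WD f f1 ∧ WD f1 G := by
  have hp := WD.prim hG 0
  obtain ⟨c, hc⟩ := exists_const_of_deriv_eq_zero
    (fun η => (∫ y, deriv η y * f y) + ∫ y, η y * Poiseuille.prim G 0 y)
    (fun η χ hη hχ => by
      have e : deriv (fun y => η y + χ y) = fun y => deriv η y + deriv χ y :=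
        funext fun y => deriv_fun_add (hη.differentiable y) (hχ.differentiable y)
      simp only [e, add_mul]
      rw [integral_add (hη.deriv.integrable_mul hf) (hχ.deriv.integrable_mul hf),
        integral_add (hη.integrable_mul hp.left) (hχ.integrable_mul hp.left)]
      ring)
    (fun c η hη => by
      have e : deriv (fun y => c * η y) = fun y => c * deriv η y :=
        funext fun y => deriv_const_mul c (hη.differentiable y)
      simp only [e, mul_assoc]
      rw [integral_const_mul, integral_const_mul]; ring)
    (fun χ hχ => by rw [h χ hχ, hp.eq χ hχ]; ring)
  refine ⟨Poiseuille.prim G (-c), ⟨hf, (continuous_prim hG _).locallyIntegrable, fun η hη => ?_⟩,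
    WD.prim hG _⟩
  have := hc η hη
  have e : ∀ y, η y * Poiseuille.prim G (-c) y = η y * Poiseuille.prim G 0 y - c * η y := by
    intro y; simp only [Poiseuille.prim]; ring
  simp only [e]
  rw [integral_sub (hη.integrable_mul hp.left) (hη.integrable.const_mul c), integral_const_mul]
  linarith

namespace WD

variable {f g p q : ℝ → ℝ}

theorem add (h : WD f g) (h' : WD p q) : WD (fun y => f y + p y) (fun y => g y + q y) where
  left := h.left.add h'.left
  right := h.right.add h'.right
  eq η hη := by
    simp only [mul_add]
    rw [integral_add (hη.deriv.integrable_mul h.left) (hη.deriv.integrable_mul h'.left),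
      integral_add (hη.integrable_mul h.right) (hη.integrable_mul h'.right), h.eq η hη, h'.eq η hη]
    ring

theorem const_mul (c : ℝ) (h : WD f g) : WD (fun y => c * f y) (fun y => c * g y) where
  left := h.left.smul c
  right := h.right.smul c
  eq η hη := by
    have := h.eq η hη
    simp only [mul_left_comm _ c]
    rw [integral_const_mul, integral_const_mul, this]; ring

theorem of_hasDerivAt {f' : ℝ → ℝ} (h : ∀ y, HasDerivAt f (f' y) y) (hc : Continuous f') :
    WD f f' := by
  have : f = Poiseuille.prim f' (f 0) := by
    funext y
    rw [Poiseuille.prim, intervalIntegral.integral_eq_sub_of_hasDerivAt (fun x _ => h x)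
      (hc.intervalIntegrable _ _)]
    ring
  rw [this]
  exact WD.prim hc.locallyIntegrable _

theorem unique (h : WD f g) (h' : WD f q) : g =ᵐ[volume] q :=
  ae_eq_of_integral_contDiff_smul_eq h.right h'.right fun η h1 h2 => by
    have e1 := h.eq η ⟨h1, h2⟩
    have e2 := h'.eq η ⟨h1, h2⟩
    simp only [smul_eq_mul]; linarith

end WD

/-! ### Integrating weak derivatives over the line -/

/-- A smooth cutoff, equal to `1` on `[-1, 1]` and supported in `[-2, 2]`. -/
noncomputable def bump : ContDiffBump (0 : ℝ) := ⟨1, 2, by norm_num, by norm_num⟩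

/-- The cutoff `bump` rescaled to live on `[-2(n+1), 2(n+1)]`. -/
noncomputable def cutoff (n : ℕ) (y : ℝ) : ℝ := bump ((1 / (n + 1 : ℝ)) * y)

theorem isLineTest_bump : IsLineTest bump := ⟨bump.contDiff, bump.hasCompactSupport⟩

theorem isLineTest_cutoff (n : ℕ) : IsLineTest (cutoff n) := by
  have hn : (1 / (n + 1 : ℝ)) ≠ 0 := by positivity
  refine ⟨bump.contDiff.comp (contDiff_const.mul contDiff_id), ?_⟩
  exact bump.hasCompactSupport.comp_homeomorph (Homeomorph.mulLeft₀ _ hn)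

theorem deriv_cutoff (n : ℕ) :
    deriv (cutoff n) = fun y => (1 / (n + 1 : ℝ)) * deriv bump ((1 / (n + 1 : ℝ)) * y) := by
  funext y
  have := (isLineTest_bump.differentiable ((1 / (n + 1 : ℝ)) * y)).hasDerivAt.comp y
    ((hasDerivAt_id y).const_mul (1 / (n + 1 : ℝ)))
  simp only [mul_one] at this
  rw [show cutoff n = (bump : ℝ → ℝ) ∘ fun y => (1 / (n + 1 : ℝ)) * y from rfl, this.deriv]; ring

theorem deriv_deriv_cutoff (n : ℕ) : deriv (deriv (cutoff n)) =
    fun y => (1 / (n + 1 : ℝ)) ^ 2 * deriv (deriv bump) ((1 / (n + 1 : ℝ)) * y) := by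
  funext y
  rw [deriv_cutoff]
  have := ((isLineTest_bump.deriv.differentiable ((1 / (n + 1 : ℝ)) * y)).hasDerivAt.comp y
    ((hasDerivAt_id y).const_mul (1 / (n + 1 : ℝ)))).const_mul (1 / (n + 1 : ℝ))
  simp only [mul_one] at this
  refine this.deriv.trans ?_
  ring

theorem cutoff_eq_one {n : ℕ} {y : ℝ} (h : |y| ≤ n + 1) : cutoff n y = 1 := by
  refine bump.one_of_mem_closedBall ?_
  have hn : (0 : ℝ) < n + 1 := by positivity
  simp only [bump, Metric.mem_closedBall, dist_zero_right, Real.norm_eq_abs, abs_mul]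
  rw [abs_of_pos (by positivity), one_div_mul_eq_div, div_le_one hn]
  exact h

theorem deriv_bump_zero_of_lt {z : ℝ} (h : 2 < |z|) : deriv bump z = 0 := by
  have : (bump : ℝ → ℝ) =ᶠ[𝓝 z] fun _ => 0 := by
    filter_upwards [(isOpen_lt continuous_const continuous_abs).mem_nhds h] with x hx
    refine bump.zero_of_le_dist ?_
    simp only [bump, dist_zero_right, Real.norm_eq_abs]
    exact le_of_lt hx
  rw [this.deriv_eq]; simp

theorem exists_deriv_cutoff_bound :
    ∃ C : ℝ, (∀ n y, |deriv (cutoff n) y| * (1 + |y|) ≤ C) ∧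
      (∀ n y, |deriv (cutoff n) y| ≤ C / (n + 1)) ∧
      ∀ n y, |deriv (deriv (cutoff n)) y| ≤ C / (n + 1) := by
  obtain ⟨C1, h1⟩ := isLineTest_bump.deriv.compact.exists_bound_of_continuous
    isLineTest_bump.deriv.continuous
  obtain ⟨C2, h2⟩ := isLineTest_bump.deriv.deriv.compact.exists_bound_of_continuous
    isLineTest_bump.deriv.deriv.continuous
  simp only [Real.norm_eq_abs] at h1 h2
  have p1 : 0 ≤ C1 := (abs_nonneg _).trans (h1 0)
  have p2 : 0 ≤ C2 := (abs_nonneg _).trans (h2 0)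
  refine ⟨3 * C1 + C2, fun n y => ?_, fun n y => ?_, fun n y => ?_⟩
  · have hn : (0 : ℝ) < n + 1 := by positivity
    rw [deriv_cutoff]
    simp only
    rw [abs_mul, abs_of_pos (by positivity : (0 : ℝ) < 1 / (n + 1))]
    rcases lt_or_ge 2 |1 / ((n : ℝ) + 1) * y| with h | h
    · rw [deriv_bump_zero_of_lt h]; simp; positivity
    · rw [abs_mul, abs_of_pos (by positivity : (0 : ℝ) < 1 / (n + 1)), one_div_mul_eq_div] at h
      have h3 : 1 / ((n : ℝ) + 1) * (1 + |y|) ≤ 3 := by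
        rw [mul_add, one_div_mul_eq_div, one_div_mul_eq_div]
        have : 1 / ((n : ℝ) + 1) ≤ 1 := by
          rw [div_le_one hn]; linarith [Nat.cast_nonneg (α := ℝ) n]
        linarith
      calc _ = |deriv bump (1 / ((n : ℝ) + 1) * y)| * (1 / ((n : ℝ) + 1) * (1 + |y|)) := by ring
        _ ≤ C1 * 3 := by gcongr; exact h1 _
        _ ≤ _ := by linarith
  · rw [deriv_cutoff]
    simp only
    rw [abs_mul, abs_of_pos (by positivity : (0 : ℝ) < 1 / (n + 1)), one_div_mul_eq_div]
    gcongr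
    linarith [h1 (1 / ((n : ℝ) + 1) * y)]
  · rw [deriv_deriv_cutoff]
    simp only
    have hle : (1 / ((n : ℝ) + 1)) ^ 2 ≤ 1 / (n + 1) := by
      rw [sq]
      refine mul_le_of_le_one_left (by positivity) ?_
      rw [div_le_one (by positivity)]; linarith [Nat.cast_nonneg (α := ℝ) n]
    rw [abs_mul, abs_of_nonneg (by positivity)]
    calc _ ≤ 1 / ((n : ℝ) + 1) * C2 := by gcongr; exact h2 _
      _ ≤ 1 / ((n : ℝ) + 1) * (3 * C1 + C2) := by gcongr; linarith
      _ = _ := by ring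

theorem tendsto_integral_cutoff_mul {g : ℝ → ℝ} (hg : Integrable g) :
    Tendsto (fun n => ∫ y, cutoff n y * g y) atTop (𝓝 (∫ y, g y)) := by
  refine tendsto_integral_of_dominated_convergence (fun y => |g y|)
    (fun n => ((isLineTest_cutoff n).integrable_mul hg.locallyIntegrable).aestronglyMeasurable)
    hg.abs (fun n => Eventually.of_forall fun y => ?_) (Eventually.of_forall fun y => ?_)
  · rw [Real.norm_eq_abs, abs_mul, cutoff, abs_of_nonneg bump.nonneg]
    exact mul_le_of_le_one_left (abs_nonneg _) bump.le_one
  · refine tendsto_const_nhds.congr' ?_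
    obtain ⟨N, hN⟩ := exists_nat_gt |y|
    filter_upwards [eventually_ge_atTop N] with n hn
    rw [cutoff_eq_one, one_mul]
    have : (N : ℝ) ≤ n := by exact_mod_cast hn
    linarith

theorem tendsto_const_div_succ (C : ℝ) : Tendsto (fun n : ℕ => C / ((n : ℝ) + 1)) atTop (𝓝 0) :=
  (tendsto_const_nhds (x := C)).div_atTop
    (tendsto_atTop_add_const_right _ _ tendsto_natCast_atTop_atTop)

/-- The tool for all integrations by parts below. If `h' = q + r` with `q ≥ 0` and `r ∈ L¹`, and
`h` is small at infinity in a weak sense (`h = m' + n` with `m ∈ L¹` and `n` integrable up to one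
factor `y`), then `q ∈ L¹` and `h` contributes no boundary term. -/
theorem integrable_of_WD_add {h q r m n : ℝ → ℝ} (hh : WD h (fun y => q y + r y))
    (hm : WD m (fun y => h y - n y)) (hmi : Integrable m)
    (hn : Integrable (fun y => n y / (1 + |y|))) (hr : Integrable r) (hq : ∀ y, 0 ≤ q y) :
    Integrable q ∧ ∫ y, q y + r y = 0 := by
  obtain ⟨C, hC1, hC2, hC3⟩ := exists_deriv_cutoff_bound
  have hnl : LocallyIntegrable n :=
    (hh.left.sub hm.right).congr (Eventually.of_forall fun y => by simp)
  have hql : LocallyIntegrable q :=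
    (hh.right.sub hr.locallyIntegrable).congr (Eventually.of_forall fun y => by simp)
  have hlim : Tendsto (fun k => ∫ y, cutoff k y * (q y + r y)) atTop (𝓝 0) := by
    have e : ∀ k, ∫ y, cutoff k y * (q y + r y) =
        (∫ y, deriv (deriv (cutoff k)) y * m y) - ∫ y, deriv (cutoff k) y * n y := by
      intro k
      have hk := isLineTest_cutoff k
      have e1 := hh.eq _ hk
      have e2 := hm.eq _ hk.deriv
      simp only [mul_sub] at e2
      rw [integral_sub (hk.deriv.integrable_mul hh.left) (hk.deriv.integrable_mul hnl)] at e2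
      linarith
    simp only [e]
    have t1 : Tendsto (fun k => ∫ y, deriv (deriv (cutoff k)) y * m y) atTop
        (𝓝 (∫ _ : ℝ, (0 : ℝ))) := by
      refine tendsto_integral_of_dominated_convergence (fun y => C * |m y|)
        (fun k => ((isLineTest_cutoff k).deriv.deriv.integrable_mul
          hmi.locallyIntegrable).aestronglyMeasurable)
        (hmi.abs.const_mul C) (fun k => Eventually.of_forall fun y => ?_)
        (Eventually.of_forall fun y => ?_)
      · rw [Real.norm_eq_abs, abs_mul]
        refine mul_le_mul_of_nonneg_right ((hC3 k y).trans ?_) (abs_nonneg _)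
        have : 0 ≤ C := by
          have := (abs_nonneg _).trans (hC3 0 0)
          simpa using this
        exact div_le_self this (by linarith [Nat.cast_nonneg (α := ℝ) k])
      · refine squeeze_zero_norm (a := fun k : ℕ => C / ((k : ℝ) + 1) * |m y|) (fun k => ?_) ?_
        · rw [Real.norm_eq_abs, abs_mul]
          exact mul_le_mul_of_nonneg_right (hC3 k y) (abs_nonneg _)
        · simpa using (tendsto_const_div_succ C).mul_const |m y|
    have t2 : Tendsto (fun k => ∫ y, deriv (cutoff k) y * n y) atTop (𝓝 (∫ _ : ℝ, (0 : ℝ))) := by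
      refine tendsto_integral_of_dominated_convergence (fun y => C * |n y / (1 + |y|)|)
        (fun k => ((isLineTest_cutoff k).deriv.integrable_mul hnl).aestronglyMeasurable)
        (hn.abs.const_mul C) (fun k => Eventually.of_forall fun y => ?_)
        (Eventually.of_forall fun y => ?_)
      · have hy : 0 < 1 + |y| := by positivity
        rw [Real.norm_eq_abs, abs_mul, abs_div, abs_of_pos hy]
        calc _ = (|deriv (cutoff k) y| * (1 + |y|)) * (|n y| / (1 + |y|)) := by field_simp
          _ ≤ _ := by gcongr; exact hC1 k y
      · refine squeeze_zero_norm (a := fun k : ℕ => C / ((k : ℝ) + 1) * |n y|) (fun k => ?_) ?_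
        · rw [Real.norm_eq_abs, abs_mul]
          exact mul_le_mul_of_nonneg_right (hC2 k y) (abs_nonneg _)
        · simpa using (tendsto_const_div_succ C).mul_const |n y|
    simpa using t1.sub t2
  have hlr := tendsto_integral_cutoff_mul hr
  have hsplit : ∀ k, ∫ y, cutoff k y * (q y + r y) =
      (∫ y, cutoff k y * q y) + ∫ y, cutoff k y * r y := by
    intro k
    have hk := isLineTest_cutoff k
    simp only [mul_add]
    rw [integral_add (hk.integrable_mul hql) (hk.integrable_mul hr.locallyIntegrable)]
  have hlq : Tendsto (fun k => ∫ y, cutoff k y * q y) atTop (𝓝 (0 - ∫ y, r y)) := by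
    refine (hlim.sub hlr).congr fun k => ?_
    rw [hsplit k]; ring
  have hqi : Integrable q := by
    obtain ⟨B, hB⟩ := hlq.bddAbove_range
    refine (aecover_closedBall (x := (0 : ℝ)) (μ := volume)
      tendsto_natCast_atTop_atTop).integrable_of_integral_norm_bounded B
      (fun k => hql.integrableOn_isCompact (isCompact_closedBall _ _))
      (Eventually.of_forall fun k => ?_)
    have hk := isLineTest_cutoff k
    refine le_trans ?_ (hB (Set.mem_range_self k))
    rw [← integral_indicator Metric.isClosed_closedBall.measurableSet]
    have hbi : IntegrableOn (fun y => ‖q y‖) (Metric.closedBall (0 : ℝ) k) :=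
      (hql.integrableOn_isCompact (isCompact_closedBall _ _)).norm
    refine integral_mono (hbi.integrable_indicator Metric.isClosed_closedBall.measurableSet)
      (hk.integrable_mul hql) fun y => ?_
    simp only [Set.indicator, Metric.mem_closedBall, dist_zero_right, Real.norm_eq_abs]
    split_ifs with hy
    · rw [cutoff_eq_one (by linarith), one_mul, abs_of_nonneg (hq y)]
    · exact mul_nonneg bump.nonneg (hq y)
  refine ⟨hqi, ?_⟩
  exact tendsto_nhds_unique (tendsto_integral_cutoff_mul (hqi.add hr)) hlim

theorem integral_eq_zero_of_WD {h r m n : ℝ → ℝ} (hh : WD h r)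
    (hm : WD m (fun y => h y - n y)) (hmi : Integrable m)
    (hn : Integrable (fun y => n y / (1 + |y|))) (hr : Integrable r) : ∫ y, r y = 0 := by
  have := integrable_of_WD_add (q := fun _ => 0) (r := r) (by simpa using hh) hm hmi hn hr
    (fun _ => le_rfl)
  simpa using this.2

end Poiseuille

namespace Poiseuille

/-! ### Complex-valued functions and the space `L²(ℝ; ℂ)` -/

/-- The real inner product `Re (z * conj w)` of `ℂ`. -/
def dot (z w : ℂ) : ℝ := z.re * w.re + z.im * w.im

/-- Weak derivatives of complex-valued functions on the line. -/
structure WDc (f g : ℝ → ℂ) : Prop where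
  re : WD (fun y => (f y).re) (fun y => (g y).re)
  im : WD (fun y => (f y).im) (fun y => (g y).im)

namespace WDc

variable {f g p q : ℝ → ℂ}

theorem dot_mul (h : WDc f g) (h' : WDc p q) :
    WD (fun y => dot (f y) (p y)) (fun y => dot (g y) (p y) + dot (f y) (q y)) := by
  convert! (h.re.mul h'.re).add (h.im.mul h'.im) using 1
  funext y; simp only [dot]; ring

theorem congr {f' g' : ℝ → ℂ} (h : WDc f g) (hf : f =ᵐ[volume] f') (hg : g =ᵐ[volume] g') :
    WDc f' g' :=
  ⟨h.re.congr (hf.mono fun y hy => by simp only [hy]) (hg.mono fun y hy => by simp only [hy]),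
    h.im.congr (hf.mono fun y hy => by simp only [hy]) (hg.mono fun y hy => by simp only [hy])⟩

theorem unique (h : WDc f g) (h' : WDc f q) : g =ᵐ[volume] q := by
  filter_upwards [h.re.unique h'.re, h.im.unique h'.im] with y h1 h2
  exact Complex.ext h1 h2

theorem mul_I (h : WDc f g) : WDc (fun y => Complex.I * f y) (fun y => Complex.I * g y) := by
  refine ⟨?_, ?_⟩
  · simpa using h.im.const_mul (-1)
  · simpa using h.re

theorem add (h : WDc f g) (h' : WDc p q) : WDc (fun y => f y + p y) (fun y => g y + q y) :=
  ⟨by simpa using h.re.add h'.re, by simpa using h.im.add h'.im⟩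

theorem const_mul (c : ℝ) (h : WDc f g) :
    WDc (fun y => (c : ℂ) * f y) (fun y => (c : ℂ) * g y) :=
  ⟨by simpa using h.re.const_mul c, by simpa using h.im.const_mul c⟩

theorem real_mul {a a' : ℝ → ℝ} (ha : WD a a') (h : WDc f g) :
    WDc (fun y => (a y : ℂ) * f y) (fun y => (a' y : ℂ) * f y + (a y : ℂ) * g y) :=
  ⟨by simpa using ha.mul h.re, by simpa using ha.mul h.im⟩

end WDc

theorem WD_id : WD (fun y => y) (fun _ => 1) :=
  WD.of_hasDerivAt (fun y => hasDerivAt_id' y) continuous_const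

theorem WD_zero : WD (fun _ => 0) (fun _ => 0) :=
  WD.of_hasDerivAt (fun y => hasDerivAt_const y 0) continuous_const

theorem WD_pow (n : ℕ) : WD (fun y => y ^ n) (fun y => n * y ^ (n - 1)) :=
  WD.of_hasDerivAt (fun y => hasDerivAt_pow n y) (by fun_prop)

/-- Square integrable complex-valued functions on the line. -/
noncomputable abbrev L2C := Lp ℂ 2 (volume : Measure ℝ)

theorem integrable_dot {f g : ℝ → ℂ} (hf : MemLp f 2) (hg : MemLp g 2) :
    Integrable (fun y => dot (f y) (g y)) :=
  (hf.re.integrable_mul hg.re).add (hf.im.integrable_mul hg.im)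

theorem memLp_of_integrable_dot {f : ℝ → ℂ} (hm : AEStronglyMeasurable f volume)
    (hi : Integrable fun y => dot (f y) (f y)) : MemLp f 2 := by
  rw [memLp_two_iff_integrable_sq_norm hm]
  refine hi.congr (Eventually.of_forall fun y => ?_)
  simp only [dot]
  rw [← Complex.normSq_eq_norm_sq, Complex.normSq_apply]

theorem dot_self_nonneg (z : ℂ) : 0 ≤ dot z z := by
  simp only [dot]; nlinarith [sq_nonneg z.re, sq_nonneg z.im]

theorem locallyIntegrable_of_memLp {f : ℝ → ℂ} (h : MemLp f 2) : LocallyIntegrable f :=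
  h.locallyIntegrable (by norm_num)

theorem inner_eq (F G : L2C) : inner ℝ F G = ∫ y, dot (F y) (G y) := by
  rw [L2.inner_def]
  congr 1; funext y
  rw [Complex.inner]
  simp only [dot, Complex.mul_re, Complex.conj_re, Complex.conj_im]; ring

theorem integrable_dot' (F G : L2C) : Integrable (fun y => dot (F y) (G y)) :=
  integrable_dot (Lp.memLp F) (Lp.memLp G)

theorem inner_congr {F G : L2C} {f g : ℝ → ℂ} (hf : F =ᵐ[volume] f) (hg : G =ᵐ[volume] g) :
    inner ℝ F G = ∫ y, dot (f y) (g y) := by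
  rw [inner_eq]
  exact integral_congr_ae (by filter_upwards [hf, hg] with y h1 h2; rw [h1, h2])

theorem integrable_dot_congr {F G : L2C} {f g : ℝ → ℂ} (hf : F =ᵐ[volume] f)
    (hg : G =ᵐ[volume] g) : Integrable (fun y => dot (f y) (g y)) :=
  (integrable_dot' F G).congr (by filter_upwards [hf, hg] with y h1 h2; rw [h1, h2])

/-- `Y = y F` in `L²`. -/
def IsMulY (F Y : L2C) : Prop := Y =ᵐ[volume] fun y => (y : ℂ) * F y

theorem IsMulY.inner {F Y G Z : L2C} (h : IsMulY F Y) (h' : IsMulY G Z) :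
    inner ℝ Y G = inner ℝ F Z := by
  rw [inner_congr h (ae_eq_refl G), inner_congr (ae_eq_refl F) h']
  congr 1; funext y
  simp [dot]; ring

theorem inner_I_left (F G : L2C) : inner ℝ (Complex.I • F) G = -inner ℝ F (Complex.I • G) := by
  rw [inner_congr (Lp.coeFn_smul Complex.I F) (ae_eq_refl G),
    inner_congr (ae_eq_refl F) (Lp.coeFn_smul Complex.I G), ← integral_neg]
  congr 1; funext y
  simp [dot]

theorem inner_I_self (F : L2C) : inner ℝ (Complex.I • F) F = 0 := by
  have := inner_I_left F F
  rw [real_inner_comm] at this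
  have h2 := real_inner_comm (Complex.I • F) F
  linarith

theorem inner_I_I (F G : L2C) : inner ℝ (Complex.I • F) (Complex.I • G) = inner ℝ F G := by
  rw [inner_I_left, ← mul_smul, Complex.I_mul_I, neg_one_smul, inner_neg_right, neg_neg]

theorem WDc.smul_I {F G : L2C} (h : WDc F G) : WDc (Complex.I • F : L2C) (Complex.I • G : L2C) :=
  h.mul_I.congr (Lp.coeFn_smul Complex.I F).symm (Lp.coeFn_smul Complex.I G).symm

theorem integrable_div_one_add_abs {n : ℝ → ℝ} (h : Integrable n) :
    Integrable (fun y => n y / (1 + |y|)) := by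
  refine h.mono ?_ (Eventually.of_forall fun y => ?_)
  · exact (h.aestronglyMeasurable.aemeasurable.div
      ((measurable_const.add measurable_id.abs).aemeasurable)).aestronglyMeasurable
  · have : 1 ≤ 1 + |y| := by linarith [abs_nonneg y]
    rw [norm_div, Real.norm_of_nonneg (by linarith : (0 : ℝ) ≤ 1 + |y|)]
    exact div_le_self (norm_nonneg _) this

theorem integral_eq_zero_of_WD_integrable {h r : ℝ → ℝ} (hh : WD h r) (hi : Integrable h)
    (hr : Integrable r) : ∫ y, r y = 0 := by
  refine integral_eq_zero_of_WD (m := fun _ => 0) (n := h) hh ?_ (integrable_zero _ _ _)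
    (integrable_div_one_add_abs hi) hr
  simpa using WD_zero

/-- Integration by parts in `H¹(ℝ)`. -/
theorem WDc.inner_add {F F1 G G1 : L2C} (h : WDc F F1) (h' : WDc G G1) :
    inner ℝ F1 G + inner ℝ F G1 = 0 := by
  rw [inner_eq, inner_eq, ← integral_add (integrable_dot' _ _) (integrable_dot' _ _)]
  exact integral_eq_zero_of_WD_integrable (h.dot_mul h') (integrable_dot' _ _)
    ((integrable_dot' _ _).add (integrable_dot' _ _))

/-- A weak second derivative pairing integrably with the function forces the first derivative to
be square integrable. -/
theorem exists_memLp_WDc {f G : ℝ → ℂ} (hf : MemLp f 2) (hG : LocallyIntegrable G)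
    (hre : ∀ η, IsLineTest η → ∫ y, deriv (deriv η) y * (f y).re = ∫ y, η y * (G y).re)
    (him : ∀ η, IsLineTest η → ∫ y, deriv (deriv η) y * (f y).im = ∫ y, η y * (G y).im)
    (hi : Integrable fun y => dot (G y) (f y)) :
    ∃ f1 : ℝ → ℂ, WDc f f1 ∧ WDc f1 G ∧ MemLp f1 2 ∧
      (∫ y, dot (f1 y) (f1 y)) + ∫ y, dot (G y) (f y) = 0 := by
  have hfl := locallyIntegrable_of_memLp hf
  have reL : ∀ {g : ℝ → ℂ}, LocallyIntegrable g → LocallyIntegrable fun y => (g y).re :=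
    fun hg x => (hg x).imp fun _ h => ⟨h.1, h.2.re⟩
  have imL : ∀ {g : ℝ → ℂ}, LocallyIntegrable g → LocallyIntegrable fun y => (g y).im :=
    fun hg x => (hg x).imp fun _ h => ⟨h.1, h.2.im⟩
  obtain ⟨a, ha1, ha2⟩ := exists_WD_of_second (reL hfl) (reL hG) hre
  obtain ⟨c, hc1, hc2⟩ := exists_WD_of_second (imL hfl) (imL hG) him
  let f1 : ℝ → ℂ := fun y => ⟨a y, c y⟩
  have w1 : WDc f f1 := ⟨ha1, hc1⟩
  have w2 : WDc f1 G := ⟨ha2, hc2⟩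
  have hm : WD (fun y => (1 / 2 : ℝ) * dot (f y) (f y)) (fun y => dot (f1 y) (f y) - 0) := by
    convert (w1.dot_mul w1).const_mul (1 / 2) using 1
    funext y; simp only [dot]; ring
  have key := integrable_of_WD_add (h := fun y => dot (f1 y) (f y))
    (q := fun y => dot (f1 y) (f1 y)) (r := fun y => dot (G y) (f y))
    (m := fun y => (1 / 2 : ℝ) * dot (f y) (f y)) (n := fun _ => 0)
    (by
      convert w2.dot_mul w1 using 1
      funext y; ring)
    hm ((integrable_dot hf hf).const_mul _) (by simp) hi
    (fun y => dot_self_nonneg _)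
  have hmeas : AEStronglyMeasurable f1 volume := by
    have h1 := w1.re.right.aestronglyMeasurable.aemeasurable
    have h2 := w1.im.right.aestronglyMeasurable.aemeasurable
    have := (Complex.measurable_ofReal.comp_aemeasurable h1).add
      ((Complex.measurable_ofReal.comp_aemeasurable h2).mul_const Complex.I)
    refine this.aestronglyMeasurable.congr (Eventually.of_forall fun y => ?_)
    exact Complex.re_add_im (f1 y)
  refine ⟨f1, w1, w2, ?_, ?_⟩
  · exact memLp_of_integrable_dot hmeas key.1
  · rw [← integral_add key.1 hi]; exact key.2

end Poiseuille

namespace Poiseuille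

/-! ### The equation of one Fourier mode at a fixed time -/

/-- Real part of `ν (U'' - k² U) - i k y² U + 2 i k B` tested against `η`. -/
noncomputable def evoRe (ν k : ℝ) (η : ℝ → ℝ) (U B : L2C) : ℝ :=
  (∫ y, (ν * (deriv (deriv η) y - k ^ 2 * η y)) * (U y).re) +
    k * (∫ y, (y ^ 2 * η y) * (U y).im) - 2 * k * ∫ y, η y * (B y).im

/-- Imaginary part of `ν (U'' - k² U) - i k y² U + 2 i k B` tested against `η`. -/
noncomputable def evoIm (ν k : ℝ) (η : ℝ → ℝ) (U B : L2C) : ℝ :=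
  (∫ y, (ν * (deriv (deriv η) y - k ^ 2 * η y)) * (U y).im) -
    k * (∫ y, (y ^ 2 * η y) * (U y).re) + 2 * k * ∫ y, η y * (B y).re

/-- The weak form of `P = ν (U'' - k² U) - i k y² U + 2 i k B`, split into real and imaginary
parts. For a solution `U` of the mode equation, `P` is its time derivative. -/
structure IsEvo (ν k : ℝ) (U B P : L2C) : Prop where
  re : ∀ η, IsLineTest η → ∫ y, η y * (P y).re = evoRe ν k η U B
  im : ∀ η, IsLineTest η → ∫ y, η y * (P y).im = evoIm ν k η U B

/-- The second derivative `U''` expressed through the equation. -/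
noncomputable def secondDeriv (ν k : ℝ) (U B P : L2C) (y : ℝ) : ℂ :=
  (ν⁻¹ : ℝ) * (P y + (ν * k ^ 2 : ℝ) * U y + Complex.I * ((k * y ^ 2 : ℝ) * U y) -
    Complex.I * ((2 * k : ℝ) * B y))

theorem locallyIntegrable_L2C (U : L2C) : LocallyIntegrable U :=
  locallyIntegrable_of_memLp (Lp.memLp U)

theorem locallyIntegrable_L2C_re (U : L2C) : LocallyIntegrable fun y => (U y).re :=
  fun x => (locallyIntegrable_L2C U x).imp fun _ h => ⟨h.1, h.2.re⟩

theorem locallyIntegrable_L2C_im (U : L2C) : LocallyIntegrable fun y => (U y).im :=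
  fun x => (locallyIntegrable_L2C U x).imp fun _ h => ⟨h.1, h.2.im⟩

theorem locallyIntegrable_secondDeriv (ν k : ℝ) (U B P : L2C) :
    LocallyIntegrable (secondDeriv ν k U B P) := by
  have h1 : LocallyIntegrable fun y => ((k * y ^ 2 : ℝ) : ℂ) * U y := by
    rw [← locallyIntegrableOn_univ]
    exact ((locallyIntegrable_L2C U).locallyIntegrableOn _).continuousOn_mul
      (by fun_prop) isOpen_univ.isLocallyClosed
  exact (((((locallyIntegrable_L2C P).add ((locallyIntegrable_L2C U).smul
    ((ν * k ^ 2 : ℝ) : ℂ))).add (h1.smul Complex.I)).sub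
      (((locallyIntegrable_L2C B).smul ((2 * k : ℝ) : ℂ)).smul Complex.I)).smul ((ν⁻¹ : ℝ) : ℂ))

variable {ν k : ℝ} {U B P : L2C}

theorem IsLineTest.pow_mul {η : ℝ → ℝ} (h : IsLineTest η) (n : ℕ) :
    IsLineTest (fun y => y ^ n * η y) :=
  ⟨(contDiff_id.pow n).mul h.smooth, h.compact.mul_left⟩

theorem IsEvo.second (hν : 0 < ν) (h : IsEvo ν k U B P) (η : ℝ → ℝ) (hη : IsLineTest η) :
    (∫ y, deriv (deriv η) y * (U y).re = ∫ y, η y * (secondDeriv ν k U B P y).re) ∧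
      ∫ y, deriv (deriv η) y * (U y).im = ∫ y, η y * (secondDeriv ν k U B P y).im := by
  have rU := locallyIntegrable_L2C_re U
  have iU := locallyIntegrable_L2C_im U
  have y2 : IsLineTest fun y => y ^ 2 * η y := hη.pow_mul 2
  have h1 := h.re η hη
  have h2 := h.im η hη
  unfold evoRe at h1
  unfold evoIm at h2
  have e : ∀ g : ℝ → ℝ, LocallyIntegrable g →
      ∫ y, (ν * (deriv (deriv η) y - k ^ 2 * η y)) * g y =
        ν * (∫ y, deriv (deriv η) y * g y) - ν * k ^ 2 * ∫ y, η y * g y := by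
    intro g hg
    rw [← integral_const_mul, ← integral_const_mul, ← integral_sub
      ((hη.deriv.deriv.integrable_mul hg).const_mul _) ((hη.integrable_mul hg).const_mul _)]
    congr 1; funext y; ring
  rw [e _ rU] at h1
  rw [e _ iU] at h2
  have nz : ν ≠ 0 := hν.ne'
  constructor
  · have : ∫ y, η y * (secondDeriv ν k U B P y).re = ν⁻¹ * ((∫ y, η y * (P y).re) +
        ν * k ^ 2 * (∫ y, η y * (U y).re) - k * (∫ y, (y ^ 2 * η y) * (U y).im) +
        2 * k * ∫ y, η y * (B y).im) := by
      simp only [← integral_const_mul]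
      rw [← integral_add (hη.integrable_mul (locallyIntegrable_L2C_re P))
        ((hη.integrable_mul rU).const_mul _), ← integral_sub, ← integral_add]
      · rw [← integral_const_mul]
        congr 1; funext y; simp [secondDeriv, -Complex.ofReal_pow, -Complex.ofReal_mul]; ring
      · exact ((hη.integrable_mul (locallyIntegrable_L2C_re P)).add
          ((hη.integrable_mul rU).const_mul _)).sub ((y2.integrable_mul iU).const_mul _)
      · exact (hη.integrable_mul (locallyIntegrable_L2C_im B)).const_mul _
      · exact ((hη.integrable_mul (locallyIntegrable_L2C_re P)).add
          ((hη.integrable_mul rU).const_mul _))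
      · exact ((y2.integrable_mul iU).const_mul _)
    rw [this, h1]; field_simp; ring
  · have : ∫ y, η y * (secondDeriv ν k U B P y).im = ν⁻¹ * ((∫ y, η y * (P y).im) +
        ν * k ^ 2 * (∫ y, η y * (U y).im) + k * (∫ y, (y ^ 2 * η y) * (U y).re) -
        2 * k * ∫ y, η y * (B y).re) := by
      simp only [← integral_const_mul]
      rw [← integral_add (hη.integrable_mul (locallyIntegrable_L2C_im P))
        ((hη.integrable_mul iU).const_mul _), ← integral_add, ← integral_sub]
      · rw [← integral_const_mul]
        congr 1; funext y; simp [secondDeriv, -Complex.ofReal_pow, -Complex.ofReal_mul]; ring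
      · exact ((hη.integrable_mul (locallyIntegrable_L2C_im P)).add
          ((hη.integrable_mul iU).const_mul _)).add ((y2.integrable_mul rU).const_mul _)
      · exact (hη.integrable_mul (locallyIntegrable_L2C_re B)).const_mul _
      · exact ((hη.integrable_mul (locallyIntegrable_L2C_im P)).add
          ((hη.integrable_mul iU).const_mul _))
      · exact ((y2.integrable_mul rU).const_mul _)
    rw [this, h2]; field_simp; ring

/-- The stream function equation `B'' = k² B + U`, with `B1 = B'`. -/
structure IsStream (k : ℝ) (U B B1 : L2C) : Prop where
  first : WDc B B1
  second : WDc B1 (k ^ 2 • B + U : L2C)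

theorem IsStream.inner_B_left {B1 : L2C} (h : IsStream k U B B1) {F F1 : L2C} (hF : WDc F F1) :
    inner ℝ F1 B1 + (k ^ 2 * inner ℝ F B + inner ℝ F U) = 0 := by
  have := hF.inner_add h.second
  rwa [_root_.inner_add_right, real_inner_smul_right] at this

theorem IsStream.energy {B1 : L2C} (h : IsStream k U B B1) :
    inner ℝ B1 B1 + k ^ 2 * inner ℝ B B + inner ℝ B U = 0 := by
  have := h.inner_B_left h.first
  linarith

/-- The nonlocal term `2 i k B` does no work on `U`. -/
theorem IsStream.inner_I {B1 : L2C} (h : IsStream k U B B1) :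
    inner ℝ (Complex.I • B) U = 0 := by
  have := h.inner_B_left h.first.smul_I
  rw [inner_I_self, inner_I_self] at this
  linarith

/-- The energy identity `ν (‖U'‖² + k² ‖U‖²) = -⟨P, U⟩`, together with the regularity `U' ∈ L²` that
it presupposes: the transport term is skew, and the nonlocal term does no work. -/
theorem IsEvo.exists_deriv {B1 : L2C} (hν : 0 < ν) (h : IsEvo ν k U B P)
    (hs : IsStream k U B B1) :
    ∃ U1 : L2C, WDc U U1 ∧ WDc U1 (secondDeriv ν k U B P) ∧
      ν * inner ℝ U1 U1 + ν * k ^ 2 * inner ℝ U U + inner ℝ P U = 0 := by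
  have hIB : Integrable fun y => dot (Complex.I * B y) (U y) :=
    integrable_dot_congr (Lp.coeFn_smul Complex.I B) (ae_eq_refl U)
  have edot : ∀ y, dot (secondDeriv ν k U B P y) (U y) = ν⁻¹ * dot (P y) (U y) +
      (ν⁻¹ * ν * k ^ 2) * dot (U y) (U y) - (ν⁻¹ * 2 * k) * dot (Complex.I * B y) (U y) := by
    intro y
    simp [dot, secondDeriv, -Complex.ofReal_pow, -Complex.ofReal_mul, -Complex.ofReal_inv]; ring
  obtain ⟨f1, w1, w2, hm, hint⟩ := exists_memLp_WDc (Lp.memLp U)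
    (locallyIntegrable_secondDeriv ν k U B P) (fun η hη => (h.second hν η hη).1)
    (fun η hη => (h.second hν η hη).2) (by
      simp only [edot]
      exact (((integrable_dot' P U).const_mul _).add ((integrable_dot' U U).const_mul _)).sub
        (hIB.const_mul _))
  have hc : hm.toLp f1 =ᵐ[volume] f1 := hm.coeFn_toLp
  refine ⟨hm.toLp f1, w1.congr (ae_eq_refl _) hc.symm, w2.congr hc.symm (ae_eq_refl _), ?_⟩
  rw [inner_congr hc hc]
  have e2 : ∫ y, dot (secondDeriv ν k U B P y) (U y) = ν⁻¹ * inner ℝ P U +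
      (ν⁻¹ * ν * k ^ 2) * inner ℝ U U := by
    simp only [edot]
    rw [integral_sub (f := fun y => ν⁻¹ * dot (P y) (U y) + (ν⁻¹ * ν * k ^ 2) * dot (U y) (U y))
      (((integrable_dot' P U).const_mul _).add ((integrable_dot' U U).const_mul _))
      (hIB.const_mul _), integral_add ((integrable_dot' P U).const_mul _)
      ((integrable_dot' U U).const_mul _)]
    simp only [integral_const_mul]
    have := hs.inner_I
    rw [inner_congr (Lp.coeFn_smul Complex.I B) (ae_eq_refl U)] at this
    simp only [Pi.smul_apply, smul_eq_mul] at this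
    rw [this, ← inner_eq, ← inner_eq]; ring
  rw [e2] at hint
  have nz : ν ≠ 0 := hν.ne'
  field_simp at hint
  linarith

end Poiseuille

namespace Poiseuille

/-! ### Weighted regularity and the energy identities -/

variable {ν k : ℝ} {U V B B1 P R U1 : L2C}

/-- Multiplier `y² U - 2 B`: the transport part of the equation is a multiple of `i` times this
multiplier, so it drops out, and `y U' ∈ L²` follows together with the weighted energy identity. -/
theorem exists_mulY_deriv (hY : IsMulY U V) (hs : IsStream k U B B1) (hR : IsMulY P R)
    (w1 : WDc U U1) (w2 : WDc U1 (secondDeriv ν k U B P)) :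
    ∃ Y1 : L2C, IsMulY U1 Y1 ∧
      inner ℝ Y1 Y1 + (ν⁻¹ * (inner ℝ R V - 2 * inner ℝ P B) +
        ν⁻¹ * ν * k ^ 2 * (inner ℝ V V - 2 * inner ℝ U B) +
        2 * inner ℝ U1 V - 2 * inner ℝ U1 B1) = 0 := by
  have wM := (WDc.real_mul (WD_pow 2) w1).add (hs.first.const_mul (-2))
  have hh := w2.dot_mul wM
  let q : ℝ → ℝ := fun y => dot ((y : ℂ) * U1 y) ((y : ℂ) * U1 y)
  let r : ℝ → ℝ := fun y => ν⁻¹ * (dot ((y : ℂ) * P y) ((y : ℂ) * U y) - 2 * dot (P y) (B y)) +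
    ν⁻¹ * ν * k ^ 2 * (dot ((y : ℂ) * U y) ((y : ℂ) * U y) - 2 * dot (U y) (B y)) +
    2 * dot (U1 y) ((y : ℂ) * U y) - 2 * dot (U1 y) (B1 y)
  have i1 := integrable_dot_congr hR hY
  have i2 := integrable_dot_congr hY hY
  have i3 := integrable_dot_congr (ae_eq_refl U1) hY
  have j1 : Integrable fun y : ℝ => dot ((y : ℂ) * P y) ((y : ℂ) * U y) - 2 * dot (P y) (B y) :=
    i1.sub ((integrable_dot' P B).const_mul 2)
  have j2 : Integrable fun y : ℝ => dot ((y : ℂ) * U y) ((y : ℂ) * U y) - 2 * dot (U y) (B y) :=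
    i2.sub ((integrable_dot' U B).const_mul 2)
  have j12 : Integrable fun y : ℝ =>
      ν⁻¹ * (dot ((y : ℂ) * P y) ((y : ℂ) * U y) - 2 * dot (P y) (B y)) +
      ν⁻¹ * ν * k ^ 2 * (dot ((y : ℂ) * U y) ((y : ℂ) * U y) - 2 * dot (U y) (B y)) :=
    (j1.const_mul _).add (j2.const_mul _)
  have j123 : Integrable fun y : ℝ =>
      ν⁻¹ * (dot ((y : ℂ) * P y) ((y : ℂ) * U y) - 2 * dot (P y) (B y)) +
      ν⁻¹ * ν * k ^ 2 * (dot ((y : ℂ) * U y) ((y : ℂ) * U y) - 2 * dot (U y) (B y)) +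
      2 * dot (U1 y) ((y : ℂ) * U y) := j12.add (i3.const_mul 2)
  have hr : Integrable r := j123.sub ((integrable_dot' U1 B1).const_mul 2)
  have i4 : Integrable fun y : ℝ => dot (U y) ((y : ℂ) * U y) :=
    integrable_dot_congr (ae_eq_refl U) hY
  have hm : WD (fun y => (1 / 2 : ℝ) * dot ((y : ℂ) * U y) ((y : ℂ) * U y))
      (fun y => dot (U1 y) (((y ^ 2 : ℝ) : ℂ) * U y + ((-2 : ℝ) : ℂ) * B y) -
        (-2 * dot (U1 y) (B y) - dot (U y) ((y : ℂ) * U y))) := by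
    have w := WDc.real_mul WD_id w1
    convert (w.dot_mul w).const_mul (1 / 2) using 1
    funext y; simp [dot, -Complex.ofReal_pow]; ring
  have key := integrable_of_WD_add (q := q) (r := r)
    (by
      convert hh using 1
      funext y
      simp [q, r, dot, secondDeriv, -Complex.ofReal_pow, -Complex.ofReal_mul, -Complex.ofReal_inv]
      ring)
    hm (i2.const_mul _)
    (integrable_div_one_add_abs (((integrable_dot' U1 B).const_mul (-2)).sub i4)) hr
    (fun y => dot_self_nonneg _)
  have hmeas : AEStronglyMeasurable (fun y : ℝ => (y : ℂ) * U1 y) volume :=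
    Complex.continuous_ofReal.aestronglyMeasurable.mul (Lp.aestronglyMeasurable U1)
  have hmem := memLp_of_integrable_dot hmeas key.1
  refine ⟨hmem.toLp _, hmem.coeFn_toLp, ?_⟩
  rw [inner_congr hmem.coeFn_toLp hmem.coeFn_toLp]
  have e := key.2
  rw [integral_add key.1 hr] at e
  convert e using 2
  simp only [r]
  rw [integral_sub j123 ((integrable_dot' U1 B1).const_mul 2), integral_add j12 (i3.const_mul 2),
    integral_add (j1.const_mul _) (j2.const_mul _)]
  simp only [integral_const_mul]
  rw [integral_sub i1 ((integrable_dot' P B).const_mul 2),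
    integral_sub i2 ((integrable_dot' U B).const_mul 2)]
  simp only [integral_const_mul]
  rw [inner_congr hR hY, inner_congr hY hY, inner_congr (ae_eq_refl U1) hY, inner_eq, inner_eq,
    inner_eq]

/-- The cross term between `U''` and `i y² U` in the equation is a boundary term up to lower order,
whence both belong to `L²` separately. -/
theorem exists_second_deriv (hν : 0 < ν) (hk : 0 < k) {Y1 : L2C} (hY : IsMulY U V)
    (hY1 : IsMulY U1 Y1) (w1 : WDc U U1) (w2 : WDc U1 (secondDeriv ν k U B P)) :
    ∃ U2 W : L2C, WDc U1 U2 ∧ IsMulY V W ∧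
      P = ν • U2 - (ν * k ^ 2) • U - k • (Complex.I • W) + (2 * k) • (Complex.I • B) ∧
      inner ℝ (Complex.I • W) U2 = -2 * inner ℝ U1 (Complex.I • V) := by
  set G := secondDeriv ν k U B P with hGdef
  have hG : ∀ y, (ν : ℂ) * G y = P y + (ν * k ^ 2 : ℝ) * U y +
      Complex.I * ((k * y ^ 2 : ℝ) * U y) - Complex.I * ((2 * k : ℝ) * B y) := by
    intro y
    rw [hGdef, secondDeriv, ← mul_assoc, ← Complex.ofReal_mul, mul_inv_cancel₀ hν.ne',
      Complex.ofReal_one, one_mul]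
  have wI := (WDc.real_mul (WD_pow 2) w1).mul_I
  have hh := w2.dot_mul wI
  have hIV : (Complex.I • V : L2C) =ᵐ[volume] fun y => Complex.I * ((y : ℂ) * U y) := by
    filter_upwards [Lp.coeFn_smul Complex.I V, hY] with y h1 h2
    rw [h1, Pi.smul_apply, h2, smul_eq_mul]
  have i1 := integrable_dot_congr (ae_eq_refl U1) hIV
  have i2 : Integrable fun y : ℝ => dot (U1 y) (Complex.I * (((y ^ 2 : ℝ) : ℂ) * U y)) := by
    refine (integrable_dot_congr hY1 hIV).congr (Eventually.of_forall fun y => ?_)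
    simp [dot, -Complex.ofReal_pow]; ring
  let S : L2C := P + (ν * k ^ 2) • U - (2 * k) • (Complex.I • B)
  have hS : S =ᵐ[volume] fun y => (ν : ℂ) * G y - Complex.I * ((k * y ^ 2 : ℝ) * U y) := by
    filter_upwards [Lp.coeFn_sub (P + (ν * k ^ 2) • U) ((2 * k) • (Complex.I • B)),
      Lp.coeFn_add P ((ν * k ^ 2) • U), Lp.coeFn_smul (ν * k ^ 2) U,
      Lp.coeFn_smul (2 * k) (Complex.I • B), Lp.coeFn_smul Complex.I B] with y h1 h2 h3 h4 h5
    rw [h1, Pi.sub_apply, h2, Pi.add_apply, h3, h4, Pi.smul_apply, Pi.smul_apply, h5,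
      Pi.smul_apply, hG, Complex.real_smul, Complex.real_smul, smul_eq_mul]
    ring
  have i3 := integrable_dot_congr hS hS
  let q : ℝ → ℝ := fun y => ν ^ 2 * dot (G y) (G y) +
    k ^ 2 * dot (((y ^ 2 : ℝ) : ℂ) * U y) (((y ^ 2 : ℝ) : ℂ) * U y)
  let r : ℝ → ℝ := fun y => -dot ((ν : ℂ) * G y - Complex.I * ((k * y ^ 2 : ℝ) * U y))
      ((ν : ℂ) * G y - Complex.I * ((k * y ^ 2 : ℝ) * U y)) +
    (4 * ν * k) * dot (U1 y) (Complex.I * ((y : ℂ) * U y))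
  have hr : Integrable r := i3.neg.add (i1.const_mul _)
  have hq : ∀ y, 0 ≤ q y := fun y =>
    add_nonneg (mul_nonneg (sq_nonneg _) (dot_self_nonneg _))
      (mul_nonneg (sq_nonneg _) (dot_self_nonneg _))
  have key := integrable_of_WD_add
    (h := fun y => (2 * ν * k) * dot (U1 y) (Complex.I * (((y ^ 2 : ℝ) : ℂ) * U y)))
    (q := q) (r := r) (m := fun _ => 0)
    (n := fun y => (2 * ν * k) * dot (U1 y) (Complex.I * (((y ^ 2 : ℝ) : ℂ) * U y)))
    (by
      convert hh.const_mul (2 * ν * k) using 1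
      funext y
      simp [q, r, dot, -Complex.ofReal_pow, -Complex.ofReal_mul]
      ring)
    (by simpa using WD_zero)
    (integrable_zero _ _ _) (integrable_div_one_add_abs (i2.const_mul _)) hr hq
  have mG : AEStronglyMeasurable G volume :=
    (locallyIntegrable_secondDeriv ν k U B P).aestronglyMeasurable
  have mU2 : AEStronglyMeasurable (fun y : ℝ => ((y ^ 2 : ℝ) : ℂ) * U y) volume :=
    (Complex.continuous_ofReal.comp (continuous_pow 2)).aestronglyMeasurable.mul
      (Lp.aestronglyMeasurable U)
  have mdot : ∀ {f : ℝ → ℂ}, AEStronglyMeasurable f volume →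
      AEStronglyMeasurable (fun y => dot (f y) (f y)) volume := fun hf =>
    (Complex.continuous_re.comp_aestronglyMeasurable hf).mul
      (Complex.continuous_re.comp_aestronglyMeasurable hf) |>.add
      ((Complex.continuous_im.comp_aestronglyMeasurable hf).mul
      (Complex.continuous_im.comp_aestronglyMeasurable hf))
  have iG : Integrable fun y : ℝ => dot (G y) (G y) := by
    refine (key.1.const_mul (ν ^ 2)⁻¹).mono' (mdot mG) (Eventually.of_forall fun y => ?_)
    rw [Real.norm_of_nonneg (dot_self_nonneg _)]
    have := dot_self_nonneg (((y ^ 2 : ℝ) : ℂ) * U y)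
    have h2 : 0 ≤ k ^ 2 * dot (((y ^ 2 : ℝ) : ℂ) * U y) (((y ^ 2 : ℝ) : ℂ) * U y) := by positivity
    rw [inv_mul_eq_div, le_div_iff₀ (by positivity)]
    simp only [q]; linarith
  have iW : Integrable fun y : ℝ => dot (((y ^ 2 : ℝ) : ℂ) * U y) (((y ^ 2 : ℝ) : ℂ) * U y) := by
    refine (key.1.const_mul (k ^ 2)⁻¹).mono' (mdot mU2) (Eventually.of_forall fun y => ?_)
    rw [Real.norm_of_nonneg (dot_self_nonneg _)]
    have := dot_self_nonneg (G y)
    have h2 : 0 ≤ ν ^ 2 * dot (G y) (G y) := by positivity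
    rw [inv_mul_eq_div, le_div_iff₀ (by positivity)]
    simp only [q]; linarith
  have hG2 := memLp_of_integrable_dot mG iG
  have hW2 := memLp_of_integrable_dot mU2 iW
  have cG := hG2.coeFn_toLp
  have cW := hW2.coeFn_toLp
  have cIW : (Complex.I • hW2.toLp _ : L2C) =ᵐ[volume]
      fun y => Complex.I * (((y ^ 2 : ℝ) : ℂ) * U y) := by
    filter_upwards [Lp.coeFn_smul Complex.I (hW2.toLp _), cW] with y h1 h2
    rw [h1, Pi.smul_apply, h2, smul_eq_mul]
  refine ⟨hG2.toLp G, hW2.toLp _, w2.congr (ae_eq_refl _) cG.symm, ?_, ?_, ?_⟩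
  · filter_upwards [cW, hY] with y h1 h2
    rw [h1, h2]; push_cast; ring
  · apply Lp.ext
    filter_upwards [Lp.coeFn_add (ν • hG2.toLp G - (ν * k ^ 2) • U - k • (Complex.I • hW2.toLp _))
        ((2 * k) • (Complex.I • B)),
      Lp.coeFn_sub (ν • hG2.toLp G - (ν * k ^ 2) • U) (k • (Complex.I • hW2.toLp _)),
      Lp.coeFn_sub (ν • hG2.toLp G) ((ν * k ^ 2) • U), Lp.coeFn_smul ν (hG2.toLp G),
      Lp.coeFn_smul (ν * k ^ 2) U, Lp.coeFn_smul k (Complex.I • hW2.toLp _),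
      Lp.coeFn_smul (2 * k) (Complex.I • B), Lp.coeFn_smul Complex.I B, cG, cIW]
      with y h1 h2 h3 h4 h5 h6 h7 h8 h9 h10
    rw [h1, Pi.add_apply, h2, Pi.sub_apply, h3, Pi.sub_apply, h4, Pi.smul_apply, h5,
      Pi.smul_apply, h6, Pi.smul_apply, h7, Pi.smul_apply, h8, Pi.smul_apply, h9, h10,
      Complex.real_smul, Complex.real_smul, Complex.real_smul, Complex.real_smul, hG, smul_eq_mul]
    push_cast; ring
  · rw [inner_congr cIW cG, inner_congr (ae_eq_refl U1) hIV]
    have i4 : Integrable fun y : ℝ => dot (Complex.I * (((y ^ 2 : ℝ) : ℂ) * U y)) (G y) :=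
      integrable_dot_congr cIW cG
    have hh' : WD (fun y => dot (U1 y) (Complex.I * (((y ^ 2 : ℝ) : ℂ) * U y)))
        (fun y => dot (Complex.I * (((y ^ 2 : ℝ) : ℂ) * U y)) (G y) +
          2 * dot (U1 y) (Complex.I * ((y : ℂ) * U y))) := by
      convert hh using 1
      funext y; simp [dot, -Complex.ofReal_pow]; ring
    have key2 := integral_eq_zero_of_WD_integrable hh' i2 (i4.add (i1.const_mul 2))
    rw [integral_add i4 (i1.const_mul 2), integral_const_mul] at key2
    linarith

/-- The identity behind the uncertainty principle `‖U‖² ≤ 2 ‖y U‖ ‖U'‖`. -/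
theorem inner_mulY_deriv (hY : IsMulY U V) (w1 : WDc U U1) :
    inner ℝ U U + 2 * inner ℝ U1 V = 0 := by
  have i1 := integrable_dot_congr (ae_eq_refl U1) hY
  have i2 := integrable_dot_congr (ae_eq_refl U) hY
  have hh : WD (fun y => dot (U y) ((y : ℂ) * U y))
      (fun y => dot (U y) (U y) + 2 * dot (U1 y) ((y : ℂ) * U y)) := by
    convert WD_id.mul (w1.dot_mul w1) using 1
    · funext y; simp [dot]; ring
    · funext y; simp [dot]; ring
  have key := integral_eq_zero_of_WD_integrable hh i2 ((integrable_dot' U U).add (i1.const_mul 2))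
  rw [integral_add (integrable_dot' U U) (i1.const_mul 2), integral_const_mul] at key
  rw [inner_eq, inner_congr (ae_eq_refl U1) hY, key]

/-- The analogue of `inner_mulY_deriv` with the weight `y³` in place of `y`. -/
theorem inner_mulY_mulY_deriv {Y1 W : L2C} (hY : IsMulY U V) (hY1 : IsMulY U1 Y1)
    (hW : IsMulY V W) (w1 : WDc U U1) : 3 * inner ℝ V V + 2 * inner ℝ Y1 W = 0 := by
  have hW' : W =ᵐ[volume] fun y => (y : ℂ) * ((y : ℂ) * U y) := by
    filter_upwards [hW, hY] with y h1 h2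
    rw [h1, h2]
  have i1 := integrable_dot_congr hY1 hW'
  have i2 := integrable_dot_congr hY hW'
  have i3 := integrable_dot_congr hY hY
  have hh : WD (fun y => dot ((y : ℂ) * U y) ((y : ℂ) * ((y : ℂ) * U y)))
      (fun y => 3 * dot ((y : ℂ) * U y) ((y : ℂ) * U y) +
        2 * dot ((y : ℂ) * U1 y) ((y : ℂ) * ((y : ℂ) * U y))) := by
    convert (WD_pow 3).mul (w1.dot_mul w1) using 1
    · funext y; simp [dot]; ring
    · funext y; simp [dot]; ring
  have key := integral_eq_zero_of_WD_integrable hh i2 ((i3.const_mul 3).add (i1.const_mul 2))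
  rw [integral_add (i3.const_mul 3) (i1.const_mul 2), integral_const_mul, integral_const_mul] at key
  rw [inner_congr hY hY, inner_congr hY1 hW', key]

/-- Pohozaev-type identity, from the multiplier `y B'`. -/
theorem IsStream.inner_mulY (hs : IsStream k U B B1) (hY : IsMulY U V) :
    inner ℝ B1 B1 - k ^ 2 * inner ℝ B B + 2 * inner ℝ B1 V = 0 := by
  have i1 := integrable_dot_congr (ae_eq_refl B1) hY
  have i2 : Integrable fun y : ℝ => dot (B1 y) (B1 y) - k ^ 2 * dot (B y) (B y) :=
    (integrable_dot' B1 B1).sub ((integrable_dot' B B).const_mul (k ^ 2))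
  have cS : (k ^ 2 • B + U : L2C) =ᵐ[volume] fun y => ((k ^ 2 : ℝ) : ℂ) * B y + U y := by
    filter_upwards [Lp.coeFn_add (k ^ 2 • B) U, Lp.coeFn_smul (k ^ 2) B] with y h1 h2
    rw [h1, Pi.add_apply, h2, Pi.smul_apply, Complex.real_smul]
  have w2 := hs.second.congr (ae_eq_refl _) cS
  have hh : WD (fun y => y * (dot (B1 y) (B1 y) - k ^ 2 * dot (B y) (B y)))
      (fun y => (dot (B1 y) (B1 y) - k ^ 2 * dot (B y) (B y)) +
        2 * dot (B1 y) ((y : ℂ) * U y)) := by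
    convert WD_id.mul ((w2.dot_mul w2).add ((hs.first.dot_mul hs.first).const_mul (-k ^ 2))) using 1
    · funext y; simp only [dot]; ring
    · funext y; simp [dot, -Complex.ofReal_pow]; ring
  have i3 : Integrable fun y : ℝ =>
      y * (dot (B1 y) (B1 y) - k ^ 2 * dot (B y) (B y)) / (1 + |y|) := by
    refine i2.mono ?_ (Eventually.of_forall fun y => ?_)
    · exact (hh.left.aestronglyMeasurable.aemeasurable.div
        (measurable_const.add measurable_id.abs).aemeasurable).aestronglyMeasurable
    · have : 0 < 1 + |y| := by positivity
      rw [norm_div, norm_mul, Real.norm_of_nonneg this.le, div_le_iff₀ this, mul_comm,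
        Real.norm_eq_abs y]
      exact mul_le_mul_of_nonneg_left (by linarith) (norm_nonneg _)
  have key := integral_eq_zero_of_WD (m := fun _ => 0) hh (by simpa using WD_zero)
    (integrable_zero _ _ _) i3 (i2.add (i1.const_mul 2))
  rw [integral_add i2 (i1.const_mul 2), integral_sub (integrable_dot' B1 B1)
    ((integrable_dot' B B).const_mul _), integral_const_mul, integral_const_mul] at key
  rw [inner_eq, inner_eq, inner_congr (ae_eq_refl B1) hY, key]

/-- The identities behind the energy functional: the time derivatives of `‖U'‖²`, of
`⟨i y U, U'⟩` and of `‖y U‖² + 2 ‖∇B‖²` (where `P`, `P1`, `Q`, `Q1`, `R` stand for the time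
derivatives of `U`, `U'`, `B`, `B'`, `y U`). In the second one the nonlocal terms combine, by the
Pohozaev identity, to the favourable `-4 k ‖B'‖²`; in the third one the weight `y²` and the stream
function are paired so that all transport terms cancel. -/
theorem IsEvo.identities {P1 Q Q1 : L2C} (hν : 0 < ν) (hk : 0 < k) (h : IsEvo ν k U B P)
    (hY : IsMulY U V) (hs : IsStream k U B B1) (w1 : WDc U U1)
    (hR : IsMulY P R) (wP : WDc P P1) (hsQ : IsStream k P Q Q1) :
    ∃ U2 Y1 : L2C,
      inner ℝ P1 U1 = -ν * inner ℝ U2 U2 - ν * k ^ 2 * inner ℝ U1 U1 -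
        2 * k * inner ℝ (Complex.I • V) U1 ∧
      inner ℝ (Complex.I • R) U1 + inner ℝ (Complex.I • V) P1 = -2 * k * inner ℝ V V -
        4 * k * inner ℝ B1 B1 - 2 * ν * inner ℝ (Complex.I • Y1) U2 -
        2 * ν * k ^ 2 * inner ℝ (Complex.I • V) U1 ∧
      inner ℝ R V + 2 * inner ℝ Q1 B1 + 2 * k ^ 2 * inner ℝ Q B = -ν * inner ℝ Y1 Y1 -
        ν * k ^ 2 * inner ℝ V V - ν * inner ℝ U U := by
  obtain ⟨U1', w1', w2', -⟩ := h.exists_deriv hν hs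
  have w2 : WDc U1 (secondDeriv ν k U B P) := w2'.congr (w1'.unique w1) (ae_eq_refl _)
  obtain ⟨Y1, hY1, hYe⟩ := exists_mulY_deriv hY hs hR w1 w2
  obtain ⟨U2, W, wU2, hW, hP, hWe⟩ := exists_second_deriv hν hk hY hY1 w1 w2
  refine ⟨U2, Y1, ?_, ?_, ?_⟩
  · have e1 := wP.inner_add wU2
    have e2 := w1.inner_add wU2
    have e3 := hs.first.smul_I.inner_add wU2
    have e4 := hs.inner_B_left w1
    have e5 := hs.second.smul_I.inner_add w1
    have e6 := hs.inner_I
    have e7 : inner ℝ P U2 = ν * inner ℝ U2 U2 - ν * k ^ 2 * inner ℝ U U2 -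
        k * inner ℝ (Complex.I • W) U2 + 2 * k * inner ℝ (Complex.I • B) U2 := by
      conv_lhs => rw [hP]
      simp only [_root_.inner_add_left, inner_sub_left, real_inner_smul_left]
    rw [smul_add, _root_.inner_add_left, smul_comm, real_inner_smul_left, e6, inner_I_self] at e5
    have e8 := real_inner_comm (Complex.I • V) U1
    rw [hWe] at e7
    linear_combination e1 - e7 + ν * k ^ 2 * e2 - 2 * k * e8 - 2 * k * (e3 - e5)
  · have wV : WDc V (U + Y1 : L2C) := by
      refine (WDc.real_mul WD_id w1).congr (EventuallyEq.symm hY) ?_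
      filter_upwards [Lp.coeFn_add U Y1, hY1] with y h1 h2
      rw [h1, Pi.add_apply, h2, Complex.ofReal_one, one_mul]
    have mIU : ∀ {F G : L2C}, IsMulY F G → IsMulY (Complex.I • F) (Complex.I • G) := by
      intro F G hFG
      filter_upwards [Lp.coeFn_smul Complex.I F, Lp.coeFn_smul Complex.I G, hFG] with y h1 h2 h3
      rw [h1, h2, Pi.smul_apply, Pi.smul_apply, h3, smul_eq_mul, smul_eq_mul]; ring
    have e1 := wV.smul_I.inner_add wP
    rw [smul_add, _root_.inner_add_left] at e1
    have e2 := inner_I_left R U1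
    rw [hR.inner (mIU hY1)] at e2
    have e3 := real_inner_comm (Complex.I • Y1) P
    have e4 : inner ℝ (Complex.I • U) P = ν * inner ℝ (Complex.I • U) U2 - k * inner ℝ V V +
        2 * k * inner ℝ U B := by
      conv_lhs => rw [hP]
      simp only [_root_.inner_add_right, inner_sub_right, real_inner_smul_right, inner_I_I,
        inner_I_self, hY.inner hW]
      ring
    have e5 : inner ℝ (Complex.I • Y1) P = ν * inner ℝ (Complex.I • Y1) U2 -
        ν * k ^ 2 * inner ℝ (Complex.I • Y1) U - k * inner ℝ Y1 W + 2 * k * inner ℝ Y1 B := by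
      conv_lhs => rw [hP]
      simp only [_root_.inner_add_right, inner_sub_right, real_inner_smul_right, inner_I_I]
    have e6 := w1.smul_I.inner_add wU2
    rw [inner_I_self] at e6
    have e7 := (mIU hY1).inner hY
    have e8 := inner_I_left U1 V
    have e9 := wV.inner_add hs.first
    rw [_root_.inner_add_left] at e9
    have e10 := hs.inner_mulY hY
    have e11 := hs.energy
    have e12 := inner_mulY_mulY_deriv hY hY1 hW w1
    have e13 := real_inner_comm (Complex.I • V) U1
    have e14 := real_inner_comm B U
    have e15 := real_inner_comm V B1
    linear_combination e2 + e1 - e3 - e4 - 2 * e5 - ν * e6 + 2 * ν * k ^ 2 * (e7 + e8 - e13) +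
      k * e12 - 4 * k * e9 + 2 * k * e10 + 2 * k * e11 + 2 * k * e14 - 4 * k * e15
  · have e1 := hs.inner_B_left w1
    have e2 := inner_mulY_deriv hY w1
    have e3 := hsQ.second.inner_add hs.first
    rw [_root_.inner_add_left, real_inner_smul_left] at e3
    have nz : ν ≠ 0 := hν.ne'
    field_simp at hYe
    linear_combination hYe + 2 * e3 - ν * e2 + 2 * ν * e1

end Poiseuille

namespace Poiseuille

/-! ### The hypocoercive functional -/

theorem δ₀_pos : 0 < δ₀ := by unfold δ₀; positivity

theorem δ₀_pow_four : δ₀ ^ 4 = 1 / 512 := by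
  unfold δ₀
  rw [← Real.rpow_natCast, ← Real.rpow_mul (by norm_num)]
  norm_num

theorem ε₀_pos : 0 < ε₀ := by have := δ₀_pos; unfold ε₀; positivity

theorem one_div_twenty_le_ε₀ : 1 / 20 ≤ ε₀ := by
  have : 1 / 5 ≤ δ₀ := by
    refine le_of_pow_le_pow_left₀ (n := 4) (by norm_num) δ₀_pos.le ?_
    rw [δ₀_pow_four]; norm_num
  unfold ε₀; linarith

/-- The functional `½ (‖U‖² + α ‖U'‖² + 2 β ⟨i y U, U'⟩ + γ (‖y U‖² + 2 ‖∇B‖²))`, as a function of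
`U`, `V = y U`, `B`, `B1 = B'`, `U1 = U'`. -/
noncomputable def hypo (k α β γ : ℝ) (U V B B1 U1 : L2C) : ℝ :=
  1 / 2 * (inner ℝ U U + α * inner ℝ U1 U1 + 2 * β * inner ℝ (Complex.I • V) U1 +
    γ * (inner ℝ V V + 2 * inner ℝ B1 B1 + 2 * k ^ 2 * inner ℝ B B))

/-- The energy of one mode, which is `Q` up to the factor `4π`. -/
noncomputable def modeEnergy (k : ℝ) (U V B B1 : L2C) : ℝ :=
  1 / 2 * inner ℝ U U + γ₀ / 4 * (inner ℝ V V + 2 * (inner ℝ B1 B1 + k ^ 2 * inner ℝ B B))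

theorem norm_I_smul (V : L2C) : ‖(Complex.I • V : L2C)‖ = ‖V‖ := by
  rw [norm_smul, Complex.norm_I, one_mul]

/-- `2√(αγ)`-Young inequality in the form used for the cross terms. -/
theorem cross_le {α β γ x y : ℝ} (hα : 0 < α) (h : α * γ = 16 * β ^ 2) :
    8 * (β * (x * y)) ≤ α * x ^ 2 + γ * y ^ 2 := by
  have : 0 ≤ α * (α * x ^ 2 + γ * y ^ 2 - 8 * (β * (x * y))) := by
    have e : α * (α * x ^ 2 + γ * y ^ 2 - 8 * (β * (x * y))) = (α * x - 4 * β * y) ^ 2 := by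
      linear_combination y ^ 2 * h
    rw [e]; positivity
  have := nonneg_of_mul_nonneg_right this hα
  linarith

/-- The algebra of the hypocoercivity estimate. Here `a, n, v, g, z` are the norms of `U`, `U'`,
`y U`, `U''`, `y U'`, while `c = ‖B'‖²`, `d = k² ‖B‖²`, `J = ⟨i y U, U'⟩`, `S = ⟨i y U', U''⟩`, and
`r` is the decay rate. The relations `h1` to `h5` hold for the scaling `α ∼ √(ν/k)`, `β ∼ 1`,
`γ ∼ √(k/ν)`, `r ∼ √(ν k)`; the hypothesis `ha` is the uncertainty principle, and `hd` follows from
the Pohozaev identity. -/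
theorem hypo_dissipation {ν k α β γ r a n v g z c d J S : ℝ} (hν : 0 < ν) (hk : 0 < k)
    (hα : 0 < α) (hβ : 0 < β) (hγ : 0 < γ) (hr : 0 < r) (h1 : α * γ = 16 * β ^ 2)
    (h2 : 8 * α ^ 2 * k = ν * β) (h3 : r * γ = β * k / 4) (h4 : r * α = ν / 512)
    (h5 : 4 * r ^ 2 = β * ν * k) (hc : 0 ≤ c)
    (hJ : |J| ≤ v * n) (hS : |S| ≤ z * g) (ha : a ^ 2 ≤ 2 * (n * v)) (hd : d ≤ 2 * c + v ^ 2) :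
    (-ν * n ^ 2 - ν * k ^ 2 * a ^ 2) + α * (-ν * g ^ 2 - ν * k ^ 2 * n ^ 2 - 2 * k * J) +
      β * (-2 * k * v ^ 2 - 4 * k * c - 2 * ν * S - 2 * ν * k ^ 2 * J) +
      γ * (-ν * z ^ 2 - ν * k ^ 2 * v ^ 2 - ν * a ^ 2) ≤
    -r * (a ^ 2 + α * n ^ 2 + 2 * β * J + γ * (v ^ 2 + 2 * c + 2 * d)) := by
  have hJ' := abs_le.1 hJ
  have hS' := abs_le.1 hS
  have c1 := cross_le (x := g) (y := z) hα h1
  have c2 := cross_le (x := n) (y := v) hα h1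
  have bJ1 : -(β * (v * n)) ≤ β * J := by linear_combination β * hJ'.1
  have bJ2 : β * J ≤ β * (v * n) := by linear_combination β * hJ'.2
  have bS1 : -(β * (z * g)) ≤ β * S := by linear_combination β * hS'.1
  have t1 : -(2 * ν) * (β * S) ≤ ν / 4 * (α * g ^ 2 + γ * z ^ 2) := by
    linear_combination 2 * ν * bS1 + ν / 4 * c1
  have t2 : -(2 * (ν * k ^ 2)) * (β * J) ≤ ν * k ^ 2 / 4 * (α * n ^ 2 + γ * v ^ 2) := by
    linear_combination 2 * (ν * k ^ 2) * bJ1 + ν * k ^ 2 / 4 * c2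
  -- The term `2 α k J` is split between the dissipation `ν n²` and the gain `2 β k v²`.
  have t3 : -(2 * α * k) * J ≤ ν / 2 * n ^ 2 + β * k / 4 * v ^ 2 := by
    have e3 : 4 * α ^ 2 * k ^ 2 * v ^ 2 = ν * (β * k / 2 * v ^ 2) := by
      linear_combination (k * v ^ 2 / 2) * h2
    have e4 : 0 ≤ ν * (ν * n ^ 2 - 4 * α * k * (v * n) + β * k / 2 * v ^ 2) := by
      rw [show ν * (ν * n ^ 2 - 4 * α * k * (v * n) + β * k / 2 * v ^ 2) =
        (ν * n - 2 * α * k * v) ^ 2 by linear_combination -e3]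
      positivity
    have := nonneg_of_mul_nonneg_right e4 hν
    linear_combination 2 * α * k * hJ'.1 + this / 2
  -- By the uncertainty principle, `r a²` is controlled by dissipation and gain.
  have t4 : 2 * r * (n * v) ≤ ν / 3 * n ^ 2 + 3 / 4 * β * k * v ^ 2 := by
    have e4 : 0 ≤ ν * (ν * n ^ 2 - 6 * r * (v * n) + 9 / 4 * β * k * v ^ 2) := by
      rw [show ν * (ν * n ^ 2 - 6 * r * (v * n) + 9 / 4 * β * k * v ^ 2) =
        (ν * n - 3 * r * v) ^ 2 by linear_combination -(9 / 4 * v ^ 2) * h5]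
      positivity
    have := nonneg_of_mul_nonneg_right e4 hν
    linear_combination this / 3
  have t5 : r * a ^ 2 ≤ 2 * r * (n * v) := by linear_combination r * ha
  have t6 : 2 * r * (β * J) ≤ r / 4 * (α * n ^ 2 + γ * v ^ 2) := by
    linear_combination 2 * r * bJ2 + r / 4 * c2
  have t7 : r * γ * (2 * d) ≤ r * γ * (4 * c + 2 * v ^ 2) :=
    mul_le_mul_of_nonneg_left (by linarith) (by positivity)
  have p1 : 0 ≤ ν * k ^ 2 * a ^ 2 := by positivity
  have p2 : 0 ≤ γ * (ν * a ^ 2) := by positivity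
  have p3 : 0 ≤ α * (ν * g ^ 2) := by positivity
  have p4 : 0 ≤ γ * (ν * z ^ 2) := by positivity
  have p5 : 0 ≤ ν * k ^ 2 * (α * n ^ 2) := by positivity
  have p6 : 0 ≤ ν * k ^ 2 * (γ * v ^ 2) := by positivity
  have p7 : 0 ≤ β * k * v ^ 2 := by positivity
  have p8 : 0 ≤ β * k * c := by positivity
  have p9 : 0 ≤ ν * n ^ 2 := by positivity
  have q1 : r * (α * n ^ 2) = ν / 512 * n ^ 2 := by linear_combination n ^ 2 * h4
  have q2 : r * (γ * v ^ 2) = β * k / 4 * v ^ 2 := by linear_combination v ^ 2 * h3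
  have q3 : r * γ * c = β * k / 4 * c := by linear_combination c * h3
  linarith

/-- The static hypotheses on a mode `U` and its time derivative `P` at a fixed time; `V = y U`,
`B1 = B'`, `U1 = U'`, and `R`, `Q`, `Q1`, `P1` are the corresponding quantities for `P`. -/
structure IsRegular (ν k : ℝ) (U V B B1 U1 P R Q Q1 P1 : L2C) : Prop where
  evo : IsEvo ν k U B P
  mulY : IsMulY U V
  stream : IsStream k U B B1
  wd : WDc U U1
  mulY' : IsMulY P R
  stream' : IsStream k P Q Q1
  wd' : WDc P P1

variable {ν k : ℝ} {U V B B1 U1 P R Q Q1 P1 : L2C}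

namespace IsRegular

theorem energy (hν : 0 < ν) (h : IsRegular ν k U V B B1 U1 P R Q Q1 P1) :
    inner ℝ P U = -ν * inner ℝ U1 U1 - ν * k ^ 2 * inner ℝ U U := by
  obtain ⟨U1', w, -, e⟩ := h.evo.exists_deriv hν h.stream
  have : U1' = U1 := Lp.ext (w.unique h.wd)
  rw [this] at e
  linarith

theorem hypo_deriv_le (hν : 0 < ν) (hk : 0 < k) (h : IsRegular ν k U V B B1 U1 P R Q Q1 P1)
    {α β γ r : ℝ} (hα : 0 < α) (hβ : 0 < β) (hγ : 0 < γ) (hr : 0 < r) (h1 : α * γ = 16 * β ^ 2)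
    (h2 : 8 * α ^ 2 * k = ν * β) (h3 : r * γ = β * k / 4) (h4 : r * α = ν / 512)
    (h5 : 4 * r ^ 2 = β * ν * k) :
    inner ℝ P U + α * inner ℝ P1 U1 +
      β * (inner ℝ (Complex.I • R) U1 + inner ℝ (Complex.I • V) P1) +
      γ * (inner ℝ R V + 2 * inner ℝ Q1 B1 + 2 * k ^ 2 * inner ℝ Q B) ≤
    -(2 * r) * hypo k α β γ U V B B1 U1 := by
  obtain ⟨U2, Y1, i1, i2, i3⟩ := h.evo.identities hν hk h.mulY h.stream h.wd h.mulY' h.wd' h.stream'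
  have e := h.energy hν
  have u := inner_mulY_deriv h.mulY h.wd
  have p := h.stream.inner_mulY h.mulY
  have cs1 := abs_real_inner_le_norm (Complex.I • V) U1
  have cs2 := abs_real_inner_le_norm (Complex.I • Y1) U2
  have cs3 := abs_real_inner_le_norm U1 V
  have cs4 := abs_real_inner_le_norm B1 V
  rw [norm_I_smul] at cs1 cs2
  rw [i1, i2, i3, e, hypo]
  simp only [real_inner_self_eq_norm_sq] at u p ⊢
  have key := hypo_dissipation (a := ‖U‖) (n := ‖U1‖) (v := ‖V‖) (g := ‖U2‖) (z := ‖Y1‖)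
    (c := ‖B1‖ ^ 2) (d := k ^ 2 * ‖B‖ ^ 2) hν hk hα hβ hγ hr h1 h2 h3 h4 h5 (by positivity) cs1 cs2
    (by linarith [(abs_le.1 cs3).1])
    (by nlinarith [(abs_le.1 cs4).2, sq_nonneg (‖B1‖ - ‖V‖)])
  linarith

/-- The weighted part of the energy is nonincreasing on its own. -/
theorem weighted_deriv_nonpos (hν : 0 < ν) (hk : 0 < k)
    (h : IsRegular ν k U V B B1 U1 P R Q Q1 P1) :
    inner ℝ R V + 2 * inner ℝ Q1 B1 + 2 * k ^ 2 * inner ℝ Q B ≤ 0 := by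
  obtain ⟨U2, Y1, -, -, i3⟩ := h.evo.identities hν hk h.mulY h.stream h.wd h.mulY' h.wd' h.stream'
  rw [i3]
  simp only [real_inner_self_eq_norm_sq]
  have p1 : 0 ≤ ν * ‖Y1‖ ^ 2 := by positivity
  have p2 : 0 ≤ ν * k ^ 2 * ‖V‖ ^ 2 := by positivity
  have p3 : 0 ≤ ν * ‖U‖ ^ 2 := by positivity
  linarith

end IsRegular

/-- The condition `α γ = 16 β²` lets the cross term be absorbed. -/
theorem modeEnergy_le_hypo {α β γ : ℝ} (hα : 0 < α) (hβ : 0 < β) (h1 : α * γ = 16 * β ^ 2)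
    (hγ : γ₀ ≤ γ) : modeEnergy k U V B B1 ≤ hypo k α β γ U V B B1 U1 := by
  have cs1 := abs_real_inner_le_norm (Complex.I • V) U1
  rw [norm_I_smul] at cs1
  have c2 := cross_le (x := ‖U1‖) (y := ‖V‖) hα h1
  have bJ : -(β * (‖U1‖ * ‖V‖)) ≤ β * inner ℝ (Complex.I • V) U1 := by
    linear_combination β * (abs_le.1 cs1).1
  have g0 : 0 < γ₀ := by have := δ₀_pos; unfold γ₀; positivity
  unfold modeEnergy hypo
  simp only [real_inner_self_eq_norm_sq]
  have p1 : 0 ≤ α * ‖U1‖ ^ 2 := by positivity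
  have p2 : γ₀ * ‖V‖ ^ 2 ≤ γ * ‖V‖ ^ 2 := by gcongr
  have p3 : γ₀ * ‖B1‖ ^ 2 ≤ γ * ‖B1‖ ^ 2 := by gcongr
  have p4 : γ₀ * (k ^ 2 * ‖B‖ ^ 2) ≤ γ * (k ^ 2 * ‖B‖ ^ 2) := by gcongr
  have p5 : 0 ≤ γ₀ * ‖V‖ ^ 2 := by positivity
  have p6 : 0 ≤ γ₀ * ‖B1‖ ^ 2 := by positivity
  have p7 : 0 ≤ γ₀ * (k ^ 2 * ‖B‖ ^ 2) := by positivity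
  linarith

theorem hypo_le_modeEnergy {α β γ K : ℝ} (hα : 0 < α) (hβ : 0 < β) (h1 : α * γ = 16 * β ^ 2)
    (hγ : γ = γ₀ * K) (hK : 1 ≤ K) : hypo k α β γ U V B B1 U1 ≤
      5 / 8 * α * inner ℝ U1 U1 + 5 / 2 * K * modeEnergy k U V B B1 := by
  have cs1 := abs_real_inner_le_norm (Complex.I • V) U1
  rw [norm_I_smul] at cs1
  have c2 := cross_le (x := ‖U1‖) (y := ‖V‖) hα h1
  have bJ : β * inner ℝ (Complex.I • V) U1 ≤ β * (‖U1‖ * ‖V‖) := by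
    linear_combination β * (abs_le.1 cs1).2
  have g0 : 0 < γ₀ := by have := δ₀_pos; unfold γ₀; positivity
  unfold modeEnergy hypo
  subst hγ
  simp only [real_inner_self_eq_norm_sq]
  have p8 : 0 ≤ ‖U‖ ^ 2 := by positivity
  have p0 : ‖U‖ ^ 2 ≤ K * ‖U‖ ^ 2 := le_mul_of_one_le_left (by positivity) hK
  have p5 : 0 ≤ γ₀ * K * ‖V‖ ^ 2 := by positivity
  have p6 : 0 ≤ γ₀ * K * ‖B1‖ ^ 2 := by positivity
  have p7 : 0 ≤ γ₀ * K * (k ^ 2 * ‖B‖ ^ 2) := by positivity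
  linarith

end Poiseuille

namespace Poiseuille

/-! ### Decay for solutions regular in time and space -/

/-- A curve of regular modes, continuously differentiable in time. The curves `P`, `R`, `Q`, `Q1`,
`P1` are the time derivatives of `U`, `V`, `B`, `B1`, `U1`. -/
structure IsRegularCurve (ν k : ℝ) (U V B B1 U1 P R Q Q1 P1 : ℝ → L2C) : Prop where
  regular : ∀ t, 0 ≤ t →
    IsRegular ν k (U t) (V t) (B t) (B1 t) (U1 t) (P t) (R t) (Q t) (Q1 t) (P1 t)
  hasDeriv_U : ∀ t, HasDerivAt U (P t) t
  hasDeriv_V : ∀ t, HasDerivAt V (R t) t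
  hasDeriv_B : ∀ t, HasDerivAt B (Q t) t
  hasDeriv_B1 : ∀ t, HasDerivAt B1 (Q1 t) t
  hasDeriv_U1 : ∀ t, HasDerivAt U1 (P1 t) t

theorem hasDerivAt_inner_self {F F' : ℝ → L2C} {t : ℝ} (h : HasDerivAt F (F' t) t) :
    HasDerivAt (fun s => inner ℝ (F s) (F s)) (2 * inner ℝ (F' t) (F t)) t := by
  have := h.inner ℝ h
  rw [real_inner_comm (F' t) (F t), ← two_mul] at this
  exact this

/-- The final comparison: monotonicity up to the time where the exponential decay has absorbed the
factor `√(k/ν)` costs only the logarithm in the rate. -/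
theorem decay_with_log {ν k q Qt C t : ℝ} (hν : 0 < ν) (hν1 : ν ≤ 1) (hk : 1 ≤ k) (ht : 0 ≤ t)
    (hq : 0 ≤ q) (hC : Real.exp 1 ≤ C) {ε : ℝ} (hε : 0 < ε) (h1 : Qt ≤ q)
    (h2 : 1 < 2 * ε * (√ν * √k) * t →
      Qt ≤ C * (k / (√ν * √k)) * q * Real.exp (-(2 * ε * (√ν * √k) * t))) :
    Qt ≤ C * q * Real.exp (-2 * ε * (√ν * √k / (1 + |Real.log ν| + Real.log k)) * t) := by
  set L := |Real.log ν| + Real.log k with hL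
  have hL0 : 0 ≤ L := add_nonneg (abs_nonneg _) (Real.log_nonneg hk)
  have hk0 : 0 < k := by linarith
  have hC0 : 0 < C := (Real.exp_pos 1).trans_le hC
  set μ := √ν * √k with hμ
  have hμ0 : 0 < μ := mul_pos (Real.sqrt_pos.2 hν) (Real.sqrt_pos.2 hk0)
  set τ := 2 * ε * μ * t with hτ
  have hτ0 : 0 ≤ τ := by positivity
  have hexp : -2 * ε * (μ / (1 + |Real.log ν| + Real.log k)) * t = -(τ / (1 + L)) := by
    rw [hτ, hL, ← add_assoc]; ring
  rw [hexp]
  -- Either the claimed exponential is still at least `1 / e`, or `τ` beats the factor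
  -- `k / μ = exp (L / 2)`.
  rcases le_or_gt τ (1 + L) with h | h
  · have : Real.exp (-1) ≤ Real.exp (-(τ / (1 + L))) := by
      apply Real.exp_le_exp.2
      have : τ / (1 + L) ≤ 1 := by rw [div_le_one (by linarith)]; exact h
      linarith
    have h3 : 1 ≤ C * Real.exp (-(τ / (1 + L))) := by
      calc (1 : ℝ) = Real.exp 1 * Real.exp (-1) := by rw [← Real.exp_add]; simp
        _ ≤ _ := by gcongr
    calc Qt ≤ q * 1 := by linarith
      _ ≤ q * (C * Real.exp (-(τ / (1 + L)))) := by gcongr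
      _ = _ := by ring
  · refine (h2 (by linarith)).trans ?_
    have hK : k / μ = Real.exp (L / 2) := by
      have e1 : k / μ = √k / √ν := by
        rw [hμ]
        have := Real.mul_self_sqrt hk0.le
        have s1 := Real.sqrt_pos.2 hν
        have s2 := Real.sqrt_pos.2 hk0
        field_simp
        rw [sq]; exact this.symm
      rw [e1, ← Real.exp_log (div_pos (Real.sqrt_pos.2 hk0) (Real.sqrt_pos.2 hν)),
        Real.log_div (Real.sqrt_pos.2 hk0).ne' (Real.sqrt_pos.2 hν).ne',
        Real.log_sqrt hk0.le, Real.log_sqrt hν.le, hL, abs_of_nonpos (Real.log_nonpos hν.le hν1)]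
      congr 1; ring
    have : k / μ * Real.exp (-τ) ≤ Real.exp (-(τ / (1 + L))) := by
      rw [hK, ← Real.exp_add]
      apply Real.exp_le_exp.2
      have h5 : τ - τ / (1 + L) = L * (τ / (1 + L)) := by field_simp; ring
      have h6 : 1 ≤ τ / (1 + L) := by rw [le_div_iff₀ (by linarith)]; linarith
      nlinarith
    calc C * (k / μ) * q * Real.exp (-τ) = C * q * (k / μ * Real.exp (-τ)) := by ring
      _ ≤ _ := by gcongr

namespace IsRegularCurve

variable {ν k : ℝ} {U V B B1 U1 P R Q Q1 P1 : ℝ → L2C}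

theorem modeEnergy_antitone (h : IsRegularCurve ν k U V B B1 U1 P R Q Q1 P1) (hν : 0 < ν)
    (hk : 0 < k) :
    AntitoneOn (fun t => modeEnergy k (U t) (V t) (B t) (B1 t)) (Set.Ici 0) := by
  have hd : ∀ t, HasDerivAt (fun t => modeEnergy k (U t) (V t) (B t) (B1 t))
      (1 / 2 * (2 * inner ℝ (P t) (U t)) + γ₀ / 4 * (2 * inner ℝ (R t) (V t) +
        2 * (2 * inner ℝ (Q1 t) (B1 t) + k ^ 2 * (2 * inner ℝ (Q t) (B t))))) t := fun t =>
    ((hasDerivAt_inner_self (h.hasDeriv_U t)).const_mul _).add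
      (((hasDerivAt_inner_self (h.hasDeriv_V t)).add
        (((hasDerivAt_inner_self (h.hasDeriv_B1 t)).add
          ((hasDerivAt_inner_self (h.hasDeriv_B t)).const_mul _)).const_mul _)).const_mul _)
  refine antitoneOn_of_deriv_nonpos (convex_Ici 0)
    (fun t _ => (hd t).continuousAt.continuousWithinAt)
    (fun t _ => (hd t).differentiableAt.differentiableWithinAt) fun t ht => ?_
  rw [interior_Ici] at ht
  rw [(hd t).deriv]
  have r := h.regular t (le_of_lt ht)
  have e1 := r.energy hν
  have e2 := r.weighted_deriv_nonpos hν hk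
  have g0 : 0 < γ₀ := by have := δ₀_pos; unfold γ₀; positivity
  simp only [real_inner_self_eq_norm_sq] at e1
  have p1 : 0 ≤ ν * ‖U1 t‖ ^ 2 := by positivity
  have p2 : 0 ≤ ν * k ^ 2 * ‖U t‖ ^ 2 := by positivity
  have p3 := mul_le_mul_of_nonneg_left e2 g0.le
  linarith

/-- The energy dissipation provides a time at which `U'` is controlled by the datum. -/
theorem exists_time (h : IsRegularCurve ν k U V B B1 U1 P R Q Q1 P1) (hν : 0 < ν) {T : ℝ}
    (hT : 0 < T) : ∃ t ∈ Set.Ioo 0 T,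
      2 * ν * T * inner ℝ (U1 t) (U1 t) ≤ inner ℝ (U 0) (U 0) := by
  have hd : ∀ t, HasDerivAt (fun t => inner ℝ (U t) (U t)) (2 * inner ℝ (P t) (U t)) t := fun t =>
    hasDerivAt_inner_self (h.hasDeriv_U t)
  obtain ⟨t, ht, e⟩ := exists_hasDerivAt_eq_slope (fun t => inner ℝ (U t) (U t)) _ hT
    (fun t _ => (hd t).continuousAt.continuousWithinAt) (fun t _ => hd t)
  refine ⟨t, ht, ?_⟩
  have r := (h.regular t ht.1.le).energy hν
  rw [eq_div_iff (by linarith), r] at e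
  simp only [real_inner_self_eq_norm_sq] at e ⊢
  have p1 : 0 ≤ ‖U T‖ ^ 2 := by positivity
  have p2 : 0 ≤ ν * k ^ 2 * ‖U t‖ ^ 2 * T := by positivity
  linarith

/-- Grönwall's inequality for the hypocoercive functional. -/
theorem hypo_decay (h : IsRegularCurve ν k U V B B1 U1 P R Q Q1 P1) (hν : 0 < ν)
    (hk : 0 < k) {α β γ r : ℝ} (hα : 0 < α) (hβ : 0 < β) (hγ : 0 < γ) (hr : 0 < r)
    (h1 : α * γ = 16 * β ^ 2) (h2 : 8 * α ^ 2 * k = ν * β) (h3 : r * γ = β * k / 4)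
    (h4 : r * α = ν / 512) (h5 : 4 * r ^ 2 = β * ν * k) {s t : ℝ} (hs : 0 ≤ s) (hst : s ≤ t) :
    hypo k α β γ (U t) (V t) (B t) (B1 t) (U1 t) ≤
      hypo k α β γ (U s) (V s) (B s) (B1 s) (U1 s) * Real.exp (-(2 * r) * (t - s)) := by
  have hI : ∀ t, HasDerivAt (fun t => (Complex.I • V t : L2C)) (Complex.I • R t) t := fun t =>
    (h.hasDeriv_V t).const_smul Complex.I
  have hJ : ∀ t, HasDerivAt (fun t => inner ℝ (Complex.I • V t) (U1 t))
      (inner ℝ (Complex.I • V t) (P1 t) + inner ℝ (Complex.I • R t) (U1 t)) t := fun t =>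
    (hI t).inner ℝ (h.hasDeriv_U1 t)
  have hd : ∀ t, HasDerivAt (fun t => hypo k α β γ (U t) (V t) (B t) (B1 t) (U1 t))
      (1 / 2 * (2 * inner ℝ (P t) (U t) + α * (2 * inner ℝ (P1 t) (U1 t)) +
        2 * β * (inner ℝ (Complex.I • V t) (P1 t) + inner ℝ (Complex.I • R t) (U1 t)) +
        γ * (2 * inner ℝ (R t) (V t) + 2 * (2 * inner ℝ (Q1 t) (B1 t)) +
          2 * k ^ 2 * (2 * inner ℝ (Q t) (B t))))) t := fun t =>
    ((((hasDerivAt_inner_self (h.hasDeriv_U t)).add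
      ((hasDerivAt_inner_self (h.hasDeriv_U1 t)).const_mul _)).add ((hJ t).const_mul _)).add
      ((((hasDerivAt_inner_self (h.hasDeriv_V t)).add
        ((hasDerivAt_inner_self (h.hasDeriv_B1 t)).const_mul _)).add
          ((hasDerivAt_inner_self (h.hasDeriv_B t)).const_mul _)).const_mul _)).const_mul _
  have he : ∀ t, HasDerivAt (fun t => Real.exp (2 * r * t)) (Real.exp (2 * r * t) * (2 * r)) t := by
    intro t
    have := ((hasDerivAt_id t).const_mul (2 * r)).exp
    simpa using this
  have hE := fun t => (hd t).mul (he t)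
  have anti : AntitoneOn (fun t => hypo k α β γ (U t) (V t) (B t) (B1 t) (U1 t) *
      Real.exp (2 * r * t)) (Set.Ici 0) := by
    refine antitoneOn_of_deriv_nonpos (convex_Ici 0)
      (fun t _ => (hE t).continuousAt.continuousWithinAt)
      (fun t _ => (hE t).differentiableAt.differentiableWithinAt) fun t ht => ?_
    rw [interior_Ici] at ht
    refine (hE t).deriv.trans_le ?_
    have key := (h.regular t (le_of_lt ht)).hypo_deriv_le hν hk hα hβ hγ hr h1 h2 h3 h4 h5
    have hx := Real.exp_pos (2 * r * t)
    linear_combination Real.exp (2 * r * t) * key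
  have := anti (Set.mem_Ici.2 hs) (Set.mem_Ici.2 (hs.trans hst)) hst
  simp only at this
  have e : Real.exp (-(2 * r) * (t - s)) = Real.exp (2 * r * s) * Real.exp (-(2 * r * t)) := by
    rw [← Real.exp_add]; congr 1; ring
  rw [e, ← mul_assoc]
  calc _ = hypo k α β γ (U t) (V t) (B t) (B1 t) (U1 t) * Real.exp (2 * r * t) *
        Real.exp (-(2 * r * t)) := by rw [mul_assoc, ← Real.exp_add]; simp
    _ ≤ _ := by gcongr

theorem modeEnergy_nonneg (k : ℝ) (U V B B1 : L2C) : 0 ≤ modeEnergy k U V B B1 := by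
  have g0 : 0 < γ₀ := by have := δ₀_pos; unfold γ₀; positivity
  unfold modeEnergy
  simp only [real_inner_self_eq_norm_sq]
  positivity

/-- The decay estimate for regular solutions. The functional is used from a time `t₀` on at which
`U'` is controlled by the datum; before that, the energy is monotone. -/
theorem decay (h : IsRegularCurve ν k U V B B1 U1 P R Q Q1 P1) (hν : 0 < ν) (hν1 : ν ≤ 1)
    (hk : 1 ≤ k) {t : ℝ} (ht : 0 ≤ t) :
    modeEnergy k (U t) (V t) (B t) (B1 t) ≤ C₀ ^ 2 * modeEnergy k (U 0) (V 0) (B 0) (B1 0) *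
      Real.exp (-2 * ε₀ * (√ν * √k / (1 + |Real.log ν| + Real.log k)) * t) := by
  have hk0 : 0 < k := by linarith
  have dp := δ₀_pos
  have d4 := δ₀_pow_four
  have ap : 0 < α₀ := by unfold α₀; positivity
  have ep := ε₀_pos
  have hC : C₀ ^ 2 = 3 * Real.exp 1 * (1 + 2 * α₀ * ε₀) := by
    unfold C₀; exact Real.sq_sqrt (by positivity)
  have anti := h.modeEnergy_antitone hν hk0
  have hq := modeEnergy_nonneg k (U 0) (V 0) (B 0) (B1 0)
  refine decay_with_log hν hν1 hk ht hq ?_ ep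
    (anti (Set.mem_Ici.2 le_rfl) (Set.mem_Ici.2 ht) ht) fun hlt => ?_
  · rw [hC]
    have := Real.exp_pos 1
    have h2 : 0 ≤ Real.exp 1 * (α₀ * ε₀) := by positivity
    linarith
  set μ := √ν * √k with hμ
  have hμ0 : 0 < μ := mul_pos (Real.sqrt_pos.2 hν) (Real.sqrt_pos.2 hk0)
  have hμ2 : μ ^ 2 = ν * k := by rw [hμ, mul_pow, Real.sq_sqrt hν.le, Real.sq_sqrt hk0.le]
  set K := k / μ with hK
  have hK1 : 1 ≤ K := by
    rw [hK, le_div_iff₀ hμ0, one_mul]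
    have : μ ^ 2 ≤ k ^ 2 := by rw [hμ2, sq]; gcongr; linarith
    exact le_of_sq_le_sq this hk0.le
  -- Starting the hypocoercive decay at a time `t₀ < T` costs a factor `exp (2 ε₀ μ T) = e`.
  set T := 1 / (2 * ε₀ * μ) with hT
  have hT0 : 0 < T := by positivity
  obtain ⟨t₀, ht₀, hb⟩ := h.exists_time hν hT0
  have hTt : T < t := by
    rw [hT, div_lt_iff₀ (by positivity)]; linarith
  set α := α₀ * (ν / μ) with hα
  have hα0 : 0 < α := by positivity
  set γ := γ₀ * K with hγ
  have hg0 : 0 < γ₀ := by unfold γ₀; positivity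
  have hγ0 : 0 < γ := by positivity
  have h1 : α * γ = 16 * (δ₀ ^ 2 / 4) ^ 2 := by
    have e : ν / μ * (k / μ) = 1 := by
      rw [div_mul_div_comm, ← hμ2, sq, div_self (by positivity)]
    rw [hα, hγ, hK]
    calc _ = α₀ * γ₀ * (ν / μ * (k / μ)) := by ring
      _ = _ := by rw [e]; unfold α₀ γ₀; ring
  have h2 : 8 * α ^ 2 * k = ν * (δ₀ ^ 2 / 4) := by
    have e : (ν / μ) ^ 2 * k = ν := by
      rw [div_pow, hμ2]; field_simp
    calc 8 * α ^ 2 * k = 8 * α₀ ^ 2 * ((ν / μ) ^ 2 * k) := by rw [hα]; ring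
      _ = 128 * δ₀ ^ 4 * δ₀ ^ 2 * ν := by rw [e]; unfold α₀; ring
      _ = _ := by rw [d4]; ring
  have h3 : ε₀ * μ * γ = δ₀ ^ 2 / 4 * k / 4 := by
    have e : μ * (k / μ) = k := by field_simp
    calc ε₀ * μ * γ = ε₀ * γ₀ * (μ * (k / μ)) := by rw [hγ, hK]; ring
      _ = _ := by rw [e]; unfold ε₀ γ₀; ring
  have h4 : ε₀ * μ * α = ν / 512 := by
    have e : μ * (ν / μ) = ν := by field_simp
    calc ε₀ * μ * α = ε₀ * α₀ * (μ * (ν / μ)) := by rw [hα]; ring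
      _ = δ₀ ^ 4 * ν := by rw [e]; unfold ε₀ α₀; ring
      _ = _ := by rw [d4]; ring
  have h5 : 4 * (ε₀ * μ) ^ 2 = δ₀ ^ 2 / 4 * ν * k := by
    rw [mul_pow, hμ2]; unfold ε₀; ring
  have hβ0 : 0 < δ₀ ^ 2 / 4 := by positivity
  have dec := h.hypo_decay hν hk0 hα0 hβ0 hγ0 (mul_pos ep hμ0) h1 h2 h3 h4 h5 ht₀.1.le
    (ht₀.2.trans hTt).le
  have low := modeEnergy_le_hypo (k := k) (U := U t) (V := V t) (B := B t) (B1 := B1 t) (U1 := U1 t)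
    hα0 hβ0 h1 (le_mul_of_one_le_right hg0.le hK1)
  have up := hypo_le_modeEnergy (k := k) (U := U t₀) (V := V t₀) (B := B t₀) (B1 := B1 t₀)
    (U1 := U1 t₀) hα0 hβ0 h1 hγ hK1
  have mon := anti (Set.mem_Ici.2 le_rfl) (Set.mem_Ici.2 ht₀.1.le) ht₀.1.le
  simp only at mon
  set q := modeEnergy k (U 0) (V 0) (B 0) (B1 0) with hqdef
  have hU0 : inner ℝ (U 0) (U 0) ≤ 2 * q := by
    rw [hqdef]; unfold modeEnergy
    simp only [real_inner_self_eq_norm_sq]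
    have : 0 ≤ γ₀ / 4 * (‖V 0‖ ^ 2 + 2 * (‖B1 0‖ ^ 2 + k ^ 2 * ‖B 0‖ ^ 2)) := by positivity
    linarith
  -- The derivative part of the functional at `t₀` is controlled by the energy of the datum.
  have hU1 : α * inner ℝ (U1 t₀) (U1 t₀) ≤ 2 * α₀ * ε₀ * q := by
    have e : α = α₀ * ε₀ * (2 * ν * T) := by
      rw [hα, hT]; field_simp
    rw [e]
    calc _ = α₀ * ε₀ * (2 * ν * T * inner ℝ (U1 t₀) (U1 t₀)) := by ring
      _ ≤ α₀ * ε₀ * (2 * q) := mul_le_mul_of_nonneg_left (hb.trans hU0) (by positivity)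
      _ = _ := by ring
  have hup : hypo k α (δ₀ ^ 2 / 4) γ (U t₀) (V t₀) (B t₀) (B1 t₀) (U1 t₀) ≤
      3 * (1 + 2 * α₀ * ε₀) * K * q := by
    have m1 : K * modeEnergy k (U t₀) (V t₀) (B t₀) (B1 t₀) ≤ K * q := by gcongr
    have m2 : 2 * α₀ * ε₀ * q ≤ K * (2 * α₀ * ε₀ * q) := le_mul_of_one_le_left (by positivity) hK1
    have m3 : 0 ≤ K * q := by positivity
    have m4 : 0 ≤ K * (2 * α₀ * ε₀ * q) := by positivity
    linarith
  refine low.trans (dec.trans ?_)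
  have hexp : Real.exp (-(2 * (ε₀ * μ)) * (t - t₀)) ≤
      Real.exp 1 * Real.exp (-(2 * ε₀ * μ * t)) := by
    rw [← Real.exp_add]
    apply Real.exp_le_exp.2
    have : 2 * ε₀ * μ * t₀ ≤ 2 * ε₀ * μ * T := by gcongr; exact ht₀.2.le
    have e : 2 * ε₀ * μ * T = 1 := by rw [hT]; field_simp
    linarith
  calc _ ≤ 3 * (1 + 2 * α₀ * ε₀) * K * q * (Real.exp 1 * Real.exp (-(2 * ε₀ * μ * t))) := by
        gcongr
    _ = _ := by rw [hC]; ring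

end IsRegularCurve

end Poiseuille

namespace Poiseuille

/-! ### Averages in time -/

section avg

variable {E F : Type*} [NormedAddCommGroup E] [NormedSpace ℝ E] [CompleteSpace E]
  [NormedAddCommGroup F] [NormedSpace ℝ F] [CompleteSpace F]

/-- The forward average `h⁻¹ ∫ₜ^{t+h} f`. -/
noncomputable def avg (h : ℝ) (f : ℝ → E) (t : ℝ) : E := h⁻¹ • ∫ s in t..t + h, f s

theorem hasDerivAt_avg {f : ℝ → E} (hf : Continuous f) (h t : ℝ) :
    HasDerivAt (avg h f) (h⁻¹ • (f (t + h) - f t)) t := by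
  have hF : ∀ t, HasDerivAt (fun t => ∫ s in (0 : ℝ)..t, f s) (f t) t := fun t =>
    intervalIntegral.integral_hasDerivAt_right (hf.intervalIntegrable _ _)
      (hf.stronglyMeasurableAtFilter _ _) hf.continuousAt
  have h1 : HasDerivAt (fun t => ∫ s in (0 : ℝ)..t + h, f s) (f (t + h)) t :=
    (hF (t + h)).comp_add_const t h
  refine ((h1.sub (hF t)).const_smul h⁻¹).congr_of_eventuallyEq (Eventually.of_forall fun s => ?_)
  simp only [avg, Pi.smul_apply, Pi.sub_apply]
  rw [intervalIntegral.integral_interval_sub_left (hf.intervalIntegrable _ _)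
    (hf.intervalIntegrable _ _)]

theorem continuous_avg {f : ℝ → E} (hf : Continuous f) (h : ℝ) : Continuous (avg h f) :=
  continuous_iff_continuousAt.2 fun t => (hasDerivAt_avg hf h t).continuousAt

theorem map_avg (L : E →L[ℝ] F) {f : ℝ → E} (hf : Continuous f) (h t : ℝ) :
    L (avg h f t) = avg h (fun s => L (f s)) t := by
  rw [avg, avg, map_smul, ContinuousLinearMap.intervalIntegral_comp_comm _
    (hf.intervalIntegrable _ _)]

theorem avg_prod {f : ℝ → E} {g : ℝ → F} (hf : Continuous f) (hg : Continuous g) (h t : ℝ) :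
    avg h (fun s => (f s, g s)) t = (avg h f t, avg h g t) :=
  Prod.ext (map_avg (ContinuousLinearMap.fst ℝ E F) (hf.prodMk hg) h t)
    (map_avg (ContinuousLinearMap.snd ℝ E F) (hf.prodMk hg) h t)

theorem norm_avg_sub_le {f : ℝ → E} (hf : Continuous f) {h t ε : ℝ} (hh : 0 < h) (c : E)
    (hε : ∀ s ∈ Set.Icc t (t + h), ‖f s - c‖ ≤ ε) : ‖avg h f t - c‖ ≤ ε := by
  have e : avg h f t - c = h⁻¹ • ∫ s in t..t + h, (f s - c) := by
    rw [intervalIntegral.integral_sub (hf.intervalIntegrable _ _) (by simp),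
      intervalIntegral.integral_const, smul_sub, add_sub_cancel_left, smul_smul,
      inv_mul_cancel₀ hh.ne', one_smul, avg]
  rw [e, norm_smul, norm_inv, Real.norm_of_nonneg hh.le, inv_mul_le_iff₀ hh, mul_comm]
  refine (intervalIntegral.norm_integral_le_of_norm_le_const fun s hs => hε s ?_).trans ?_
  · rw [Set.uIoc_of_le (by linarith)] at hs
    exact ⟨hs.1.le, hs.2⟩
  · rw [add_sub_cancel_left, abs_of_pos hh]

theorem tendsto_avg_avg {f : ℝ → E} (hf : Continuous f) (t : ℝ) :
    Tendsto (fun h => avg h (avg h f) t) (𝓝[>] 0) (𝓝 (f t)) := by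
  rw [Metric.tendsto_nhds]
  intro ε hε
  obtain ⟨d, hd, hc⟩ := Metric.continuous_iff.1 hf t (ε / 2) (by positivity)
  filter_upwards [Ioo_mem_nhdsGT (show (0 : ℝ) < d / 2 by positivity)] with h hh
  rw [dist_eq_norm]
  refine lt_of_le_of_lt (norm_avg_sub_le (continuous_avg hf h) hh.1 _ (ε := ε / 2)
    fun s hs => norm_avg_sub_le hf hh.1 _ fun r hr => ?_) (by linarith)
  rw [← dist_eq_norm]
  refine (hc r ?_).le
  rw [Real.dist_eq, abs_lt]
  constructor <;> linarith [hs.1, hs.2, hr.1, hr.2, hh.1, hh.2]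

end avg

section linearRelation

variable {E F : Type*} [NormedAddCommGroup E] [NormedSpace ℝ E] [NormedAddCommGroup F]
  [NormedSpace ℝ F]

/-- Relations cut out by continuous linear functionals. Weak equations are of this kind, and are
therefore preserved by averages in time. -/
def IsLin (S : E → Prop) : Prop :=
  ∃ (ι : Type) (L : ι → E →L[ℝ] ℝ), ∀ z, S z ↔ ∀ i, L i z = 0

theorem IsLin.avg [CompleteSpace E] {S : E → Prop} (hS : IsLin S) {f : ℝ → E}
    (hf : Continuous f) {h t : ℝ} (hh : 0 < h)
    (hz : ∀ s ∈ Set.Icc t (t + h), S (f s)) : S (avg h f t) := by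
  obtain ⟨ι, L, hL⟩ := hS
  refine (hL _).2 fun i => ?_
  rw [map_avg _ hf, Poiseuille.avg, intervalIntegral.integral_congr (g := fun _ => 0)]
  · simp
  · intro s hs
    rw [Set.uIcc_of_le (by linarith)] at hs
    exact (hL _).1 (hz s hs) i

theorem IsLin.sub {S : E → Prop} (hS : IsLin S) {z w : E} (hz : S z) (hw : S w) : S (z - w) := by
  obtain ⟨ι, L, hL⟩ := hS
  refine (hL _).2 fun i => ?_
  rw [map_sub, (hL _).1 hz, (hL _).1 hw, sub_zero]

theorem IsLin.smul {S : E → Prop} (hS : IsLin S) {z : E} (c : ℝ) (hz : S z) : S (c • z) := by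
  obtain ⟨ι, L, hL⟩ := hS
  refine (hL _).2 fun i => ?_
  rw [map_smul, (hL _).1 hz, smul_zero]

theorem IsLin.and {S T : E → Prop} (hS : IsLin S) (hT : IsLin T) :
    IsLin fun z => S z ∧ T z := by
  obtain ⟨ι, L, hL⟩ := hS
  obtain ⟨κ, M, hM⟩ := hT
  refine ⟨ι ⊕ κ, Sum.elim L M, fun z => ?_⟩
  change S z ∧ T z ↔ _
  rw [hL, hM]
  simp

theorem IsLin.of_tests {S : E → Prop} (L : ∀ η, IsLineTest η → E →L[ℝ] ℝ)
    (h : ∀ z, S z ↔ ∀ η hη, L η hη z = 0) : IsLin S :=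
  ⟨{η // IsLineTest η}, fun η => L η.1 η.2, fun z => by rw [h]; simp⟩

theorem IsLin.comp {S : F → Prop} (hS : IsLin S) (A : E →L[ℝ] F) : IsLin fun z => S (A z) := by
  obtain ⟨ι, L, hL⟩ := hS
  exact ⟨ι, fun i => (L i).comp A, fun z => hL (A z)⟩

end linearRelation

/-! ### The static relations are linear and closed -/

theorem IsLineTest.memLp {η : ℝ → ℝ} (h : IsLineTest η) : MemLp (fun y => (η y : ℂ)) 2 :=
  (Complex.continuous_ofReal.comp h.continuous).memLp_of_hasCompactSupport
    (h.compact.comp_left Complex.ofReal_zero)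

/-- Pairing of the real part with a test function. -/
noncomputable def pairRe (η : ℝ → ℝ) (h : IsLineTest η) : L2C →L[ℝ] ℝ := innerSL ℝ (h.memLp.toLp _)

/-- Pairing of the imaginary part with a test function. -/
noncomputable def pairIm (η : ℝ → ℝ) (h : IsLineTest η) : L2C →L[ℝ] ℝ :=
  innerSL ℝ (Complex.I • h.memLp.toLp _ : L2C)

theorem pairRe_apply {η : ℝ → ℝ} (h : IsLineTest η) (U : L2C) :
    pairRe η h U = ∫ y, η y * (U y).re := by
  rw [pairRe, innerSL_apply_apply, inner_congr h.memLp.coeFn_toLp (ae_eq_refl U)]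
  simp [dot]

theorem pairIm_apply {η : ℝ → ℝ} (h : IsLineTest η) (U : L2C) :
    pairIm η h U = ∫ y, η y * (U y).im := by
  have : (Complex.I • h.memLp.toLp _ : L2C) =ᵐ[volume] fun y => Complex.I * (η y : ℂ) := by
    filter_upwards [Lp.coeFn_smul Complex.I (h.memLp.toLp _), h.memLp.coeFn_toLp] with y h1 h2
    rw [h1, Pi.smul_apply, h2, smul_eq_mul]
  rw [pairIm, innerSL_apply_apply, inner_congr this (ae_eq_refl U)]
  simp [dot]

open ContinuousLinearMap in
theorem isLin_WDc : IsLin fun z : L2C × L2C => WDc z.1 z.2 := by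
  have h : ∀ z : L2C × L2C, WDc z.1 z.2 ↔
      (∀ η hη, ((pairRe (deriv η) (IsLineTest.deriv hη)).comp (fst ℝ L2C L2C) +
        (pairRe η hη).comp (snd ℝ L2C L2C)) z = 0) ∧
      (∀ η hη, ((pairIm (deriv η) (IsLineTest.deriv hη)).comp (fst ℝ L2C L2C) +
        (pairIm η hη).comp (snd ℝ L2C L2C)) z = 0) := by
    intro z
    simp only [_root_.add_apply, coe_comp, Function.comp_apply, coe_fst', coe_snd',
      pairRe_apply, pairIm_apply]
    constructor
    · intro w
      exact ⟨fun η hη => by rw [w.re.eq η hη]; ring, fun η hη => by rw [w.im.eq η hη]; ring⟩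
    · rintro ⟨h1, h2⟩
      exact ⟨⟨locallyIntegrable_L2C_re _, locallyIntegrable_L2C_re _, fun η hη => by
        linarith [h1 η hη]⟩, ⟨locallyIntegrable_L2C_im _, locallyIntegrable_L2C_im _, fun η hη => by
        linarith [h2 η hη]⟩⟩
  simp only [h]
  exact (IsLin.of_tests _ fun z => Iff.rfl).and (IsLin.of_tests _ fun z => Iff.rfl)

open ContinuousLinearMap in
theorem isLin_mulY : IsLin fun z : L2C × L2C => IsMulY z.1 z.2 := by
  have h : ∀ z : L2C × L2C, IsMulY z.1 z.2 ↔
      (∀ η hη, ((pairRe (fun y => y ^ 1 * η y) (IsLineTest.pow_mul hη 1)).comp (fst ℝ L2C L2C) -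
        (pairRe η hη).comp (snd ℝ L2C L2C)) z = 0) ∧
      (∀ η hη, ((pairIm (fun y => y ^ 1 * η y) (IsLineTest.pow_mul hη 1)).comp (fst ℝ L2C L2C) -
        (pairIm η hη).comp (snd ℝ L2C L2C)) z = 0) := by
    intro z
    simp only [_root_.sub_apply, coe_comp, Function.comp_apply, coe_fst', coe_snd',
      pairRe_apply, pairIm_apply, sub_eq_zero, pow_one]
    constructor
    · intro w
      refine ⟨fun η hη => integral_congr_ae ?_, fun η hη => integral_congr_ae ?_⟩
      · filter_upwards [w] with y hy
        rw [hy]; simp; ring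
      · filter_upwards [w] with y hy
        rw [hy]; simp; ring
    · rintro ⟨h1, h2⟩
      have loc : ∀ {g : ℝ → ℝ}, LocallyIntegrable g → LocallyIntegrable fun y => y * g y := by
        intro g hg
        rw [← locallyIntegrableOn_univ] at hg ⊢
        exact hg.continuousOn_mul continuousOn_id isOpen_univ.isLocallyClosed
      have e1 := ae_eq_of_integral_contDiff_smul_eq (locallyIntegrable_L2C_re z.2)
        (loc (locallyIntegrable_L2C_re z.1)) fun η a b => by
          simp only [smul_eq_mul]
          rw [← h1 η ⟨a, b⟩]
          congr 1; funext y; ring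
      have e2 := ae_eq_of_integral_contDiff_smul_eq (locallyIntegrable_L2C_im z.2)
        (loc (locallyIntegrable_L2C_im z.1)) fun η a b => by
          simp only [smul_eq_mul]
          rw [← h2 η ⟨a, b⟩]
          congr 1; funext y; ring
      filter_upwards [e1, e2] with y h3 h4
      apply Complex.ext
      · rw [h3]; simp
      · rw [h4]; simp
  simp only [h]
  exact (IsLin.of_tests _ fun z => Iff.rfl).and (IsLin.of_tests _ fun z => Iff.rfl)

theorem IsLineTest.visc {η : ℝ → ℝ} (h : IsLineTest η) (ν k : ℝ) :
    IsLineTest fun y => ν * (_root_.deriv (_root_.deriv η) y - k ^ 2 * η y) := by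
  convert (h.deriv.deriv.add (h.const_mul (-k ^ 2))).const_mul ν using 2
  ring

open ContinuousLinearMap in
/-- `evoRe` as a continuous linear functional. -/
noncomputable def evoReL (ν k : ℝ) (η : ℝ → ℝ) (h : IsLineTest η) : L2C × L2C →L[ℝ] ℝ :=
  (pairRe _ (h.visc ν k)).comp (fst ℝ L2C L2C) + k • (pairIm _ (h.pow_mul 2)).comp (fst ℝ L2C L2C) -
    (2 * k) • (pairIm _ h).comp (snd ℝ L2C L2C)

open ContinuousLinearMap in
/-- `evoIm` as a continuous linear functional. -/
noncomputable def evoImL (ν k : ℝ) (η : ℝ → ℝ) (h : IsLineTest η) : L2C × L2C →L[ℝ] ℝ :=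
  (pairIm _ (h.visc ν k)).comp (fst ℝ L2C L2C) - k • (pairRe _ (h.pow_mul 2)).comp (fst ℝ L2C L2C) +
    (2 * k) • (pairRe _ h).comp (snd ℝ L2C L2C)

theorem evoReL_apply {ν k : ℝ} {η : ℝ → ℝ} (h : IsLineTest η) (U B : L2C) :
    evoReL ν k η h (U, B) = evoRe ν k η U B := by
  simp [evoReL, evoRe, pairRe_apply, pairIm_apply]

theorem evoImL_apply {ν k : ℝ} {η : ℝ → ℝ} (h : IsLineTest η) (U B : L2C) :
    evoImL ν k η h (U, B) = evoIm ν k η U B := by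
  simp [evoImL, evoIm, pairRe_apply, pairIm_apply]

open ContinuousLinearMap in
theorem isLin_evo (ν k : ℝ) : IsLin fun z : (L2C × L2C) × L2C => IsEvo ν k z.1.1 z.1.2 z.2 := by
  have h : ∀ z : (L2C × L2C) × L2C, IsEvo ν k z.1.1 z.1.2 z.2 ↔
      (∀ η hη, ((pairRe η hη).comp (snd ℝ (L2C × L2C) L2C) -
        (evoReL ν k η hη).comp (fst ℝ (L2C × L2C) L2C)) z = 0) ∧
      (∀ η hη, ((pairIm η hη).comp (snd ℝ (L2C × L2C) L2C) -
        (evoImL ν k η hη).comp (fst ℝ (L2C × L2C) L2C)) z = 0) := by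
    rintro ⟨⟨U, B⟩, P⟩
    simp only [_root_.sub_apply, coe_comp, Function.comp_apply, coe_fst', coe_snd',
      pairRe_apply, pairIm_apply, evoReL_apply, evoImL_apply, sub_eq_zero]
    exact ⟨fun w => ⟨w.re, w.im⟩, fun w => ⟨w.1, w.2⟩⟩
  simp only [h]
  exact (IsLin.of_tests _ fun z => Iff.rfl).and (IsLin.of_tests _ fun z => Iff.rfl)

open ContinuousLinearMap in
theorem isLin_stream (k : ℝ) :
    IsLin fun z : (L2C × L2C) × L2C => IsStream k z.1.1 z.1.2 z.2 := by
  have h : ∀ z : (L2C × L2C) × L2C, IsStream k z.1.1 z.1.2 z.2 ↔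
      WDc z.1.2 z.2 ∧ WDc z.2 (k ^ 2 • z.1.2 + z.1.1 : L2C) := fun z =>
    ⟨fun w => ⟨w.1, w.2⟩, fun w => ⟨w.1, w.2⟩⟩
  simp only [h]
  exact (isLin_WDc.comp (((snd ℝ L2C L2C).comp (fst ℝ (L2C × L2C) L2C)).prod
      (snd ℝ (L2C × L2C) L2C))).and
    (isLin_WDc.comp ((snd ℝ (L2C × L2C) L2C).prod
      ((k ^ 2 • (snd ℝ L2C L2C) + fst ℝ L2C L2C).comp (fst ℝ (L2C × L2C) L2C))))

end Poiseuille

namespace Poiseuille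

/-! ### Weak solutions of the mode equation -/

/-- A weak solution on `[0, ∞)` of `∂ₜ U = ν (U'' - k² U) - i k y² U + 2 i k B`,
`B'' - k² B = U`, with `V = y U` and `B1 = B'`, continuous in time with values in `L²`. The curves
are defined on the whole line for convenience, and constrained for nonnegative times only. -/
structure IsModeSolution (ν k : ℝ) (U V B B1 : ℝ → L2C) : Prop where
  cont_U : Continuous U
  cont_V : Continuous V
  cont_B : Continuous B
  cont_B1 : Continuous B1
  mulY : ∀ t, 0 ≤ t → IsMulY (U t) (V t)
  stream : ∀ t, 0 ≤ t → IsStream k (U t) (B t) (B1 t)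
  evo_re : ∀ t, 0 ≤ t → ∀ η, IsLineTest η → (∫ y, η y * (U t y).re) - ∫ y, η y * (U 0 y).re =
    ∫ s in (0 : ℝ)..t, evoRe ν k η (U s) (B s)
  evo_im : ∀ t, 0 ≤ t → ∀ η, IsLineTest η → (∫ y, η y * (U t y).im) - ∫ y, η y * (U 0 y).im =
    ∫ s in (0 : ℝ)..t, evoIm ν k η (U s) (B s)

variable {ν k : ℝ}

theorem IsEvo.norm_deriv_le {U B B1 P U1 : L2C} (hν : 0 < ν) (h : IsEvo ν k U B P)
    (hs : IsStream k U B B1) (w : WDc U U1) : ν * ‖U1‖ ^ 2 ≤ ‖P‖ * ‖U‖ := by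
  obtain ⟨U1', w', -, e⟩ := h.exists_deriv hν hs
  rw [Lp.ext (w'.unique w)] at e
  simp only [real_inner_self_eq_norm_sq] at e
  have := (abs_le.1 (abs_real_inner_le_norm P U)).1
  have : 0 ≤ ν * k ^ 2 * ‖U‖ ^ 2 := by positivity
  linarith

theorem continuous_diffQuot {U : ℝ → L2C} (hU : Continuous U) (h : ℝ) :
    Continuous fun s => h⁻¹ • (U (s + h) - U s) :=
  (by fun_prop : Continuous fun s => U (s + h) - U s).const_smul h⁻¹

namespace IsModeSolution

variable {U V B B1 : ℝ → L2C}

/-- The difference quotient over `[t, t + h]` is the right-hand side of the equation for the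
average over `[t, t + h]`. -/
theorem isEvo_avg (S : IsModeSolution ν k U V B B1) {h t : ℝ} (ht : 0 ≤ t) (hh : 0 < h) :
    IsEvo ν k (avg h U t) (avg h B t) (h⁻¹ • (U (t + h) - U t)) := by
  have hc : Continuous fun s => (U s, B s) := S.cont_U.prodMk S.cont_B
  constructor
  · intro η hη
    have e1 := S.evo_re t ht η hη
    have e2 := S.evo_re (t + h) (by linarith) η hη
    simp only [← pairRe_apply hη] at e1 e2 ⊢
    simp only [← evoReL_apply hη] at e1 e2 ⊢
    have hci : ∀ a b, IntervalIntegrable (fun s => evoReL ν k η hη (U s, B s)) volume a b :=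
      fun a b => ((evoReL ν k η hη).continuous.comp hc).intervalIntegrable a b
    rw [map_smul, map_sub, ← avg_prod S.cont_U S.cont_B, map_avg _ hc, avg,
      ← intervalIntegral.integral_interval_sub_left (hci 0 (t + h)) (hci 0 t), ← e1, ← e2]
    congr 1; ring
  · intro η hη
    have e1 := S.evo_im t ht η hη
    have e2 := S.evo_im (t + h) (by linarith) η hη
    simp only [← pairIm_apply hη] at e1 e2 ⊢
    simp only [← evoImL_apply hη] at e1 e2 ⊢
    have hci : ∀ a b, IntervalIntegrable (fun s => evoImL ν k η hη (U s, B s)) volume a b :=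
      fun a b => ((evoImL ν k η hη).continuous.comp hc).intervalIntegrable a b
    rw [map_smul, map_sub, ← avg_prod S.cont_U S.cont_B, map_avg _ hc, avg,
      ← intervalIntegral.integral_interval_sub_left (hci 0 (t + h)) (hci 0 t), ← e1, ← e2]
    congr 1; ring

protected theorem avg (S : IsModeSolution ν k U V B B1) {h : ℝ} (hh : 0 < h) :
    IsModeSolution ν k (avg h U) (avg h V) (avg h B) (avg h B1) where
  cont_U := continuous_avg S.cont_U h
  cont_V := continuous_avg S.cont_V h
  cont_B := continuous_avg S.cont_B h
  cont_B1 := continuous_avg S.cont_B1 h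
  mulY t ht := by
    have := isLin_mulY.avg (S.cont_U.prodMk S.cont_V) hh
      (fun s (hs : s ∈ Set.Icc t (t + h)) => S.mulY s (ht.trans hs.1))
    rwa [avg_prod S.cont_U S.cont_V] at this
  stream t ht := by
    have := (isLin_stream k).avg ((S.cont_U.prodMk S.cont_B).prodMk S.cont_B1) hh
      (fun s (hs : s ∈ Set.Icc t (t + h)) => S.stream s (ht.trans hs.1))
    rwa [avg_prod (S.cont_U.prodMk S.cont_B) S.cont_B1, avg_prod S.cont_U S.cont_B] at this
  evo_re t ht η hη := by
    have hd : ∀ s, HasDerivAt (fun s => pairRe η hη (avg h U s))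
        (pairRe η hη (h⁻¹ • (U (s + h) - U s))) s := fun s =>
      (pairRe η hη).hasFDerivAt.comp_hasDerivAt s (hasDerivAt_avg S.cont_U h s)
    have hc : Continuous fun s => pairRe η hη (h⁻¹ • (U (s + h) - U s)) :=
      (pairRe η hη).continuous.comp (continuous_diffQuot S.cont_U h)
    rw [← pairRe_apply hη, ← pairRe_apply hη, ← intervalIntegral.integral_eq_sub_of_hasDerivAt
      (fun s _ => hd s) (hc.intervalIntegrable _ _)]
    refine intervalIntegral.integral_congr fun s hs => ?_
    rw [Set.uIcc_of_le ht] at hs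
    rw [pairRe_apply, (S.isEvo_avg hs.1 hh).re η hη]
  evo_im t ht η hη := by
    have hd : ∀ s, HasDerivAt (fun s => pairIm η hη (avg h U s))
        (pairIm η hη (h⁻¹ • (U (s + h) - U s))) s := fun s =>
      (pairIm η hη).hasFDerivAt.comp_hasDerivAt s (hasDerivAt_avg S.cont_U h s)
    have hc : Continuous fun s => pairIm η hη (h⁻¹ • (U (s + h) - U s)) :=
      (pairIm η hη).continuous.comp (continuous_diffQuot S.cont_U h)
    rw [← pairIm_apply hη, ← pairIm_apply hη, ← intervalIntegral.integral_eq_sub_of_hasDerivAt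
      (fun s _ => hd s) (hc.intervalIntegrable _ _)]
    refine intervalIntegral.integral_congr fun s hs => ?_
    rw [Set.uIcc_of_le ht] at hs
    rw [pairIm_apply, (S.isEvo_avg hs.1 hh).im η hη]

/-- One average in time makes the `y`-derivative a continuous curve in `L²`. -/
theorem exists_deriv_avg (S : IsModeSolution ν k U V B B1) (hν : 0 < ν) {h : ℝ} (hh : 0 < h) :
    ∃ U1 : ℝ → L2C, Continuous U1 ∧ ∀ t, 0 ≤ t → WDc (avg h U t : L2C) (U1 t) := by
  have A := S.avg hh
  let P : ℝ → L2C := fun t => h⁻¹ • (U (t + h) - U t)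
  have hP : Continuous P := continuous_diffQuot S.cont_U h
  have hE : ∀ t, 0 ≤ t → IsEvo ν k (avg h U t) (avg h B t) (P t) := fun t ht => S.isEvo_avg ht hh
  have hex : ∀ t : ℝ, ∃ U1 : L2C, WDc (avg h U (max t 0) : L2C) U1 := fun t =>
    let ⟨U1, w, _⟩ := (hE _ (le_max_right t 0)).exists_deriv hν (A.stream _ (le_max_right t 0))
    ⟨U1, w⟩
  choose U1 hU1 using hex
  refine ⟨U1, ?_, fun t ht => by simpa [max_eq_left ht] using hU1 t⟩
  rw [continuous_iff_continuousAt]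
  intro s
  let g : ℝ → ℝ := fun t => √(ν⁻¹ * (‖P (max t 0) - P (max s 0)‖ *
    ‖avg h U (max t 0) - avg h U (max s 0)‖))
  have hg : Continuous g := by
    have h1 : Continuous fun t : ℝ => P (max t 0) := hP.comp (continuous_id.max continuous_const)
    have h2 : Continuous fun t : ℝ => avg h U (max t 0) :=
      A.cont_U.comp (continuous_id.max continuous_const)
    fun_prop
  have hg0 : Tendsto g (𝓝 s) (𝓝 0) := by
    have := hg.tendsto s
    simpa [g] using this
  rw [ContinuousAt, tendsto_iff_norm_sub_tendsto_zero]
  refine squeeze_zero (fun t => norm_nonneg _) (fun t => ?_) hg0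
  have pt := le_max_right t 0
  have ps := le_max_right s 0
  have e := (isLin_evo ν k).sub (z := ((_, _), _)) (w := ((_, _), _)) (hE _ pt) (hE _ ps)
  have st := (isLin_stream k).sub (z := ((_, _), _)) (w := ((_, _), _))
    (A.stream _ pt) (A.stream _ ps)
  have w := isLin_WDc.sub (z := (_, _)) (w := (_, _)) (hU1 t) (hU1 s)
  have key := IsEvo.norm_deriv_le hν e st w
  apply Real.le_sqrt_of_sq_le
  rw [inv_mul_eq_div, le_div_iff₀ hν, mul_comm]
  exact key

/-- Two averages in time make a weak solution regular in time and space. -/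
theorem exists_isRegularCurve (S : IsModeSolution ν k U V B B1) (hν : 0 < ν) {h : ℝ}
    (hh : 0 < h) : ∃ U1 P R Q Q1 P1 : ℝ → L2C,
      IsRegularCurve ν k (avg h (avg h U)) (avg h (avg h V)) (avg h (avg h B)) (avg h (avg h B1))
        U1 P R Q Q1 P1 := by
  have A := S.avg hh
  have AA := A.avg hh
  obtain ⟨U1, hc, hw⟩ := S.exists_deriv_avg hν hh
  refine ⟨avg h U1, fun t => h⁻¹ • (avg h U (t + h) - avg h U t),
    fun t => h⁻¹ • (avg h V (t + h) - avg h V t), fun t => h⁻¹ • (avg h B (t + h) - avg h B t),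
    fun t => h⁻¹ • (avg h B1 (t + h) - avg h B1 t), fun t => h⁻¹ • (U1 (t + h) - U1 t),
    fun t ht => ?_, fun t => hasDerivAt_avg A.cont_U h t, fun t => hasDerivAt_avg A.cont_V h t,
    fun t => hasDerivAt_avg A.cont_B h t, fun t => hasDerivAt_avg A.cont_B1 h t,
    fun t => hasDerivAt_avg hc h t⟩
  have hth : 0 ≤ t + h := by linarith
  refine ⟨A.isEvo_avg ht hh, AA.mulY t ht, AA.stream t ht, ?_, ?_, ?_, ?_⟩
  · have := isLin_WDc.avg (A.cont_U.prodMk hc) hh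
      (fun s (hs : s ∈ Set.Icc t (t + h)) => hw s (ht.trans hs.1))
    rwa [avg_prod A.cont_U hc] at this
  · exact isLin_mulY.smul h⁻¹ (isLin_mulY.sub (z := (_, _)) (w := (_, _))
      (A.mulY _ hth) (A.mulY _ ht))
  · exact (isLin_stream k).smul h⁻¹ ((isLin_stream k).sub (z := ((_, _), _)) (w := ((_, _), _))
      (A.stream _ hth) (A.stream _ ht))
  · exact isLin_WDc.smul h⁻¹ (isLin_WDc.sub (z := (_, _)) (w := (_, _)) (hw _ hth) (hw _ ht))

/-- The decay estimate passes from the averaged solutions to the solution itself, since the energy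
involves no derivative of `U`. -/
theorem decay (S : IsModeSolution ν k U V B B1) (hν : 0 < ν) (hν1 : ν ≤ 1)
    (hk : 1 ≤ k) {t : ℝ} (ht : 0 ≤ t) :
    modeEnergy k (U t) (V t) (B t) (B1 t) ≤ C₀ ^ 2 * modeEnergy k (U 0) (V 0) (B 0) (B1 0) *
      Real.exp (-2 * ε₀ * (√ν * √k / (1 + |Real.log ν| + Real.log k)) * t) := by
  have lim : ∀ t, Tendsto (fun h => modeEnergy k (avg h (avg h U) t) (avg h (avg h V) t)
      (avg h (avg h B) t) (avg h (avg h B1) t)) (𝓝[>] 0)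
      (𝓝 (modeEnergy k (U t) (V t) (B t) (B1 t))) := by
    intro t
    have l1 := tendsto_avg_avg S.cont_U t
    have l2 := tendsto_avg_avg S.cont_V t
    have l3 := tendsto_avg_avg S.cont_B t
    have l4 := tendsto_avg_avg S.cont_B1 t
    exact ((l1.inner l1).const_mul _).add (((l2.inner l2).add
      (((l4.inner l4).add ((l3.inner l3).const_mul _)).const_mul _)).const_mul _)
  refine le_of_tendsto_of_tendsto (lim t) (((lim 0).const_mul _).mul_const _) ?_
  filter_upwards [self_mem_nhdsWithin] with h hh
  obtain ⟨U1, P, R, Q, Q1, P1, hreg⟩ := S.exists_isRegularCurve hν (h := h) hh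
  exact hreg.decay hν hν1 hk ht

end IsModeSolution

end Poiseuille

namespace Poiseuille

/-! ### Fourier coefficients on the cylinder -/

/-- Lebesgue measure on one period. -/
noncomputable def per : Measure ℝ := volume.restrict (Set.Ioc 0 (2 * Real.pi))

instance : IsFiniteMeasure per := by unfold per; infer_instance

theorem cyl_eq_prod : cyl = per.prod (volume : Measure ℝ) := by
  unfold cyl per
  rw [Measure.volume_eq_prod, ← Measure.prod_restrict, Measure.restrict_univ]

theorem two_pi_pos : 0 < 2 * Real.pi := by positivity

theorem per_real_univ : per.real Set.univ = 2 * Real.pi := by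
  simp [per, Measure.real]
  exact Real.pi_pos.le

theorem integral_cyl {E : Type*} [NormedAddCommGroup E] [NormedSpace ℝ E]
    {f : ℝ × ℝ → E} (hf : Integrable f cyl) : ∫ p, f p ∂cyl = ∫ y, ∫ x, f (x, y) ∂per := by
  rw [cyl_eq_prod] at hf ⊢
  exact integral_prod_symm f hf

theorem integral_cyl' {E : Type*} [NormedAddCommGroup E] [NormedSpace ℝ E]
    {f : ℝ × ℝ → E} (hf : Integrable f cyl) : ∫ p, f p ∂cyl = ∫ x, (∫ y, f (x, y)) ∂per := by
  rw [cyl_eq_prod] at hf ⊢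
  exact integral_prod f hf

theorem fourierCoef_eq (l : ℤ) (f : ℝ × ℝ → ℝ) (y : ℝ) : fourierCoef l f y =
    (1 / (2 * Real.pi) : ℂ) * ∫ x, (f (x, y) : ℂ) * Complex.exp (-(Complex.I * l * x)) ∂per := by
  rw [fourierCoef, intervalIntegral.integral_of_le two_pi_pos.le]; rfl

theorem norm_character (l : ℤ) (x : ℝ) : ‖Complex.exp (-(Complex.I * l * x))‖ = 1 := by
  have : -(Complex.I * l * x) = ((-(l * x) : ℝ) : ℂ) * Complex.I := by push_cast; ring
  rw [this, Complex.norm_exp_ofReal_mul_I]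

theorem aestronglyMeasurable_fourierCoef (l : ℤ) {f : ℝ × ℝ → ℝ}
    (hf : AEStronglyMeasurable f cyl) : AEStronglyMeasurable (fourierCoef l f) volume := by
  have e : fourierCoef l f = fun y => (1 / (2 * Real.pi) : ℂ) *
      ∫ x, (f (x, y) : ℂ) * Complex.exp (-(Complex.I * l * x)) ∂per :=
    funext fun y => fourierCoef_eq l f y
  rw [e]
  refine AEStronglyMeasurable.const_mul ?_ _
  have h1 : AEStronglyMeasurable
      (fun p : ℝ × ℝ => (f p : ℂ) * Complex.exp (-(Complex.I * l * p.1))) cyl :=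
    (Complex.continuous_ofReal.comp_aestronglyMeasurable hf).mul
      (by fun_prop : Continuous fun p : ℝ × ℝ =>
        Complex.exp (-(Complex.I * l * p.1))).aestronglyMeasurable
  rw [cyl_eq_prod] at h1
  exact h1.prod_swap.integral_prod_right'

/-- Bessel's inequality for one coefficient, in each fiber. -/
theorem norm_fourierCoef_sq_le (l : ℤ) {f : ℝ × ℝ → ℝ} {y : ℝ}
    (h : MemLp (fun x => f (x, y)) 2 per) :
    ‖fourierCoef l f y‖ ^ 2 ≤ 1 / (2 * Real.pi) * ∫ x, f (x, y) ^ 2 ∂per := by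
  have hi : Integrable (fun x => |f (x, y)|) per := (h.integrable (by norm_num)).abs
  have hsq : Integrable (fun x => f (x, y) ^ 2) per := h.integrable_sq
  set c := 1 / (2 * Real.pi) * ∫ x, |f (x, y)| ∂per with hc
  have hpi := two_pi_pos
  have hn : ‖fourierCoef l f y‖ ≤ c := by
    rw [fourierCoef_eq, norm_mul, hc]
    have : ‖(1 / (2 * Real.pi) : ℂ)‖ = 1 / (2 * Real.pi) := by
      rw [show (1 / (2 * Real.pi) : ℂ) = ((1 / (2 * Real.pi) : ℝ) : ℂ) by push_cast; ring,
        Complex.norm_real, Real.norm_of_nonneg (by positivity)]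
    rw [this]
    gcongr
    refine (norm_integral_le_integral_norm _).trans (le_of_eq ?_)
    congr 1; funext x
    rw [norm_mul, norm_character, mul_one, Complex.norm_real, Real.norm_eq_abs]
  have hvar : 0 ≤ ∫ x, (|f (x, y)| - c) ^ 2 ∂per := integral_nonneg fun x => sq_nonneg _
  have e : ∫ x, (|f (x, y)| - c) ^ 2 ∂per =
      (∫ x, f (x, y) ^ 2 ∂per) - 2 * c * (∫ x, |f (x, y)| ∂per) + 2 * Real.pi * c ^ 2 := by
    have e0 : ∀ x, (|f (x, y)| - c) ^ 2 = f (x, y) ^ 2 - 2 * c * |f (x, y)| + c ^ 2 := by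
      intro x; rw [sub_sq, sq_abs]; ring
    simp only [e0]
    have i1 : Integrable (fun x => f (x, y) ^ 2 - 2 * c * |f (x, y)|) per :=
      hsq.sub (hi.const_mul _)
    rw [integral_add i1 (integrable_const _), integral_sub hsq (hi.const_mul _),
      integral_const_mul, integral_const, per_real_univ, smul_eq_mul]
  have e2 : ∫ x, |f (x, y)| ∂per = 2 * Real.pi * c := by rw [hc]; field_simp
  rw [e, e2] at hvar
  have h3 : ‖fourierCoef l f y‖ ^ 2 ≤ c ^ 2 := by gcongr
  refine h3.trans ?_
  rw [one_div, inv_mul_eq_div, le_div_iff₀ hpi]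
  linarith

theorem ae_memLp_fiber {f : ℝ × ℝ → ℝ} (hf : MemLp f 2 cyl) :
    ∀ᵐ y, MemLp (fun x => f (x, y)) 2 per := by
  have h1 := hf.1
  have h2 := hf.integrable_sq
  rw [cyl_eq_prod] at h1 h2
  have m := h1.prod_swap.prodMk_left
  filter_upwards [m, h2.prod_left_ae] with y a b
  have a' : AEStronglyMeasurable (fun x => f (x, y)) per := a
  rw [memLp_two_iff_integrable_sq a']
  exact b

/-- Bessel's inequality for one coefficient. -/
theorem integral_norm_fourierCoef_sq_le (l : ℤ) {f : ℝ × ℝ → ℝ} (hf : MemLp f 2 cyl) :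
    Integrable (fun y => ‖fourierCoef l f y‖ ^ 2) ∧
      ∫ y, ‖fourierCoef l f y‖ ^ 2 ≤ 1 / (2 * Real.pi) * normSq f := by
  have h2 := hf.integrable_sq
  have hm := aestronglyMeasurable_fourierCoef l hf.1
  have hi : Integrable fun y => 1 / (2 * Real.pi) * ∫ x, f (x, y) ^ 2 ∂per := by
    have h3 := h2
    rw [cyl_eq_prod] at h3
    exact h3.integral_prod_right.const_mul _
  have hb : ∀ᵐ y, ‖fourierCoef l f y‖ ^ 2 ≤ 1 / (2 * Real.pi) * ∫ x, f (x, y) ^ 2 ∂per := by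
    filter_upwards [ae_memLp_fiber hf] with y hy
    exact norm_fourierCoef_sq_le l hy
  have hint : Integrable (fun y => ‖fourierCoef l f y‖ ^ 2) := by
    refine hi.mono' (hm.norm.pow 2) ?_
    filter_upwards [hb] with y hy
    rw [Real.norm_of_nonneg (by positivity)]; exact hy
  refine ⟨hint, ?_⟩
  rw [normSq, integral_cyl h2, ← integral_const_mul]
  exact integral_mono_ae hint hi hb

theorem memLp_fourierCoef (l : ℤ) {f : ℝ × ℝ → ℝ} (hf : MemLp f 2 cyl) :
    MemLp (fourierCoef l f) 2 := by
  rw [memLp_two_iff_integrable_sq_norm (aestronglyMeasurable_fourierCoef l hf.1)]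
  exact (integral_norm_fourierCoef_sq_le l hf).1

theorem fourierCoef_mulY (l : ℤ) (f : ℝ × ℝ → ℝ) (y : ℝ) :
    fourierCoef l (mulY f) y = y * fourierCoef l f y := by
  have e : ∫ x, (mulY f (x, y) : ℂ) * Complex.exp (-(Complex.I * l * x)) ∂per =
      y * ∫ x, (f (x, y) : ℂ) * Complex.exp (-(Complex.I * l * x)) ∂per := by
    rw [← integral_const_mul]
    congr 1; funext x
    simp only [mulY]; push_cast; ring
  rw [fourierCoef_eq, fourierCoef_eq, e, mul_left_comm]

theorem fourierCoef_sub (l : ℤ) {f g : ℝ × ℝ → ℝ} (hf : MemLp f 2 cyl) (hg : MemLp g 2 cyl) :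
    fourierCoef l (fun p => f p - g p) =ᵐ[volume]
      fun y => fourierCoef l f y - fourierCoef l g y := by
  have key : ∀ {f : ℝ × ℝ → ℝ} {y : ℝ}, MemLp (fun x => f (x, y)) 2 per →
      Integrable (fun x => (f (x, y) : ℂ) * Complex.exp (-(Complex.I * l * x))) per := by
    intro f y h
    refine ((h.integrable (by norm_num)).ofReal (𝕜 := ℂ)).mul_bdd (c := 1)
      (by fun_prop : Continuous fun x : ℝ =>
        Complex.exp (-(Complex.I * l * x))).aestronglyMeasurable (Eventually.of_forall fun x => ?_)
    rw [norm_character]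
  filter_upwards [ae_memLp_fiber hf, ae_memLp_fiber hg] with y h1 h2
  simp only [fourierCoef_eq]
  rw [← mul_sub, ← integral_sub (key h1) (key h2)]
  congr 2; funext x
  push_cast; ring

/-- Testing against `cos (k x) η(y)` and `sin (k x) η(y)` is testing the Fourier coefficient against
`η`. -/
theorem integral_cyl_mul_trig (k : ℕ) {f : ℝ × ℝ → ℝ} {η : ℝ → ℝ}
    (hi : Integrable (fun p => f p * η p.2) cyl) :
    Integrable (fun p : ℝ × ℝ => f p * (Real.cos (k * p.1) * η p.2)) cyl ∧
    Integrable (fun p : ℝ × ℝ => f p * (Real.sin (k * p.1) * η p.2)) cyl ∧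
    ∫ p, f p * (Real.cos (k * p.1) * η p.2) ∂cyl =
      2 * Real.pi * ∫ y, η y * (fourierCoef k f y).re ∧
    ∫ p, f p * (Real.sin (k * p.1) * η p.2) ∂cyl =
      -(2 * Real.pi) * ∫ y, η y * (fourierCoef k f y).im := by
  let G : ℝ × ℝ → ℂ := fun p => ((f p * η p.2 : ℝ) : ℂ) *
    Complex.exp (-(Complex.I * (k : ℤ) * p.1))
  have hG : Integrable G cyl := by
    refine (hi.ofReal (𝕜 := ℂ)).mul_bdd (c := 1)
      (by fun_prop : Continuous fun p : ℝ × ℝ =>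
        Complex.exp (-(Complex.I * (k : ℤ) * p.1))).aestronglyMeasurable
      (Eventually.of_forall fun p => ?_)
    rw [norm_character]
  have hexp : ∀ x : ℝ, Complex.exp (-(Complex.I * (k : ℤ) * x)) =
      ⟨Real.cos (k * x), -Real.sin (k * x)⟩ := by
    intro x
    have : -(Complex.I * (k : ℤ) * x) = ((-(k * x) : ℝ) : ℂ) * Complex.I := by push_cast; ring
    rw [this, Complex.exp_mul_I, ← Complex.ofReal_cos, ← Complex.ofReal_sin, Real.cos_neg,
      Real.sin_neg]
    apply Complex.ext <;> simp [-Complex.ofReal_cos, -Complex.ofReal_sin, -Complex.ofReal_mul]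
  have hre : ∀ p, (G p).re = f p * (Real.cos (k * p.1) * η p.2) := by
    intro p; simp only [G]; rw [Complex.re_ofReal_mul, hexp]; ring
  have him : ∀ p, (G p).im = -(f p * (Real.sin (k * p.1) * η p.2)) := by
    intro p; simp only [G]; rw [Complex.im_ofReal_mul, hexp]; ring
  have hfib : ∀ y, ∫ x, G (x, y) ∂per =
      ((2 * Real.pi : ℝ) : ℂ) * ((η y : ℂ) * fourierCoef k f y) := by
    intro y
    have hpi : (Real.pi : ℂ) ≠ 0 := by exact_mod_cast Real.pi_ne_zero
    rw [fourierCoef_eq]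
    have : ∫ x, G (x, y) ∂per = (η y : ℂ) *
        ∫ x, (f (x, y) : ℂ) * Complex.exp (-(Complex.I * (k : ℤ) * x)) ∂per := by
      rw [← integral_const_mul]
      congr 1; funext x; simp only [G]; push_cast; ring
    rw [this]; push_cast; field_simp
  have hIy : Integrable fun y => (η y : ℂ) * fourierCoef k f y := by
    have h3 := hG
    rw [cyl_eq_prod] at h3
    have h4 := h3.integral_prod_right
    simp only [hfib] at h4
    have := h4.const_mul (((2 * Real.pi : ℝ) : ℂ)⁻¹)
    refine this.congr (Eventually.of_forall fun y => ?_)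
    simp only
    rw [← mul_assoc, inv_mul_cancel₀, one_mul]
    exact_mod_cast two_pi_pos.ne'
  have total : ∫ p, G p ∂cyl = ((2 * Real.pi : ℝ) : ℂ) * ∫ y, (η y : ℂ) * fourierCoef k f y := by
    rw [integral_cyl hG]
    simp only [hfib]
    rw [integral_const_mul]
  have ire := hG.re
  have iim := hG.im
  simp only [RCLike.re_to_complex, RCLike.im_to_complex, hre, him] at ire iim
  refine ⟨ire, by simpa using iim.neg, ?_, ?_⟩
  · have h1 : (∫ p, G p ∂cyl).re = ∫ p, (G p).re ∂cyl := (integral_re hG).symm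
    have h2 : (∫ y, (η y : ℂ) * fourierCoef k f y).re = ∫ y, ((η y : ℂ) * fourierCoef k f y).re :=
      (integral_re hIy).symm
    rw [total, Complex.re_ofReal_mul, h2] at h1
    simp only [hre, Complex.re_ofReal_mul] at h1
    exact h1.symm
  · have h1 : (∫ p, G p ∂cyl).im = ∫ p, (G p).im ∂cyl := (integral_im hG).symm
    have h2 : (∫ y, (η y : ℂ) * fourierCoef k f y).im = ∫ y, ((η y : ℂ) * fourierCoef k f y).im :=
      (integral_im hIy).symm
    rw [total, Complex.im_ofReal_mul, h2] at h1
    simp only [him, Complex.im_ofReal_mul] at h1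
    rw [integral_neg] at h1
    linarith

/-! ### Single-frequency functions -/

/-- The real function `2 Re (c(y) e^{ikx})` on the cylinder. -/
noncomputable def wave (k : ℕ) (c : ℝ → ℂ) (p : ℝ × ℝ) : ℝ :=
  2 * ((c p.2).re * Real.cos (k * p.1) - (c p.2).im * Real.sin (k * p.1))

theorem exp_I_mul (k : ℕ) (x : ℝ) :
    Complex.exp (Complex.I * (k : ℤ) * x) = ⟨Real.cos (k * x), Real.sin (k * x)⟩ := by
  have : Complex.I * (k : ℤ) * x = ((k * x : ℝ) : ℂ) * Complex.I := by push_cast; ring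
  rw [this, Complex.exp_mul_I, ← Complex.ofReal_cos, ← Complex.ofReal_sin]
  apply Complex.ext <;> simp [-Complex.ofReal_cos, -Complex.ofReal_sin, -Complex.ofReal_mul]

theorem fourierCoef_neg (l : ℤ) (f : ℝ × ℝ → ℝ) (y : ℝ) :
    fourierCoef (-l) f y = (starRingEnd ℂ) (fourierCoef l f y) := by
  rw [fourierCoef_eq, fourierCoef_eq, map_mul, ← integral_conj]
  congr 1
  · simp [Complex.conj_ofNat]
  · congr 1; funext x
    rw [map_mul, Complex.conj_ofReal, ← Complex.exp_conj]
    simp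

/-- For real `f` the coefficients at `k` and `-k` are conjugate. -/
theorem band_eq_wave {k : ℕ} (hk : 1 ≤ k) (f : ℝ × ℝ → ℝ) :
    band k f = wave k (fourierCoef k f) := by
  funext p
  have hne : (k : ℤ) ≠ -(k : ℤ) := by omega
  rw [band, Finset.sum_pair hne, fourierCoef_neg]
  have e : Complex.exp (Complex.I * ((-(k : ℤ) : ℤ) : ℂ) * p.1) =
      (starRingEnd ℂ) (Complex.exp (Complex.I * (k : ℤ) * p.1)) := by
    rw [← Complex.exp_conj]; simp
  rw [e, exp_I_mul]
  simp [wave, -Complex.ofReal_cos, -Complex.ofReal_sin]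
  ring

theorem mulY_wave (k : ℕ) (c : ℝ → ℂ) : mulY (wave k c) = wave k fun y => (y : ℂ) * c y := by
  funext p
  simp [mulY, wave]; ring

theorem integral_per_cos {k : ℕ} (hk : 1 ≤ k) : ∫ x, Real.cos (2 * (k * x)) ∂per = 0 := by
  have hk0 : (2 * k : ℝ) ≠ 0 := by positivity
  rw [per, ← intervalIntegral.integral_of_le two_pi_pos.le]
  have : ∀ x : ℝ, Real.cos (2 * (k * x)) = Real.cos ((2 * k) * x) := fun x => by ring_nf
  simp only [this]
  rw [intervalIntegral.integral_comp_mul_left (fun x => Real.cos x) hk0, integral_cos]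
  have : 2 * (k : ℝ) * (2 * Real.pi) = ((4 * k : ℕ) : ℝ) * Real.pi := by push_cast; ring
  rw [this, Real.sin_nat_mul_pi]
  simp

theorem integral_per_sin {k : ℕ} (hk : 1 ≤ k) : ∫ x, Real.sin (2 * (k * x)) ∂per = 0 := by
  have hk0 : (2 * k : ℝ) ≠ 0 := by positivity
  rw [per, ← intervalIntegral.integral_of_le two_pi_pos.le]
  have : ∀ x : ℝ, Real.sin (2 * (k * x)) = Real.sin ((2 * k) * x) := fun x => by ring_nf
  simp only [this]
  rw [intervalIntegral.integral_comp_mul_left (fun x => Real.sin x) hk0, integral_sin]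
  have : 2 * (k : ℝ) * (2 * Real.pi) = ((2 * k : ℕ) : ℝ) * (2 * Real.pi) := by push_cast; ring
  rw [this, Real.cos_nat_mul_two_pi]
  simp

theorem integrable_per {f : ℝ → ℝ} (hf : Continuous f) : Integrable f per :=
  (hf.integrableOn_Icc (a := 0) (b := 2 * Real.pi)).mono_set Set.Ioc_subset_Icc_self

theorem integral_per_wave_sq {k : ℕ} (hk : 1 ≤ k) (c : ℝ → ℂ) (y : ℝ) :
    ∫ x, wave k c (x, y) ^ 2 ∂per = 4 * Real.pi * dot (c y) (c y) := by
  have e : ∀ x, wave k c (x, y) ^ 2 = 2 * dot (c y) (c y) +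
      2 * ((c y).re ^ 2 - (c y).im ^ 2) * Real.cos (2 * (k * x)) -
        4 * ((c y).re * (c y).im) * Real.sin (2 * (k * x)) := by
    intro x
    rw [Real.cos_two_mul, Real.sin_two_mul]
    simp only [wave, dot]
    linear_combination (4 * (c y).im ^ 2) * Real.sin_sq_add_cos_sq (k * x)
  simp only [e]
  have i1 : Integrable (fun x => Real.cos (2 * (k * x))) per := integrable_per (by fun_prop)
  have i2 : Integrable (fun x => Real.sin (2 * (k * x))) per := integrable_per (by fun_prop)
  have i3 : Integrable (fun x : ℝ => 2 * dot (c y) (c y) +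
      2 * ((c y).re ^ 2 - (c y).im ^ 2) * Real.cos (2 * (k * x))) per :=
    (integrable_const _).add (i1.const_mul _)
  rw [integral_sub i3 (i2.const_mul _), integral_add (integrable_const _) (i1.const_mul _),
    integral_const, integral_const_mul, integral_const_mul, integral_per_cos hk,
    integral_per_sin hk, per_real_univ, smul_eq_mul]
  ring

theorem memLp_wave (k : ℕ) {c : ℝ → ℂ} (hc : MemLp c 2) : MemLp (wave k c) 2 cyl := by
  have hcm : AEStronglyMeasurable (fun p : ℝ × ℝ => c p.2) cyl := by
    rw [cyl_eq_prod]; exact hc.1.comp_snd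
  have hi : Integrable (fun p : ℝ × ℝ => ‖c p.2‖ ^ 2) cyl := by
    rw [cyl_eq_prod]
    exact (Integrable.comp_snd ((memLp_two_iff_integrable_sq_norm hc.1).1 hc) per)
  have h1 : MemLp (fun p : ℝ × ℝ => c p.2) 2 cyl := (memLp_two_iff_integrable_sq_norm hcm).2 hi
  have bd : ∀ {g f : ℝ × ℝ → ℝ}, MemLp g 2 cyl → Continuous f → (∀ p, |f p| ≤ 1) →
      MemLp (fun p => g p * f p) 2 cyl := by
    intro g f hg hf hb
    refine hg.mono (hg.1.mul hf.aestronglyMeasurable) (Eventually.of_forall fun p => ?_)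
    rw [norm_mul, Real.norm_eq_abs (f p)]
    exact mul_le_of_le_one_right (norm_nonneg _) (hb p)
  exact ((bd h1.re (f := fun p : ℝ × ℝ => Real.cos (k * p.1)) (by fun_prop)
    (fun p => Real.abs_cos_le_one _)).sub (bd h1.im (f := fun p : ℝ × ℝ => Real.sin (k * p.1))
      (by fun_prop) (fun p => Real.abs_sin_le_one _))).const_mul 2

theorem normSq_wave {k : ℕ} (hk : 1 ≤ k) {c : ℝ → ℂ} (hc : MemLp c 2) :
    normSq (wave k c) = 4 * Real.pi * ∫ y, dot (c y) (c y) := by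
  rw [normSq, integral_cyl (memLp_wave k hc).integrable_sq]
  simp only [integral_per_wave_sq hk]
  rw [integral_const_mul]

theorem fourierCoef_wave {k : ℕ} (hk : 1 ≤ k) (c : ℝ → ℂ) : fourierCoef k (wave k c) = c := by
  funext y
  have hpi : (Real.pi : ℂ) ≠ 0 := by exact_mod_cast Real.pi_ne_zero
  have j1 : Integrable (fun x => Real.cos (2 * (k * x))) per := integrable_per (by fun_prop)
  have j2 : Integrable (fun x => Real.sin (2 * (k * x))) per := integrable_per (by fun_prop)
  have i1 : Integrable (fun x => ((Real.cos (2 * (k * x)) : ℝ) : ℂ)) per := j1.ofReal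
  have i2 : Integrable (fun x => ((Real.sin (2 * (k * x)) : ℝ) : ℂ)) per := j2.ofReal
  have e : ∀ x : ℝ, (wave k c (x, y) : ℂ) * Complex.exp (-(Complex.I * (k : ℤ) * x)) =
      c y + (starRingEnd ℂ) (c y) * ((Real.cos (2 * (k * x)) : ℝ) : ℂ) -
        Complex.I * (starRingEnd ℂ) (c y) * ((Real.sin (2 * (k * x)) : ℝ) : ℂ) := by
    intro x
    rw [show Complex.exp (-(Complex.I * (k : ℤ) * x)) =
      (starRingEnd ℂ) (Complex.exp (Complex.I * (k : ℤ) * x)) by rw [← Complex.exp_conj]; simp,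
      exp_I_mul, Real.cos_two_mul, Real.sin_two_mul]
    have hs := Real.sin_sq_add_cos_sq (k * x)
    apply Complex.ext
    · simp only [wave, Complex.conj_re, Complex.conj_im, Complex.sub_re,
        Complex.add_re, Complex.mul_re, Complex.ofReal_re, Complex.ofReal_im, Complex.I_re,
        Complex.I_im, Complex.mul_im]
      ring
    · simp only [wave, Complex.conj_re, Complex.conj_im, Complex.sub_im,
        Complex.add_im, Complex.mul_re, Complex.ofReal_re, Complex.ofReal_im, Complex.I_re,
        Complex.I_im, Complex.mul_im]
      linear_combination (2 * (c y).im) * hs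
  rw [fourierCoef_eq]
  simp only [e]
  have i3 : Integrable (fun x : ℝ => c y +
      (starRingEnd ℂ) (c y) * ((Real.cos (2 * (k * x)) : ℝ) : ℂ)) per :=
    (integrable_const _).add (i1.const_mul _)
  rw [integral_sub i3 (i2.const_mul _), integral_add (integrable_const _) (i1.const_mul _),
    integral_const, integral_const_mul, integral_const_mul, integral_complex_ofReal,
    integral_complex_ofReal, integral_per_cos hk, integral_per_sin hk, per_real_univ,
    Complex.real_smul]
  push_cast; field_simp; ring

end Poiseuille

namespace Poiseuille

/-! ### Test functions on the cylinder -/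

section trig

variable (k : ℕ) {η : ℝ → ℝ}

theorem IsLineTest.isTest_mul (h : IsLineTest η) {g : ℝ → ℝ}
    (hg : ContDiff ℝ ((⊤ : ℕ∞) : WithTop ℕ∞) g) (hp : Function.Periodic g (2 * Real.pi)) :
    IsTest fun p => g p.1 * η p.2 where
  smooth := (hg.comp contDiff_fst).mul (h.smooth.comp contDiff_snd)
  periodic x y := by simp only [hp x]
  compact := by
    obtain ⟨R, -, hR⟩ := h.exists_bound
    exact ⟨R, fun x y hy => by simp only [hR y hy.le, mul_zero]⟩

theorem IsLineTest.isTest_cos (h : IsLineTest η) :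
    IsTest fun p => Real.cos (k * p.1) * η p.2 :=
  h.isTest_mul (g := fun x => Real.cos (k * x))
    (Real.contDiff_cos.comp (contDiff_const.mul contDiff_id)) fun x => by
    simp only [mul_add, Real.cos_add_nat_mul_two_pi]

theorem IsLineTest.isTest_sin (h : IsLineTest η) :
    IsTest fun p => Real.sin (k * p.1) * η p.2 :=
  h.isTest_mul (g := fun x => Real.sin (k * x))
    (Real.contDiff_sin.comp (contDiff_const.mul contDiff_id)) fun x => by
    simp only [mul_add, Real.sin_add_nat_mul_two_pi]

theorem hasDerivAt_cos_mul (x : ℝ) :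
    HasDerivAt (fun x => Real.cos (k * x)) (-k * Real.sin (k * x)) x := by
  convert! ((hasDerivAt_id x).const_mul (k : ℝ)).cos using 1
  simp only [id]; ring

theorem hasDerivAt_sin_mul (x : ℝ) :
    HasDerivAt (fun x => Real.sin (k * x)) (k * Real.cos (k * x)) x := by
  convert! ((hasDerivAt_id x).const_mul (k : ℝ)).sin using 1
  simp only [id]; ring

theorem dx_cos (η : ℝ → ℝ) : dx (fun p => Real.cos (k * p.1) * η p.2) =
    fun p => -k * Real.sin (k * p.1) * η p.2 :=
  funext fun p => ((hasDerivAt_cos_mul k p.1).mul_const (η p.2)).deriv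

theorem dx_sin (η : ℝ → ℝ) : dx (fun p => Real.sin (k * p.1) * η p.2) =
    fun p => k * Real.cos (k * p.1) * η p.2 :=
  funext fun p => ((hasDerivAt_sin_mul k p.1).mul_const (η p.2)).deriv

theorem dy_mul (g η : ℝ → ℝ) : dy (fun p => g p.1 * η p.2) = fun p => g p.1 * deriv η p.2 :=
  funext fun p => deriv_const_mul_field (v := η) (g p.1)

theorem lap_cos (η : ℝ → ℝ) : lap (fun p => Real.cos (k * p.1) * η p.2) =
    fun p => Real.cos (k * p.1) * (deriv (deriv η) p.2 - k ^ 2 * η p.2) := by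
  funext p
  rw [lap, dx_cos, dy_mul (fun x => Real.cos (k * x)), dy_mul (fun x => Real.cos (k * x))]
  have : dx (fun p => -k * Real.sin (k * p.1) * η p.2) p = -k * (k * Real.cos (k * p.1)) * η p.2 :=
    (((hasDerivAt_sin_mul k p.1).const_mul (-k : ℝ)).mul_const (η p.2)).deriv
  rw [this]; ring

theorem lap_sin (η : ℝ → ℝ) : lap (fun p => Real.sin (k * p.1) * η p.2) =
    fun p => Real.sin (k * p.1) * (deriv (deriv η) p.2 - k ^ 2 * η p.2) := by
  funext p
  rw [lap, dx_sin, dy_mul (fun x => Real.sin (k * x)), dy_mul (fun x => Real.sin (k * x))]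
  have : dx (fun p => k * Real.cos (k * p.1) * η p.2) p = k * (-k * Real.sin (k * p.1)) * η p.2 :=
    (((hasDerivAt_cos_mul k p.1).const_mul (k : ℝ)).mul_const (η p.2)).deriv
  rw [this]; ring

end trig

theorem memLp_cyl_of_continuous {f : ℝ × ℝ → ℝ} (hc : Continuous f)
    (hR : ∃ R : ℝ, ∀ x y : ℝ, R < |y| → f (x, y) = 0) : MemLp f 2 cyl := by
  obtain ⟨R, hR⟩ := hR
  rw [memLp_two_iff_integrable_sq hc.aestronglyMeasurable]
  have h1 : IntegrableOn (fun p => f p ^ 2) (Set.Icc 0 (2 * Real.pi) ×ˢ Set.Icc (-R) R) :=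
    (hc.pow 2).continuousOn.integrableOn_compact (isCompact_Icc.prod isCompact_Icc)
  refine h1.of_forall_sdiff_eq_zero (measurableSet_Ioc.prod MeasurableSet.univ) ?_
  rintro ⟨x, y⟩ ⟨⟨hx, -⟩, hn⟩
  have : R < |y| := by
    by_contra! hy
    exact hn ⟨⟨hx.1.le, hx.2⟩, abs_le.1 hy⟩
  simp only [hR x y this]; norm_num

theorem integrable_cyl_mul {f g : ℝ × ℝ → ℝ} (hf : MemLp f 2 cyl) (hg : MemLp g 2 cyl) :
    Integrable (fun p => f p * g p) cyl := hf.integrable_mul hg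

namespace IsTest

variable {φ : ℝ × ℝ → ℝ}

theorem hasDerivAt_x (h : IsTest φ) (x y : ℝ) :
    HasDerivAt (fun x => φ (x, y)) (fderiv ℝ φ (x, y) (1, 0)) x :=
  ((h.smooth.differentiable (by simp)) (x, y)).hasFDerivAt.comp_hasDerivAt x
    ((hasDerivAt_id x).prodMk (hasDerivAt_const x y))

theorem hasDerivAt_y (h : IsTest φ) (x y : ℝ) :
    HasDerivAt (fun y => φ (x, y)) (fderiv ℝ φ (x, y) (0, 1)) y :=
  ((h.smooth.differentiable (by simp)) (x, y)).hasFDerivAt.comp_hasDerivAt y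
    ((hasDerivAt_const y x).prodMk (hasDerivAt_id y))

theorem dx_eq (h : IsTest φ) : dx φ = fun p => fderiv ℝ φ p (1, 0) :=
  funext fun p => (h.hasDerivAt_x p.1 p.2).deriv

theorem dy_eq (h : IsTest φ) : dy φ = fun p => fderiv ℝ φ p (0, 1) :=
  funext fun p => (h.hasDerivAt_y p.1 p.2).deriv

theorem continuous_dx (h : IsTest φ) : Continuous (dx φ) := by
  rw [h.dx_eq]
  exact (h.smooth.continuous_fderiv (by simp)).clm_apply continuous_const

theorem continuous_dy (h : IsTest φ) : Continuous (dy φ) := by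
  rw [h.dy_eq]
  exact (h.smooth.continuous_fderiv (by simp)).clm_apply continuous_const

theorem memLp (h : IsTest φ) : MemLp φ 2 cyl :=
  memLp_cyl_of_continuous h.smooth.continuous h.compact

theorem memLp_dx (h : IsTest φ) : MemLp (dx φ) 2 cyl := by
  obtain ⟨R, hR⟩ := h.compact
  refine memLp_cyl_of_continuous h.continuous_dx ⟨R, fun x y hy => ?_⟩
  simp [dx, hR _ y hy]

theorem memLp_dy (h : IsTest φ) : MemLp (dy φ) 2 cyl := by
  obtain ⟨R, hR⟩ := h.compact
  refine memLp_cyl_of_continuous h.continuous_dy ⟨R, fun x y hy => ?_⟩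
  have : (fun y => φ (x, y)) =ᶠ[𝓝 y] fun _ => 0 := by
    filter_upwards [(isOpen_lt continuous_const continuous_abs).mem_nhds hy] with z hz
    exact hR x z hz
  simp only [dy]
  rw [this.deriv_eq]; simp

theorem isLineTest (h : IsTest φ) (x : ℝ) : IsLineTest fun y => φ (x, y) := by
  refine ⟨h.smooth.comp (contDiff_const.prodMk contDiff_id), ?_⟩
  obtain ⟨R, hR⟩ := h.compact
  refine HasCompactSupport.intro (isCompact_Icc (a := -R) (b := R)) fun y hy => hR x y ?_
  by_contra! hn
  exact hy (abs_le.1 hn)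

end IsTest

/-! ### Uniqueness of weak derivatives on the cylinder -/

theorem fourierCoeffOn_eq (f : ℝ × ℝ → ℝ) (l : ℤ) (y : ℝ) :
    fourierCoeffOn two_pi_pos (fun x => (f (x, y) : ℂ)) l = fourierCoef l f y := by
  rw [fourierCoeffOn_eq_integral, fourierCoef, Complex.real_smul]
  congr 1
  · push_cast; simp
  · congr 1; funext x
    have hpi : (Real.pi : ℂ) ≠ 0 := by exact_mod_cast Real.pi_ne_zero
    rw [fourier_coe_apply, smul_eq_mul, mul_comm]
    congr 2
    push_cast; field_simp; ring

/-- Square integrable functions are determined by their pairing with test functions: all Fourier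
coefficients are, and Parseval's identity applies in almost every fiber. -/
theorem ae_eq_of_forall_test {g g' : ℝ × ℝ → ℝ} (hg : MemLp g 2 cyl) (hg' : MemLp g' 2 cyl)
    (h : ∀ φ, IsTest φ → ∫ p, g p * φ p ∂cyl = ∫ p, g' p * φ p ∂cyl) : g =ᵐ[cyl] g' := by
  set f : ℝ × ℝ → ℝ := fun p => g p - g' p with hf
  have hfm : MemLp f 2 cyl := hg.sub hg'
  have hz : ∀ φ, IsTest φ → ∫ p, f p * φ p ∂cyl = 0 := by
    intro φ hφ
    simp only [hf, sub_mul]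
    rw [integral_sub (integrable_cyl_mul hg hφ.memLp) (integrable_cyl_mul hg' hφ.memLp), h φ hφ,
      sub_self]
  have hcoef : ∀ k : ℕ, ∀ᵐ y, fourierCoef k f y = 0 := by
    intro k
    have hm := locallyIntegrable_of_memLp (memLp_fourierCoef k hfm)
    have key : ∀ η, IsLineTest η → (∫ y, η y * (fourierCoef k f y).re = 0) ∧
        ∫ y, η y * (fourierCoef k f y).im = 0 := by
      intro η hη
      have hi : Integrable (fun p => f p * η p.2) cyl := by
        have := (hη.isTest_mul (g := fun _ => 1) contDiff_const (fun _ => rfl)).memLp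
        simp only [one_mul] at this
        exact integrable_cyl_mul hfm this
      obtain ⟨-, -, e1, e2⟩ := integral_cyl_mul_trig k hi
      rw [hz _ (hη.isTest_cos k)] at e1
      rw [hz _ (hη.isTest_sin k)] at e2
      have := two_pi_pos.ne'
      constructor
      · rcases mul_eq_zero.1 e1.symm with h0 | h0
        · exact absurd h0 this
        · exact h0
      · rcases mul_eq_zero.1 e2.symm with h0 | h0
        · exact absurd (neg_eq_zero.1 h0) this
        · exact h0
    have z1 := ae_eq_zero_of_integral_contDiff_smul_eq_zero
      (f := fun y => (fourierCoef k f y).re) (fun x => (hm x).imp fun _ h => ⟨h.1, h.2.re⟩)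
      fun η a b => by simpa using (key η ⟨a, b⟩).1
    have z2 := ae_eq_zero_of_integral_contDiff_smul_eq_zero
      (f := fun y => (fourierCoef k f y).im) (fun x => (hm x).imp fun _ h => ⟨h.1, h.2.im⟩)
      fun η a b => by simpa using (key η ⟨a, b⟩).2
    filter_upwards [z1, z2] with y h1 h2
    exact Complex.ext h1 h2
  have hfib : ∀ᵐ y, ∫ x, f (x, y) ^ 2 ∂per = 0 := by
    filter_upwards [ae_memLp_fiber hfm, ae_all_iff.2 hcoef] with y hy hc
    have hall : ∀ l : ℤ, fourierCoef l f y = 0 := by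
      intro l
      rcases Int.eq_nat_or_neg l with ⟨n, rfl | rfl⟩
      · exact hc n
      · rw [fourierCoef_neg, hc n, map_zero]
    have hp := (hasSum_sq_fourierCoeffOn two_pi_pos
      (f := fun x => (f (x, y) : ℂ)) hy.ofReal).unique (a₂ := 0) (by
        simp only [fourierCoeffOn_eq, hall, norm_zero, zero_pow two_ne_zero]
        exact hasSum_zero)
    rw [intervalIntegral.integral_of_le two_pi_pos.le, smul_eq_mul] at hp
    rcases mul_eq_zero.1 hp with h0 | h0
    · exact absurd h0 (inv_ne_zero (by simp [Real.pi_ne_zero]))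
    · simpa [per] using h0
  have hn : ∫ p, f p ^ 2 ∂cyl = 0 := by
    rw [integral_cyl hfm.integrable_sq, integral_congr_ae hfib, integral_zero]
  rw [integral_eq_zero_iff_of_nonneg (fun p => sq_nonneg _) hfm.integrable_sq] at hn
  filter_upwards [hn] with p hp
  have : f p = 0 := by simpa using hp
  simpa [hf, sub_eq_zero] using this

theorem normSq_congr {g g' : ℝ × ℝ → ℝ} (h : g =ᵐ[cyl] g') : normSq g = normSq g' :=
  integral_congr_ae (h.mono fun p hp => by simp only [hp])

theorem normSq_weakDx {f g : ℝ × ℝ → ℝ} (h : IsWeakDx f g) : normSq (weakDx f) = normSq g := by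
  have he : ∃ g, IsWeakDx f g := ⟨g, h⟩
  have hw : IsWeakDx f (weakDx f) := by
    rw [weakDx, dif_pos he]; exact he.choose_spec
  exact normSq_congr (ae_eq_of_forall_test hw.1 h.1 fun φ hφ => by
    linarith [hw.2 φ hφ, h.2 φ hφ])

theorem normSq_weakDy {f g : ℝ × ℝ → ℝ} (h : IsWeakDy f g) : normSq (weakDy f) = normSq g := by
  have he : ∃ g, IsWeakDy f g := ⟨g, h⟩
  have hw : IsWeakDy f (weakDy f) := by
    rw [weakDy, dif_pos he]; exact he.choose_spec
  exact normSq_congr (ae_eq_of_forall_test hw.1 h.1 fun φ hφ => by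
    linarith [hw.2 φ hφ, h.2 φ hφ])

/-! ### The gradient of a single-frequency function -/

theorem hasDerivAt_wave (k : ℕ) (c : ℝ → ℂ) (x y : ℝ) :
    HasDerivAt (fun x => wave k c (x, y)) (wave k (fun y => Complex.I * (k * c y)) (x, y)) x := by
  convert! (((hasDerivAt_cos_mul k x).const_mul (c y).re).sub
    ((hasDerivAt_sin_mul k x).const_mul (c y).im)).const_mul 2 using 1
  simp [wave]; ring

theorem isWeakDx_wave (k : ℕ) {c : ℝ → ℂ} (hc : MemLp c 2) :
    IsWeakDx (wave k c) (wave k fun y => Complex.I * (k * c y)) := by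
  have hc' : MemLp (fun y => Complex.I * (k * c y)) 2 := (hc.const_mul (k : ℂ)).const_mul Complex.I
  refine ⟨memLp_wave k hc', fun φ hφ => ?_⟩
  rw [integral_cyl (integrable_cyl_mul (memLp_wave k hc) hφ.memLp_dx),
    integral_cyl (integrable_cyl_mul (memLp_wave k hc') hφ.memLp), ← integral_neg]
  congr 1; funext y
  have cont : ∀ c : ℝ → ℂ, Continuous fun x => wave k c (x, y) := fun c =>
    continuous_iff_continuousAt.2 fun x => (hasDerivAt_wave k c x y).continuousAt
  have cφ : Continuous fun x => φ (x, y) := hφ.smooth.continuous.comp (by fun_prop)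
  have cd : Continuous fun x => dx φ (x, y) := hφ.continuous_dx.comp (by fun_prop)
  have i1 : Continuous fun x => wave k (fun y => Complex.I * (k * c y)) (x, y) * φ (x, y) :=
    (cont _).mul cφ
  have i2 : Continuous fun x => wave k c (x, y) * dx φ (x, y) := (cont _).mul cd
  have hd : ∀ x, HasDerivAt (fun x => wave k c (x, y) * φ (x, y))
      (wave k (fun y => Complex.I * (k * c y)) (x, y) * φ (x, y) +
        wave k c (x, y) * dx φ (x, y)) x := by
    intro x
    have := (hasDerivAt_wave k c x y).mul (hφ.hasDerivAt_x x y)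
    rw [hφ.dx_eq]; exact this
  have ftc := intervalIntegral.integral_eq_sub_of_hasDerivAt (a := 0) (b := 2 * Real.pi)
    (fun x _ => hd x) ((i1.add i2).intervalIntegrable _ _)
  have hper : wave k c (2 * Real.pi, y) * φ (2 * Real.pi, y) = wave k c (0, y) * φ (0, y) := by
    have h1 : φ (2 * Real.pi, y) = φ (0, y) := by simpa using hφ.periodic 0 y
    have h2 : Real.cos (k * (2 * Real.pi)) = 1 := Real.cos_nat_mul_two_pi k
    have h3 : Real.sin (k * (2 * Real.pi)) = 0 := by
      have := Real.sin_nat_mul_pi (2 * k)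
      push_cast at this
      rw [← this]; congr 1; ring
    simp [wave, h1, h2, h3]
  rw [intervalIntegral.integral_add (i1.intervalIntegrable _ _) (i2.intervalIntegrable _ _), hper,
    sub_self, intervalIntegral.integral_of_le two_pi_pos.le,
    intervalIntegral.integral_of_le two_pi_pos.le] at ftc
  exact eq_neg_of_add_eq_zero_right ftc

theorem isWeakDy_wave (k : ℕ) {c c1 : ℝ → ℂ} (h : WDc c c1) (hc : MemLp c 2) (hc1 : MemLp c1 2) :
    IsWeakDy (wave k c) (wave k c1) := by
  refine ⟨memLp_wave k hc1, fun φ hφ => ?_⟩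
  rw [integral_cyl' (integrable_cyl_mul (memLp_wave k hc) hφ.memLp_dy),
    integral_cyl' (integrable_cyl_mul (memLp_wave k hc1) hφ.memLp), ← integral_neg]
  congr 1; funext x
  have w : WD (fun y => wave k c (x, y)) (fun y => wave k c1 (x, y)) := by
    convert! ((h.re.const_mul (Real.cos (k * x))).add
      (h.im.const_mul (-Real.sin (k * x)))).const_mul 2 using 1
    · funext y; simp only [wave]; ring
    · funext y; simp only [wave]; ring
  have := w.eq _ (hφ.isLineTest x)
  simp only [mul_comm (wave k _ _)]
  exact this

theorem gradNormSq_wave {k : ℕ} (hk : 1 ≤ k) {c c1 : ℝ → ℂ} (h : WDc c c1) (hc : MemLp c 2)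
    (hc1 : MemLp c1 2) : gradNormSq (wave k c) =
      4 * Real.pi * (k ^ 2 * (∫ y, dot (c y) (c y)) + ∫ y, dot (c1 y) (c1 y)) := by
  have hc' : MemLp (fun y => Complex.I * (k * c y)) 2 := (hc.const_mul (k : ℂ)).const_mul Complex.I
  rw [gradNormSq, normSq_weakDx (isWeakDx_wave k hc), normSq_weakDy (isWeakDy_wave k h hc hc1),
    normSq_wave hk hc', normSq_wave hk hc1, ← integral_const_mul (((k : ℝ)) ^ 2), mul_add]
  congr 3; funext y
  simp [dot]; ring

end Poiseuille

namespace Poiseuille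

/-! ### Passage to one mode -/

/-- Integrability against all test functions of `y`. -/
def IsTestable (f : ℝ × ℝ → ℝ) : Prop :=
  ∀ η, IsLineTest η → Integrable (fun p => f p * η p.2) cyl

theorem isTestable_of_memLp {f : ℝ × ℝ → ℝ} (hf : MemLp f 2 cyl) : IsTestable f := by
  intro η hη
  have := (hη.isTest_mul (g := fun _ => 1) contDiff_const (fun _ => rfl)).memLp
  simp only [one_mul] at this
  exact integrable_cyl_mul hf this

theorem isTestable_of_integrableOn {f : ℝ × ℝ → ℝ}
    (hf : ∀ R : ℝ, IntegrableOn f (Set.Ioc (0 : ℝ) (2 * Real.pi) ×ˢ Set.Icc (-R) R)) :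
    IsTestable f := by
  intro η hη
  obtain ⟨R, -, hR⟩ := hη.exists_bound
  obtain ⟨C, hC⟩ := hη.compact.exists_bound_of_continuous hη.continuous
  have h1 : IntegrableOn (fun p => f p * η p.2) (Set.Ioc (0 : ℝ) (2 * Real.pi) ×ˢ Set.Icc (-R) R) :=
    Integrable.mul_bdd (c := C) (hf R)
      (hη.continuous.comp continuous_snd).aestronglyMeasurable
      (Eventually.of_forall fun p => hC p.2)
  refine h1.of_forall_sdiff_eq_zero (measurableSet_Ioc.prod MeasurableSet.univ) ?_
  rintro ⟨x, y⟩ ⟨⟨hx, -⟩, hn⟩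
  have : R ≤ |y| := by
    by_contra! hy
    exact hn ⟨hx, abs_le.1 hy.le⟩
  simp only [hR y this, mul_zero]

section reduction

variable {k : ℕ} {f g : ℝ × ℝ → ℝ} {U B : L2C}

theorem integral_test_cos (hf : IsTestable f) (hU : U =ᵐ[volume] fourierCoef k f) {η : ℝ → ℝ}
    (hη : IsLineTest η) : ∫ p, f p * (Real.cos (k * p.1) * η p.2) ∂cyl =
      2 * Real.pi * ∫ y, η y * (U y).re := by
  rw [(integral_cyl_mul_trig k (hf η hη)).2.2.1]
  congr 1
  exact integral_congr_ae (hU.mono fun y hy => by simp only [hy])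

theorem integral_test_sin (hf : IsTestable f) (hU : U =ᵐ[volume] fourierCoef k f) {η : ℝ → ℝ}
    (hη : IsLineTest η) : ∫ p, f p * (Real.sin (k * p.1) * η p.2) ∂cyl =
      -(2 * Real.pi) * ∫ y, η y * (U y).im := by
  rw [(integral_cyl_mul_trig k (hf η hη)).2.2.2]
  congr 1
  exact integral_congr_ae (hU.mono fun y hy => by simp only [hy])

/-- The right-hand side of the vorticity equation tested against `cos (k x) η(y)`. -/
theorem integral_vort_cos (ν : ℝ) (hf : IsTestable f) (hg : IsTestable g)
    (hU : U =ᵐ[volume] fourierCoef k f) (hB : B =ᵐ[volume] fourierCoef k g) {η : ℝ → ℝ}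
    (hη : IsLineTest η) :
    ∫ p, (f p * (p.2 ^ 2 * dx (fun p => Real.cos (k * p.1) * η p.2) p +
      ν * lap (fun p => Real.cos (k * p.1) * η p.2) p) -
        2 * (g p * dx (fun p => Real.cos (k * p.1) * η p.2) p)) ∂cyl =
      2 * Real.pi * evoRe ν k η U B := by
  have i1 := (integral_cyl_mul_trig k (hf _ (hη.visc ν k))).1
  have i2 := (integral_cyl_mul_trig k (hf _ (hη.pow_mul 2))).2.1
  have i3 := (integral_cyl_mul_trig k (hg _ hη)).2.1
  have e : ∀ p : ℝ × ℝ, f p * (p.2 ^ 2 * dx (fun p => Real.cos (k * p.1) * η p.2) p +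
      ν * lap (fun p => Real.cos (k * p.1) * η p.2) p) -
        2 * (g p * dx (fun p => Real.cos (k * p.1) * η p.2) p) =
      f p * (Real.cos (k * p.1) * (ν * (deriv (deriv η) p.2 - k ^ 2 * η p.2))) -
        k * (f p * (Real.sin (k * p.1) * (p.2 ^ 2 * η p.2))) +
        2 * k * (g p * (Real.sin (k * p.1) * η p.2)) := by
    intro p
    rw [dx_cos, lap_cos]; ring
  simp only [e]
  have i4 : Integrable (fun p : ℝ × ℝ =>
      f p * (Real.cos (k * p.1) * (ν * (deriv (deriv η) p.2 - k ^ 2 * η p.2))) -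
        k * (f p * (Real.sin (k * p.1) * (p.2 ^ 2 * η p.2)))) cyl := i1.sub (i2.const_mul _)
  rw [integral_add i4 (i3.const_mul _),
    integral_sub i1 (i2.const_mul _), integral_const_mul, integral_const_mul,
    integral_test_cos hf hU (hη.visc ν k), integral_test_sin hf hU (hη.pow_mul 2),
    integral_test_sin hg hB hη, evoRe]
  ring

/-- The right-hand side of the vorticity equation tested against `sin (k x) η(y)`. -/
theorem integral_vort_sin (ν : ℝ) (hf : IsTestable f) (hg : IsTestable g)
    (hU : U =ᵐ[volume] fourierCoef k f) (hB : B =ᵐ[volume] fourierCoef k g) {η : ℝ → ℝ}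
    (hη : IsLineTest η) :
    ∫ p, (f p * (p.2 ^ 2 * dx (fun p => Real.sin (k * p.1) * η p.2) p +
      ν * lap (fun p => Real.sin (k * p.1) * η p.2) p) -
        2 * (g p * dx (fun p => Real.sin (k * p.1) * η p.2) p)) ∂cyl =
      -(2 * Real.pi) * evoIm ν k η U B := by
  have i1 := (integral_cyl_mul_trig k (hf _ (hη.visc ν k))).2.1
  have i2 := (integral_cyl_mul_trig k (hf _ (hη.pow_mul 2))).1
  have i3 := (integral_cyl_mul_trig k (hg _ hη)).1
  have e : ∀ p : ℝ × ℝ, f p * (p.2 ^ 2 * dx (fun p => Real.sin (k * p.1) * η p.2) p +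
      ν * lap (fun p => Real.sin (k * p.1) * η p.2) p) -
        2 * (g p * dx (fun p => Real.sin (k * p.1) * η p.2) p) =
      f p * (Real.sin (k * p.1) * (ν * (deriv (deriv η) p.2 - k ^ 2 * η p.2))) +
        k * (f p * (Real.cos (k * p.1) * (p.2 ^ 2 * η p.2))) -
        2 * k * (g p * (Real.cos (k * p.1) * η p.2)) := by
    intro p
    rw [dx_sin, lap_sin]; ring
  simp only [e]
  have i4 : Integrable (fun p : ℝ × ℝ =>
      f p * (Real.sin (k * p.1) * (ν * (deriv (deriv η) p.2 - k ^ 2 * η p.2))) +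
        k * (f p * (Real.cos (k * p.1) * (p.2 ^ 2 * η p.2)))) cyl := i1.add (i2.const_mul _)
  rw [integral_sub i4 (i3.const_mul _),
    integral_add i1 (i2.const_mul _), integral_const_mul, integral_const_mul,
    integral_test_sin hf hU (hη.visc ν k), integral_test_cos hf hU (hη.pow_mul 2),
    integral_test_cos hg hB hη, evoIm]
  ring

/-- The Fourier coefficient of the stream function solves `B'' - k² B = U`. -/
theorem exists_isStream (hf : IsTestable f) (hg : IsTestable g)
    (hU : U =ᵐ[volume] fourierCoef k f) (hB : B =ᵐ[volume] fourierCoef k g)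
    (h : ∀ φ, IsTest φ → ∫ p, g p * lap φ p ∂cyl = ∫ p, f p * φ p ∂cyl) :
    ∃ B1 : L2C, IsStream k U B B1 := by
  have hpi := two_pi_pos.ne'
  have visc : ∀ {η}, IsLineTest η → IsLineTest fun y => deriv (deriv η) y - (k : ℝ) ^ 2 * η y :=
    fun hη => by simpa using hη.visc 1 k
  have hG : ((k : ℝ) ^ 2 • B + U : L2C) =ᵐ[volume] fun y => ((k ^ 2 : ℝ) : ℂ) * B y + U y := by
    filter_upwards [Lp.coeFn_add ((k : ℝ) ^ 2 • B) U, Lp.coeFn_smul ((k : ℝ) ^ 2) B] with y h1 h2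
    rw [h1, Pi.add_apply, h2, Pi.smul_apply, Complex.real_smul]
  have split : ∀ {u v : ℝ → ℝ} {η : ℝ → ℝ}, LocallyIntegrable u → LocallyIntegrable v →
      IsLineTest η → ∫ y, (deriv (deriv η) y - (k : ℝ) ^ 2 * η y) * u y = ∫ y, η y * v y →
      ∫ y, deriv (deriv η) y * u y = ∫ y, η y * (k ^ 2 * u y + v y) := by
    intro u v η hu hv hη e
    have i1 := hη.deriv.deriv.integrable_mul hu
    have i2 := hη.integrable_mul hu
    have i3 := hη.integrable_mul hv
    simp only [sub_mul, mul_assoc] at e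
    rw [integral_sub i1 (i2.const_mul _), integral_const_mul] at e
    simp only [mul_add, mul_left_comm _ ((k : ℝ) ^ 2)]
    rw [integral_add (i2.const_mul _) i3, integral_const_mul]
    linarith
  obtain ⟨b1, w1, w2, m, -⟩ := exists_memLp_WDc (f := B) (G := ((k : ℝ) ^ 2 • B + U : L2C))
    (Lp.memLp B) (locallyIntegrable_L2C _) (fun η hη => by
      have e := h _ (hη.isTest_cos k)
      rw [lap_cos, integral_test_cos hg hB (visc hη), integral_test_cos hf hU hη] at e
      have := split (locallyIntegrable_L2C_re B) (locallyIntegrable_L2C_re U) hη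
        (mul_left_cancel₀ hpi e)
      rw [this]
      refine integral_congr_ae (hG.mono fun y hy => ?_)
      simp only [hy, Complex.add_re, Complex.re_ofReal_mul]) (fun η hη => by
      have e := h _ (hη.isTest_sin k)
      rw [lap_sin, integral_test_sin hg hB (visc hη), integral_test_sin hf hU hη] at e
      have := split (locallyIntegrable_L2C_im B) (locallyIntegrable_L2C_im U) hη
        (mul_left_cancel₀ (neg_ne_zero.2 hpi) e)
      rw [this]
      refine integral_congr_ae (hG.mono fun y hy => ?_)
      simp only [hy, Complex.add_im, Complex.im_ofReal_mul]) (integrable_dot' _ _)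
  exact ⟨m.toLp b1, w1.congr (ae_eq_refl _) m.coeFn_toLp.symm,
    w2.congr m.coeFn_toLp.symm (ae_eq_refl _)⟩

end reduction

/-- Bessel's inequality for differences. -/
theorem norm_toLp_fourierCoef_sub_sq_le (l : ℤ) {f g : ℝ × ℝ → ℝ} (hf : MemLp f 2 cyl)
    (hg : MemLp g 2 cyl) :
    ‖(memLp_fourierCoef l hf).toLp - (memLp_fourierCoef l hg).toLp‖ ^ 2 ≤
      1 / (2 * Real.pi) * normSq fun p => f p - g p := by
  have hd : MemLp (fun p => f p - g p) 2 cyl := hf.sub hg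
  refine le_trans (le_of_eq ?_) (integral_norm_fourierCoef_sq_le l hd).2
  have e : ((memLp_fourierCoef l hf).toLp - (memLp_fourierCoef l hg).toLp : L2C) =ᵐ[volume]
      fourierCoef l fun p => f p - g p := by
    filter_upwards [Lp.coeFn_sub (memLp_fourierCoef l hf).toLp (memLp_fourierCoef l hg).toLp,
      (memLp_fourierCoef l hf).coeFn_toLp, (memLp_fourierCoef l hg).coeFn_toLp,
      fourierCoef_sub l hf hg] with y h1 h2 h3 h4
    rw [h1, Pi.sub_apply, h2, h3, h4]
  rw [← real_inner_self_eq_norm_sq, inner_congr e e]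
  congr 1; funext y
  simp only [dot]
  rw [← Complex.normSq_eq_norm_sq, Complex.normSq_apply]

theorem continuous_toLp_fourierCoef (l : ℤ) {F : ℝ → ℝ × ℝ → ℝ} (hF : ∀ t, MemLp (F t) 2 cyl)
    (h : ∀ t, Tendsto (fun s => normSq fun p => F s p - F t p) (𝓝 t) (𝓝 0)) :
    Continuous fun t => (memLp_fourierCoef l (hF t)).toLp := by
  refine continuous_iff_continuousAt.2 fun t => ?_
  rw [ContinuousAt, tendsto_iff_norm_sub_tendsto_zero]
  have h1 : Tendsto (fun s => 1 / (2 * Real.pi) * normSq fun p => F s p - F t p) (𝓝 t) (𝓝 0) := by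
    simpa using (h t).const_mul (1 / (2 * Real.pi))
  have h2 := (squeeze_zero (fun s => sq_nonneg _)
    (fun s => norm_toLp_fourierCoef_sub_sq_le l (hF s) (hF t)) h1).sqrt
  simpa [Real.sqrt_sq (norm_nonneg _)] using h2

theorem continuous_of_norm_sub_le {E F : Type*} [SeminormedAddCommGroup E]
    [SeminormedAddCommGroup F] {u : ℝ → E} {v : ℝ → F} (hu : Continuous u)
    (h : ∀ s t, ‖v s - v t‖ ≤ ‖u s - u t‖) : Continuous v := by
  refine continuous_iff_continuousAt.2 fun t => ?_
  rw [ContinuousAt, tendsto_iff_norm_sub_tendsto_zero]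
  exact squeeze_zero (fun s => norm_nonneg _) (fun s => h s t)
    (tendsto_iff_norm_sub_tendsto_zero.1 (hu.tendsto t))

/-- Elliptic estimate for the stream function. -/
theorem IsStream.norm_le {k : ℝ} {U B B1 : L2C} (h : IsStream k U B B1) (hk : 1 ≤ k) :
    ‖B‖ ≤ ‖U‖ ∧ ‖B1‖ ≤ ‖U‖ := by
  have e := h.energy
  simp only [real_inner_self_eq_norm_sq] at e
  have c := (abs_le.1 (abs_real_inner_le_norm B U)).1
  have hk2 : 1 ≤ k ^ 2 := one_le_pow₀ hk
  have hB : ‖B‖ ≤ ‖U‖ := by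
    by_contra! hlt
    have : ‖B‖ * ‖U‖ < ‖B‖ * ‖B‖ :=
      mul_lt_mul_of_pos_left hlt ((norm_nonneg U).trans_lt hlt)
    nlinarith [sq_nonneg ‖B1‖, sq_nonneg ‖B‖]
  refine ⟨hB, ?_⟩
  refine abs_le_of_sq_le_sq' ?_ (norm_nonneg _) |>.2
  nlinarith [norm_nonneg U, sq_nonneg ‖B‖]

theorem memLp_fourierCoef_of_band {k : ℕ} (hk : 1 ≤ k) {f : ℝ × ℝ → ℝ}
    (h : MemLp (band k f) 2 cyl) : MemLp (fourierCoef k f) 2 := by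
  have := memLp_fourierCoef k h
  rwa [band_eq_wave hk, fourierCoef_wave hk] at this

/-- `Q_k` is the energy of the mode, up to the factor `4π`. -/
theorem Q_eq {k : ℕ} (hk : 1 ≤ k) {f g : ℝ × ℝ → ℝ} {U V B B1 : L2C}
    (hU : U =ᵐ[volume] fourierCoef k f) (hB : B =ᵐ[volume] fourierCoef k g) (hV : IsMulY U V)
    (hB1 : WDc B B1) : Q k f g = 4 * Real.pi * modeEnergy k U V B B1 := by
  have mU : MemLp (fourierCoef k f) 2 := (memLp_congr_ae hU).1 (Lp.memLp U)
  have mB : MemLp (fourierCoef k g) 2 := (memLp_congr_ae hB).1 (Lp.memLp B)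
  have eV : V =ᵐ[volume] fun y : ℝ => (y : ℂ) * fourierCoef k f y := by
    filter_upwards [hV, hU] with y h1 h2
    rw [h1, h2]
  have mV : MemLp (fun y : ℝ => (y : ℂ) * fourierCoef k f y) 2 := (memLp_congr_ae eV).1 (Lp.memLp V)
  have w : WDc (fourierCoef k g) B1 := hB1.congr hB (ae_eq_refl _)
  rw [Q, band_eq_wave hk, band_eq_wave hk, mulY_wave, normSq_wave hk mU, normSq_wave hk mV,
    gradNormSq_wave hk w mB (Lp.memLp B1), modeEnergy, inner_congr hU hU, inner_congr eV eV,
    inner_congr hB hB, inner_eq]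
  ring

namespace IsSolution

variable {ν : ℝ} {ω ψ : ℝ → ℝ × ℝ → ℝ}

/-- Each Fourier mode of a solution is a weak solution of the mode equation. -/
theorem exists_isModeSolution (S : IsSolution ν ω ψ) {k : ℕ} (hk : 1 ≤ k) :
    ∃ U V B B1 : ℝ → L2C, IsModeSolution ν k U V B B1 ∧
      ∀ t, 0 ≤ t → U t =ᵐ[volume] fourierCoef k (ω t) ∧ B t =ᵐ[volume] fourierCoef k (ψ t) := by
  -- Time is frozen at `0` on the negative axis.
  have h0 : ∀ t : ℝ, 0 ≤ max t 0 := fun t => le_max_right _ _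
  have hmax : ∀ t, Tendsto (fun s : ℝ => max s 0) (𝓝 t) (𝓝[Set.Ici 0] (max t 0)) := fun t =>
    tendsto_nhdsWithin_iff.2 ⟨(continuous_id.max continuous_const).tendsto t,
      Eventually.of_forall h0⟩
  have mω : ∀ t, MemLp (ω (max t 0)) 2 cyl := fun t => (S.memX _ (h0 t)).1
  have mY : ∀ t, MemLp (mulY (ω (max t 0))) 2 cyl := fun t => (S.memX _ (h0 t)).2
  have mψ : ∀ t, MemLp (fourierCoef k (ψ (max t 0))) 2 := fun t =>
    memLp_fourierCoef_of_band hk (S.stream_H1 _ (h0 t) k hk).1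
  have nonneg : ∀ f : ℝ × ℝ → ℝ, 0 ≤ normSq f := fun f => integral_nonneg fun p => sq_nonneg _
  let U : ℝ → L2C := fun t => (memLp_fourierCoef k (mω t)).toLp
  let V : ℝ → L2C := fun t => (memLp_fourierCoef k (mY t)).toLp
  let B : ℝ → L2C := fun t => (mψ t).toLp
  have eU : ∀ t, U t =ᵐ[volume] fourierCoef k (ω (max t 0)) := fun t => MemLp.coeFn_toLp _
  have eB : ∀ t, B t =ᵐ[volume] fourierCoef k (ψ (max t 0)) := fun t => MemLp.coeFn_toLp _
  have tω : ∀ t, IsTestable (ω (max t 0)) := fun t => isTestable_of_memLp (mω t)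
  have tψ : ∀ t, IsTestable (ψ (max t 0)) := fun t =>
    isTestable_of_integrableOn (S.stream_locInt _ (h0 t))
  have hst : ∀ t, ∃ B1 : L2C, IsStream k (U t) (B t) B1 := fun t =>
    exists_isStream (tω t) (tψ t) (eU t) (eB t) (S.stream_eq _ (h0 t))
  -- No continuity is needed of this choice: it follows from the elliptic estimate.
  choose B1 hB1 using hst
  have cU : Continuous U := continuous_toLp_fourierCoef k mω fun t =>
    squeeze_zero (fun s => nonneg _)
      (fun s => le_add_of_nonneg_right (nonneg _)) ((S.cont _ (h0 t)).comp (hmax t))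
  have cV : Continuous V := continuous_toLp_fourierCoef k mY fun t => by
    refine squeeze_zero (fun s => nonneg _) (fun s => ?_) ((S.cont _ (h0 t)).comp (hmax t))
    refine le_trans (le_of_eq ?_) (le_add_of_nonneg_left (nonneg _))
    congr 1; funext p
    simp only [mulY, mul_sub]
  have hk' : (1 : ℝ) ≤ k := by exact_mod_cast hk
  have hdiff : ∀ s t, IsStream k (U s - U t) (B s - B t) (B1 s - B1 t) := fun s t =>
    (isLin_stream (k : ℝ)).sub (z := ((U s, B s), B1 s)) (w := ((U t, B t), B1 t)) (hB1 s) (hB1 t)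
  have pos : ∀ {t : ℝ}, 0 ≤ t → max t 0 = t := fun ht => max_eq_left ht
  refine ⟨U, V, B, B1, ⟨cU, cV, continuous_of_norm_sub_le cU fun s t => ((hdiff s t).norm_le hk').1,
    continuous_of_norm_sub_le cU fun s t => ((hdiff s t).norm_le hk').2, fun t _ => ?_,
    fun t _ => hB1 t, fun t ht η hη => ?_, fun t ht η hη => ?_⟩, fun t ht => ?_⟩
  · filter_upwards [(memLp_fourierCoef k (mY t)).coeFn_toLp, eU t] with y h1 h2
    rw [h2]
    exact h1.trans (fourierCoef_mulY k _ y)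
  · have e := S.vort_eq t ht _ (hη.isTest_cos k)
    have e1 := integral_test_cos (tω t) (eU t) hη
    have e2 := integral_test_cos (tω 0) (eU 0) hη
    rw [pos ht] at e1
    rw [max_self] at e2
    rw [e1, e2, intervalIntegral.integral_congr (g := fun s =>
      2 * Real.pi * evoRe ν k η (U s) (B s)), intervalIntegral.integral_const_mul, ← mul_sub] at e
    · exact mul_left_cancel₀ two_pi_pos.ne' e
    · intro s hs
      rw [Set.uIcc_of_le ht] at hs
      have := integral_vort_cos ν (tω s) (tψ s) (eU s) (eB s) hη
      rw [pos hs.1] at this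
      exact this
  · have e := S.vort_eq t ht _ (hη.isTest_sin k)
    have e1 := integral_test_sin (tω t) (eU t) hη
    have e2 := integral_test_sin (tω 0) (eU 0) hη
    rw [pos ht] at e1
    rw [max_self] at e2
    rw [e1, e2, intervalIntegral.integral_congr (g := fun s =>
      -(2 * Real.pi) * evoIm ν k η (U s) (B s)), intervalIntegral.integral_const_mul,
      ← mul_sub] at e
    · exact mul_left_cancel₀ (neg_ne_zero.2 two_pi_pos.ne') e
    · intro s hs
      rw [Set.uIcc_of_le ht] at hs
      have := integral_vort_sin ν (tω s) (tψ s) (eU s) (eB s) hη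
      rw [pos hs.1] at this
      exact this
  · have h1 := eU t
    have h2 := eB t
    rw [pos ht] at h1 h2
    exact ⟨h1, h2⟩

end IsSolution

end Poiseuille

theorem corollary2p2 :
    1 / 20 ≤ Poiseuille.ε₀ ∧
    ∀ ν : ℝ, 0 < ν → ν ≤ 1 →
    ∀ ω ψ : ℝ → ℝ × ℝ → ℝ, Poiseuille.IsSolution ν ω ψ →
    ∀ k : ℕ, 1 ≤ k → ∀ t : ℝ, 0 ≤ t →
      Poiseuille.Q k (ω t) (ψ t) ≤
        Poiseuille.C₀ ^ 2 * Poiseuille.Q k (ω 0) (ψ 0) *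
          Real.exp (-2 * Poiseuille.ε₀ * Poiseuille.rate ν k * t) := by
  refine ⟨Poiseuille.one_div_twenty_le_ε₀, fun ν hν hν1 ω ψ S k hk t ht => ?_⟩
  obtain ⟨U, V, B, B1, M, h⟩ := S.exists_isModeSolution hk
  have hQ : ∀ t, 0 ≤ t → Poiseuille.Q k (ω t) (ψ t) =
      4 * Real.pi * Poiseuille.modeEnergy k (U t) (V t) (B t) (B1 t) := fun t ht =>
    Poiseuille.Q_eq hk (h t ht).1 (h t ht).2 (M.mulY t ht) (M.stream t ht).first
  have hd := M.decay hν hν1 (by exact_mod_cast hk) ht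
  rw [hQ t ht, hQ 0 le_rfl, Poiseuille.rate]
  calc _ ≤ 4 * Real.pi * _ := mul_le_mul_of_nonneg_left hd (by positivity)
    _ = _ := by ring
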